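/- Let $q$ be a prime power and identify the elements of $\mathbb F_q$ with the digits $0,1,\dots,q-1$ by a bijection that sends $0$ to $0$ and $1$ to $1$. For $0\le k\le n$ let $\mathcal G_q(n,k)$ be the set of $k$-dimensional subspaces of $\mathbb F_q^n$. For $X\in\mathcal G_q(n,k)$ let $RE(X)$ be its $k\times n$ generator matrix in reduced row echelon form, let $v(X)\in\{0,1\}^n$ be the vector with ones exactly in the columns of the leading coefficients of $RE(X)$, and let the extended representation $EXT(X)$ be the $(k+1)\times n$ matrix with first row $v(X)$ and last $k$ rows $RE(X)$. Read each column of such a matrix as an integer in base $q$, with the most significant digit on top, and order $\mathcal G_q(n,k)$ by $X<Y$ if, in the rightmost column in which $EXT(X)$ and $EXT(Y)$ differ, the column of $EXT(X)$ is the smaller integer. Let $Ind_2(X)=|\{Y\in\mathcal G_q(n,k): Y<X\}|$ be the lexicographic index of $X$. Time is the number of $q$-ary digit operations of a random access machine: integers have base-$q$ length, an addition, subtraction, comparison, load or store is charged the total length of the numbers involved (addresses included), and a multiplication or a division with remainder is charged the product of the lengths of its operands. Then there are two such machine programs (independent of $q,n,k$, which are part of the input) and an absolute constant $C$ such that, for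 all $q$ and all $0\le k\le n$: 1. (Encoding) for every $X\in\mathcal G_q(n,k)$, the first program, given $EXT(X)$, halts with the base-$q$ digits of $Ind_2(X)$ as its output; 2. (Decoding) for every integer $0\le i<|\mathcal G_q(n,k)|$ there is an $X\in\mathcal G_q(n,k)$ with $Ind_2(X)=i$ such that the second program, given the base-$q$ digits of $i$, halts with $EXT(X)$ as its output; and if $n\ge 3$ and $0<k<n$, both programs run in time at most $C\,nk(n-k)\log n\log\log n$. That is, encoding and decoding based on the extended representation have complexity $O(nk(n-k)\log n\log\log n)$. -/

import Mathlib

/-! ### Random access machine programs with digit cost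

Programs of a random access machine, in structured form.  Variables and array cells hold natural
numbers.  Time is counted in `q`-ary digit operations: every instruction is charged according to
the number of base-`q` digits of the numbers (addresses included) that it handles, linearly for
addition, subtraction, comparison and memory access, and with the schoolbook cost for
multiplication and division (logarithmic cost criterion). -/

namespace GrassEnc

/-- An operand of an instruction: a literal or a variable. -/
inductive Operand
  | lit (c : ℕ)
  | var (x : ℕ)

/-- Arithmetic instructions on natural numbers (`sub` is truncated, `div` and `mod` are Euclidean
division). -/
inductive ArithOp
  | add | sub | mul | div | mod

/-- Programs. -/
inductive Prog
  | skip
  /-- `x := a ∘ b` -/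
  | arith (x : ℕ) (f : ArithOp) (a b : Operand)
  /-- `x := A[i]`, where `A` is the name of an array -/
  | load (x : ℕ) (A : ℕ) (i : Operand)
  /-- `A[i] := a` -/
  | store (A : ℕ) (i a : Operand)
  | seq (P Q : Prog)
  /-- `if a < b then P else Q` -/
  | ite (a b : Operand) (P Q : Prog)
  /-- `while a < b do P` -/
  | while (a b : Operand) (P : Prog)

/-- A memory state: the values of the variables and the contents of the arrays. -/
structure State where
  var : ℕ → ℕ
  arr : ℕ → ℕ → ℕ

/-- The value of an operand. -/
def Operand.val (s : State) : Operand → ℕ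
  | .lit c => c
  | .var x => s.var x

/-- The result of an arithmetic instruction. -/
def ArithOp.eval : ArithOp → ℕ → ℕ → ℕ
  | .add, a, b => a + b
  | .sub, a, b => a - b
  | .mul, a, b => a * b
  | .div, a, b => a / b
  | .mod, a, b => a % b

/-- The number of base-`q` digits of `a` (the number `0` has one digit). -/
def digitLen (q a : ℕ) : ℕ := Nat.log q a + 1

/-- The cost of an arithmetic instruction, in base-`q` digit operations. -/
def ArithOp.cost (q : ℕ) : ArithOp → ℕ → ℕ → ℕ
  | .add, a, b => digitLen q a + digitLen q b
  | .sub, a, b => digitLen q a + digitLen q b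
  | .mul, a, b => digitLen q a * digitLen q b
  | .div, a, b => digitLen q a * digitLen q b
  | .mod, a, b => digitLen q a * digitLen q b

/-- Assignment to a variable. -/
def State.setVar (s : State) (x v : ℕ) : State :=
  { s with var := Function.update s.var x v }

/-- Assignment to an array cell. -/
def State.setArr (s : State) (A i v : ℕ) : State :=
  { s with arr := Function.update s.arr A (Function.update (s.arr A) i v) }

/-- `Exec q P s s' t`: the program `P`, started in the state `s`, halts in the state `s'`, and the
run costs `t` base-`q` digit operations. -/
inductive Exec (q : ℕ) : Prog → State → State → ℕ → Prop
  | skip (s : State) : Exec q .skip s s 0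
  | arith (s : State) (x : ℕ) (f : ArithOp) (a b : Operand) :
      Exec q (.arith x f a b) s (s.setVar x (f.eval (a.val s) (b.val s)))
        (f.cost q (a.val s) (b.val s))
  | load (s : State) (x A : ℕ) (i : Operand) :
      Exec q (.load x A i) s (s.setVar x (s.arr A (i.val s)))
        (digitLen q (i.val s) + digitLen q (s.arr A (i.val s)))
  | store (s : State) (A : ℕ) (i a : Operand) :
      Exec q (.store A i a) s (s.setArr A (i.val s) (a.val s))
        (digitLen q (i.val s) + digitLen q (a.val s))
  | seq {P Q : Prog} {s s' s'' : State} {t t' : ℕ} :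
      Exec q P s s' t → Exec q Q s' s'' t' → Exec q (.seq P Q) s s'' (t + t')
  | ite_true {a b : Operand} {P Q : Prog} {s s' : State} {t : ℕ} :
      a.val s < b.val s → Exec q P s s' t →
      Exec q (.ite a b P Q) s s' (digitLen q (a.val s) + digitLen q (b.val s) + t)
  | ite_false {a b : Operand} {P Q : Prog} {s s' : State} {t : ℕ} :
      ¬ a.val s < b.val s → Exec q Q s s' t →
      Exec q (.ite a b P Q) s s' (digitLen q (a.val s) + digitLen q (b.val s) + t)
  | while_true {a b : Operand} {P : Prog} {s s' s'' : State} {t t' : ℕ} :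
      a.val s < b.val s → Exec q P s s' t → Exec q (.while a b P) s' s'' t' →
      Exec q (.while a b P) s s'' (digitLen q (a.val s) + digitLen q (b.val s) + t + t')
  | while_false {a b : Operand} {P : Prog} {s : State} :
      ¬ a.val s < b.val s →
      Exec q (.while a b P) s s (digitLen q (a.val s) + digitLen q (b.val s))

/-- The initial state: variables `0, 1, 2` hold `q, n, k`, array `0` holds the input, and
everything else is `0`. -/
def initState (q n k : ℕ) (input : ℕ → ℕ) : State where
  var := fun x => if x = 0 then q else if x = 1 then n else if x = 2 then k else 0
  arr := fun A i => if A = 0 then input i else 0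

/-- The array of the base-`q` digits of `i`, least significant digit first. -/
def digitArray (q i : ℕ) : ℕ → ℕ := fun t => i / q ^ t % q

/-- The array that holds a matrix row by row. -/
def matArray {a b : ℕ} (M : Matrix (Fin a) (Fin b) ℕ) : ℕ → ℕ := fun t =>
  if h : t < a * b then
    M (finProdFinEquiv.symm ⟨t, h⟩).1 (finProdFinEquiv.symm ⟨t, h⟩).2
  else 0

/-! ### The Grassmannian and the extended representation -/

section Grassmannian

variable {F : Type*} [Field F] {n k : ℕ}

/-- The set of all `k`-dimensional subspaces of `F ^ n`. -/
def Gr (F : Type*) [Field F] (n k : ℕ) : Set (Submodule F (Fin n → F)) :=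
  {X | Module.finrank F X = k}

/-- `RE(X)`: the generator matrix of `X ∈ Gr F n k` in reduced row echelon form (there is exactly
one; its rows span `X`, so that it has rank `k`). -/
noncomputable def RE (k : ℕ) (X : Submodule F (Fin n → F)) : Matrix (Fin k) (Fin n) F :=
  Classical.epsilon fun M => M.IsReducedRowEchelon ∧ Submodule.span F (Set.range fun r => M r) = X

open Classical in
/-- The identifying vector `v(X)`: ones in the columns of the leading coefficients of `RE(X)`. -/
noncomputable def idVec (k : ℕ) (X : Submodule F (Fin n → F)) : Fin n → ℕ := fun c =>
  if ∃ r, (RE k X).IsLeadingEntry r c then 1 else 0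

variable [Fintype F]

/-- The extended representation `EXT(X)`: the first row is `v(X)`, the other `k` rows form `RE(X)`.
The field elements are written as the digits `0, …, q - 1` by means of `σ`. -/
noncomputable def EXT (σ : F ≃ Fin (Fintype.card F)) (k : ℕ) (X : Submodule F (Fin n → F)) :
    Matrix (Fin (k + 1)) (Fin n) ℕ :=
  Matrix.of (Fin.cons (idVec k X) fun r c => (σ (RE k X r c) : ℕ))

/-- The integer whose base-`q` digits form column `c` of `M`, most significant digit on top. -/
def colValue (q : ℕ) (M : Matrix (Fin (k + 1)) (Fin n) ℕ) (c : Fin n) : ℕ :=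
  ∑ r : Fin (k + 1), M r c * q ^ (k - (r : ℕ))

/-- The order `X < Y` based on the extended representation: compare the columns from right to left;
in the first column where `EXT(X)` and `EXT(Y)` differ, `EXT(X)` has the smaller value. -/
def extLT (σ : F ≃ Fin (Fintype.card F)) (k : ℕ) (X Y : Submodule F (Fin n → F)) : Prop :=
  ∃ c : Fin n, (∀ c', c < c' → ∀ r, EXT σ k X r c' = EXT σ k Y r c') ∧
    colValue (Fintype.card F) (EXT σ k X) c < colValue (Fintype.card F) (EXT σ k Y) c

/-- `Ind₂(X)`: the lexicographic index of `X` in the Grassmannian, that is, the number of elements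
that precede `X`. -/
noncomputable def Ind₂ (σ : F ≃ Fin (Fintype.card F)) (k : ℕ) (X : Submodule F (Fin n → F)) : ℕ :=
  {Y | Y ∈ Gr F n k ∧ extLT σ k Y X}.ncard

end Grassmannian

end GrassEnc

/-! The index is an enumerative code. In a matrix with `a + 1` pivots and `b + 1` free columns the
last column is either free, with `q ^ (a + 1)` possible contents and a remainder counted by `gauss q
(a + 1) b`, or a pivot column, with a remainder counted by `gauss q a (b + 1)`. Since `v(X)`
supplies the top digit, free columns precede pivot columns. Hence the index is a sum over columns. A
column with `a` pivots and `b` free columns to its left contributes `x * gauss q a b` if it is free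
with digits `x`. It contributes `q ^ (a + 1) * gauss q (a + 1) (b - 1)` if it is a pivot column and
`b > 0`, and nothing if `b = 0`. This sum is `idx`; `idx_lt_idx`, `exists_valid_idx` and the
uniqueness of the echelon form give `bijOn_idx` and `Ind₂_eq`.

Evaluating the sum directly would multiply long numbers. The programs instead store the partial
index `I` divided by the current Gaussian coefficient, as a fixed point number `Z` close to `(I + 1
/ q) * q ^ (e + a * b) / gauss q a b`. Adding `x * gauss q a b` to `I` then amounts to writing the
digits of `x` from position `e + a * b` on, into cells that are still zero. Moving to a neighbouring
coefficient multiplies `Z` by `(1 - q ^ (-u)) / (1 - q ^ (-v))`. The division is a geometric series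
of shifts, computed by one downward pass `c t = d t + c (t + v)`; the multiplication is one upward
subtraction pass with carries. Both take linearly many operations on short numbers.

One rescaling adds an error of at most `2 ^ n * (len + 2)` (`Approx.rescale`), and there are at most
`3 * n` of them, so `4 * n + 8` fractional digits suffice; the offset `1 / q` absorbs errors of
either sign (`Approx.bracket`). The encoder runs from `(0, 0)` to `(k, n - k)` and then down to `(0,
n - k)`, where the coefficient is `1` and the integer part of the number is the index. The decoder
runs back along this way and reads off each column before erasing it.

There are `O(n)` rescalings, each with `O(k (n - k))` operations on numbers of `O(log n)` base-`q`
digits. The resulting `O(n k (n - k) log n)` is stronger than the claim: for `n ≥ 3` the factor `log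
log n` is bounded below by a positive constant. -/

namespace GrassEnc

/-! ### Gaussian binomial coefficients -/

/-- The Gaussian binomial coefficient `[a + b, a]_q`. -/
def gauss (q : ℕ) : ℕ → ℕ → ℕ
  | 0, _ => 1
  | _ + 1, 0 => 1
  | a + 1, b + 1 => q ^ (a + 1) * gauss q (a + 1) b + gauss q a (b + 1)

@[simp] theorem gauss_zero_left (q b : ℕ) : gauss q 0 b = 1 := by simp [gauss]

@[simp] theorem gauss_zero_right (q a : ℕ) : gauss q a 0 = 1 := by cases a <;> simp [gauss]

theorem gauss_succ_succ (q a b : ℕ) :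
    gauss q (a + 1) (b + 1) = q ^ (a + 1) * gauss q (a + 1) b + gauss q a (b + 1) := by
  simp [gauss]

theorem pow_le_gauss (q : ℕ) : ∀ a b : ℕ, q ^ (a * b) ≤ gauss q a b
  | 0, b => by simp
  | a + 1, 0 => by simp
  | a + 1, b + 1 => by
    rw [gauss_succ_succ]
    calc q ^ ((a + 1) * (b + 1)) = q ^ (a + 1) * q ^ ((a + 1) * b) := by ring
      _ ≤ q ^ (a + 1) * gauss q (a + 1) b := Nat.mul_le_mul_left _ (pow_le_gauss q (a + 1) b)
      _ ≤ _ := Nat.le_add_right _ _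

/-- The two summands of the recursion obey the same bound, so each step costs a factor `2`. The
crude `2 ^ (a + b)` is good enough because the number of fractional digits is linear in `n`. -/
theorem gauss_le {q : ℕ} (hq : 0 < q) : ∀ a b : ℕ, gauss q a b ≤ 2 ^ (a + b) * q ^ (a * b)
  | 0, b => by simpa using Nat.one_le_two_pow
  | a + 1, 0 => by simpa using Nat.one_le_two_pow
  | a + 1, b + 1 => by
    have h1 := gauss_le hq (a + 1) b
    have h2 := gauss_le hq a (b + 1)
    rw [gauss_succ_succ]
    calc q ^ (a + 1) * gauss q (a + 1) b + gauss q a (b + 1)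
        ≤ q ^ (a + 1) * (2 ^ (a + 1 + b) * q ^ ((a + 1) * b)) +
            2 ^ (a + (b + 1)) * q ^ (a * (b + 1)) :=
          Nat.add_le_add (Nat.mul_le_mul_left _ h1) h2
      _ ≤ q ^ (a + 1) * (2 ^ (a + 1 + b) * q ^ ((a + 1) * b)) +
            2 ^ (a + (b + 1)) * q ^ ((a + 1) * (b + 1)) := by
          gcongr
          omega
      _ = 2 ^ (a + 1 + (b + 1)) * q ^ ((a + 1) * (b + 1)) := by ring

theorem gauss_pos {q : ℕ} (hq : 0 < q) (a b : ℕ) : 0 < gauss q a b :=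
  (Nat.pow_pos hq).trans_le (pow_le_gauss q a b)

theorem gauss_le_gauss_succ_right {q : ℕ} (hq : 0 < q) (a b : ℕ) :
    gauss q a b ≤ gauss q a (b + 1) := by
  cases a with
  | zero => simp
  | succ a =>
    rw [gauss_succ_succ]
    exact (Nat.le_mul_of_pos_left _ (Nat.pow_pos hq)).trans (Nat.le_add_right _ _)

theorem gauss_le_gauss_succ_left (q a b : ℕ) :
    gauss q a b ≤ gauss q (a + 1) b := by
  cases b with
  | zero => simp
  | succ b => rw [gauss_succ_succ]; exact Nat.le_add_left _ _

theorem gauss_mono {q : ℕ} (hq : 0 < q) {a b a' b' : ℕ} (ha : a ≤ a') (hb : b ≤ b') :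
    gauss q a b ≤ gauss q a' b' :=
  (monotone_nat_of_le_succ (f := fun a => gauss q a b)
    (fun a => gauss_le_gauss_succ_left q a b) ha).trans
  (monotone_nat_of_le_succ (f := fun b => gauss q a' b)
    (fun b => gauss_le_gauss_succ_right hq a' b) hb)

/-- The product formula, written without division. The two identities are proved together: either
one at `a + b = s + 1` needs both at `s`, in order to exchange `gauss q a (b + 1)` for `gauss q (a +
1) b`. -/
theorem gauss_ratios (q : ℕ) : ∀ s a b : ℕ, a + b = s →
    ((q : ℝ) ^ (a + b + 1) - 1) * gauss q a b = ((q : ℝ) ^ (b + 1) - 1) * gauss q a (b + 1) ∧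
    ((q : ℝ) ^ (a + b + 1) - 1) * gauss q a b = ((q : ℝ) ^ (a + 1) - 1) * gauss q (a + 1) b := by
  intro s
  induction s with
  | zero =>
    intro a b h
    obtain ⟨rfl, rfl⟩ : a = 0 ∧ b = 0 := by omega
    simp
  | succ s ih =>
    intro a b h
    constructor
    · cases a with
      | zero => simp
      | succ a =>
        obtain ⟨h1, h2⟩ := ih a b (by omega)
        rw [gauss_succ_succ]
        push_cast
        have h3 : ((q : ℝ) ^ (b + 1) - 1) * gauss q a (b + 1) =
          ((q : ℝ) ^ (a + 1) - 1) * gauss q (a + 1) b := h1.symm.trans h2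
        rw [mul_add, h3]
        ring
    · cases b with
      | zero => simp
      | succ b =>
        obtain ⟨h1, h2⟩ := ih a b (by omega)
        rw [gauss_succ_succ]
        push_cast
        have h3 : ((q : ℝ) ^ (a + 1) - 1) * gauss q (a + 1) b =
          ((q : ℝ) ^ (b + 1) - 1) * gauss q a (b + 1) := h2.symm.trans h1
        rw [mul_add, mul_left_comm, h3]
        ring

/-- The Gaussian binomial coefficient divided by its leading power of `q`. -/
noncomputable def gam (q a b : ℕ) : ℝ := gauss q a b / (q : ℝ) ^ (a * b)

@[simp] theorem gam_zero_left (q b : ℕ) : gam q 0 b = 1 := by simp [gam]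

theorem one_le_gam {q : ℕ} (hq : 0 < q) (a b : ℕ) : 1 ≤ gam q a b := by
  unfold gam
  rw [one_le_div (by positivity)]
  exact_mod_cast pow_le_gauss q a b

theorem gam_le {q : ℕ} (hq : 0 < q) (a b : ℕ) : gam q a b ≤ 2 ^ (a + b) := by
  unfold gam
  rw [div_le_iff₀ (by positivity)]
  exact_mod_cast gauss_le hq a b

/-- The factor `1 - q ^ (-u)`. -/
noncomputable def fac (q u : ℕ) : ℝ := 1 - ((q : ℝ) ^ u)⁻¹

/-- Without the leading power of `q`, neighbouring coefficients differ by a quotient of two numbers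
`1 - q ^ (-u)`. Multiplying by such a number is one shifted subtraction, dividing by it a geometric
series of shifts. -/
theorem gam_succ_right {q : ℕ} (hq : 0 < q) (a b : ℕ) :
    gam q a (b + 1) * fac q (b + 1) = gam q a b * fac q (a + b + 1) := by
  have h := (gauss_ratios q _ a b rfl).1
  have hq' : (q : ℝ) ≠ 0 := by positivity
  unfold gam fac
  have e1 : (1 : ℝ) - ((q : ℝ) ^ (b + 1))⁻¹ = ((q : ℝ) ^ (b + 1) - 1) / (q : ℝ) ^ (b + 1) := by
    field_simp
  have e2 : (1 : ℝ) - ((q : ℝ) ^ (a + b + 1))⁻¹ =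
      ((q : ℝ) ^ (a + b + 1) - 1) / (q : ℝ) ^ (a + b + 1) := by
    field_simp
  rw [e1, e2, div_mul_div_comm, div_mul_div_comm, mul_comm (gauss q a b : ℝ), h,
    mul_comm (gauss q a (b + 1) : ℝ)]
  congr 1
  ring

theorem gam_succ_left {q : ℕ} (hq : 0 < q) (a b : ℕ) :
    gam q (a + 1) b * fac q (a + 1) = gam q a b * fac q (a + b + 1) := by
  have h := (gauss_ratios q _ a b rfl).2
  have hq' : (q : ℝ) ≠ 0 := by positivity
  unfold gam fac
  have e1 : (1 : ℝ) - ((q : ℝ) ^ (a + 1))⁻¹ = ((q : ℝ) ^ (a + 1) - 1) / (q : ℝ) ^ (a + 1) := by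
    field_simp
  have e2 : (1 : ℝ) - ((q : ℝ) ^ (a + b + 1))⁻¹ =
      ((q : ℝ) ^ (a + b + 1) - 1) / (q : ℝ) ^ (a + b + 1) := by
    field_simp
  rw [e1, e2, div_mul_div_comm, div_mul_div_comm, mul_comm (gauss q a b : ℝ), h,
    mul_comm (gauss q (a + 1) b : ℝ)]
  congr 1
  ring

/-- A pivot column needs a diagonal move. Through `(a, b)` it would take two rescalings, but the
common factor `fac q (a + b + 1)` cancels and one is enough. -/
theorem gam_exchange {q : ℕ} (hq : 0 < q) (a b : ℕ) :
    gam q (a + 1) b * fac q (a + 1) = gam q a (b + 1) * fac q (b + 1) :=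
  (gam_succ_left hq a b).trans (gam_succ_right hq a b).symm

theorem fac_nonneg {q : ℕ} (hq : 2 ≤ q) (u : ℕ) : 0 ≤ fac q u := by
  unfold fac
  have : (1 : ℝ) ≤ (q : ℝ) ^ u := one_le_pow₀ (by exact_mod_cast (by omega : 1 ≤ q))
  have := inv_le_one_of_one_le₀ this
  linarith

theorem fac_le_one (q u : ℕ) : fac q u ≤ 1 := by
  unfold fac
  have : (0 : ℝ) ≤ ((q : ℝ) ^ u)⁻¹ := by positivity
  linarith

theorem half_le_fac {q v : ℕ} (hq : 2 ≤ q) (hv : 1 ≤ v) : 1 / 2 ≤ fac q v := by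
  unfold fac
  have h2 : (2 : ℝ) ≤ (q : ℝ) ^ v := by
    calc (2 : ℝ) ≤ q := by exact_mod_cast hq
      _ = (q : ℝ) ^ 1 := (pow_one _).symm
      _ ≤ (q : ℝ) ^ v := pow_le_pow_right₀ (by exact_mod_cast (by omega : 1 ≤ q)) hv
  have : ((q : ℝ) ^ v)⁻¹ ≤ (2 : ℝ)⁻¹ := inv_anti₀ (by norm_num) h2
  norm_num at this ⊢
  linarith

/-! ### Rescaling of a fixed point number -/

/-- An integer approximation of `Z * (1 - q ^ (-u)) / (1 - q ^ (-v))`. -/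
def rescale (q len u v Z : ℕ) : ℕ :=
  ∑ j ∈ Finset.range len, (Z / q ^ (j * v) - Z / q ^ (j * v + u))

theorem abs_natDiv_sub_le (x d : ℕ) : ((x / d : ℕ) : ℝ) ≤ x / d ∧ (x : ℝ) / d ≤ (x / d : ℕ) + 1 := by
  refine ⟨Nat.cast_div_le, ?_⟩
  rw [← Nat.floor_div_eq_div (K := ℝ)]
  exact (Nat.lt_floor_add_one _).le

/-- In each of the `len` terms the two floors err in the same direction, so their difference errs by
at most `1`. The omitted tail of the geometric series contributes at most `1`, which is at most `2 *
fac q v` because `fac q v ≥ 1 / 2`. -/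
theorem rescale_error {q len u v Z : ℕ} (hq : 2 ≤ q) (hv : 1 ≤ v) (hZ : Z < q ^ len) :
    |(rescale q len u v Z : ℝ) * fac q v - Z * fac q u| ≤ (len + 2) * fac q v := by
  have hq0 : (0 : ℝ) < q := by positivity
  set r : ℝ := ((q : ℝ) ^ v)⁻¹ with hr
  have hfv : fac q v = 1 - r := rfl
  have hhalf := half_le_fac hq hv
  have hr0 : 0 ≤ r := by positivity
  have hterm : ∀ j ∈ Finset.range len,
      |((Z / q ^ (j * v) - Z / q ^ (j * v + u) : ℕ) : ℝ) - Z * fac q u * r ^ j| ≤ 1 := by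
    intro j _
    have hle : Z / q ^ (j * v + u) ≤ Z / q ^ (j * v) :=
      Nat.div_le_div_left (Nat.pow_le_pow_right (by omega) (by omega)) (Nat.pow_pos (by omega))
    rw [Nat.cast_sub hle]
    obtain ⟨h1, h2⟩ := abs_natDiv_sub_le Z (q ^ (j * v))
    obtain ⟨h3, h4⟩ := abs_natDiv_sub_le Z (q ^ (j * v + u))
    have e1 : (Z : ℝ) / ((q ^ (j * v) : ℕ) : ℝ) = Z * r ^ j := by
      rw [hr, div_eq_mul_inv, inv_pow, ← pow_mul, mul_comm v j]; push_cast; rfl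
    have e2 : (Z : ℝ) / ((q ^ (j * v + u) : ℕ) : ℝ) = Z * r ^ j * ((q : ℝ) ^ u)⁻¹ := by
      rw [← e1]; push_cast; rw [pow_add]; field_simp
    rw [e1] at h1 h2
    rw [e2] at h3 h4
    have e3 : (Z : ℝ) * fac q u * r ^ j = Z * r ^ j - Z * r ^ j * ((q : ℝ) ^ u)⁻¹ := by
      unfold fac; ring
    rw [e3, abs_le]
    constructor <;> linarith
  have hsum : |(rescale q len u v Z : ℝ) - Z * fac q u * ∑ j ∈ Finset.range len, r ^ j| ≤ len := by
    unfold rescale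
    rw [Nat.cast_sum, Finset.mul_sum, ← Finset.sum_sub_distrib]
    refine (Finset.abs_sum_le_sum_abs _ _).trans ((Finset.sum_le_sum hterm).trans ?_)
    simp
  have hgeom : (∑ j ∈ Finset.range len, r ^ j) * fac q v = 1 - r ^ len := by
    have := geom_sum_mul_neg r len
    rw [hfv]; exact this
  -- As `Z` has at most `len` digits and each term shifts by `v ≥ 1`, `len` terms of the series are
  -- enough.
  have htail : (Z : ℝ) * r ^ len ≤ 1 := by
    rw [hr, inv_pow, ← pow_mul, ← div_eq_mul_inv, div_le_one (by positivity)]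
    have : Z ≤ q ^ (v * len) :=
      hZ.le.trans (Nat.pow_le_pow_right (by omega) (Nat.le_mul_of_pos_left _ hv))
    exact_mod_cast this
  have htail0 : 0 ≤ (Z : ℝ) * r ^ len := by positivity
  have e : (rescale q len u v Z : ℝ) * fac q v - Z * fac q u =
      ((rescale q len u v Z : ℝ) - Z * fac q u * ∑ j ∈ Finset.range len, r ^ j) * fac q v -
        fac q u * (Z * r ^ len) := by
    have : (Z : ℝ) * fac q u * (∑ j ∈ Finset.range len, r ^ j) * fac q v =
        Z * fac q u * (1 - r ^ len) := by rw [mul_assoc, hgeom]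
    rw [sub_mul, this]; ring
  rw [e]
  have b1 : |((rescale q len u v Z : ℝ) - Z * fac q u * ∑ j ∈ Finset.range len, r ^ j) * fac q v|
      ≤ len * fac q v := by
    rw [abs_mul, abs_of_nonneg (fac_nonneg hq v)]
    exact mul_le_mul_of_nonneg_right hsum (fac_nonneg hq v)
  have b2 : |fac q u * (Z * r ^ len)| ≤ 1 := by
    rw [abs_of_nonneg (mul_nonneg (fac_nonneg hq u) htail0)]
    exact mul_le_one₀ (fac_le_one q u) htail0 htail
  refine (abs_sub _ _).trans ?_
  nlinarith

/-! ### Error analysis of the fixed point numbers -/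

/-- The relation kept by the fixed point arithmetic: `Z` is, up to an error of `s` roundings,
`(I + 1 / q) * q ^ (e + a * b) / gauss q a b`. -/
def Approx (q n e len s a b I Z : ℕ) : Prop :=
  |(Z : ℝ) * gam q a b - (I + (q : ℝ)⁻¹) * (q : ℝ) ^ e| ≤ s * (2 ^ n * (len + 2))

/-- The product `Z * gam q a b` is what stays constant: by `hg` an exact rescaling would preserve
it, so the old error is carried over unchanged. Only the new rounding is added, magnified by `gam q
a' b' ≤ 2 ^ n`. -/
theorem Approx.rescale {q n e len s a b a' b' I Z u v : ℕ} (hq : 2 ≤ q) (hv : 1 ≤ v)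
    (hZ : Z < q ^ len) (hab : a' + b' ≤ n) (hg : gam q a' b' * fac q u = gam q a b * fac q v)
    (h : Approx q n e len s a b I Z) :
    Approx q n e len (s + 1) a' b' I (rescale q len u v Z) := by
  unfold Approx at *
  have herr := rescale_error (u := u) hq hv hZ
  have hfv : 0 < fac q v := by linarith [half_le_fac hq hv]
  have hg0 : 0 ≤ gam q a' b' := by linarith [one_le_gam (by omega : 0 < q) a' b']
  have hgn : gam q a' b' ≤ 2 ^ n :=
    (gam_le (by omega) a' b').trans (pow_le_pow_right₀ (by norm_num) hab)
  set R : ℝ := (GrassEnc.rescale q len u v Z : ℝ)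
  set T : ℝ := (I + (q : ℝ)⁻¹) * (q : ℝ) ^ e
  have e1 : (R * gam q a' b' - T) * fac q v =
      (R * fac q v - Z * fac q u) * gam q a' b' + (Z * gam q a b - T) * fac q v := by
    linear_combination (Z : ℝ) * hg
  have e2 : |R * gam q a' b' - T| * fac q v ≤ ((s + 1 : ℕ) * (2 ^ n * (len + 2))) * fac q v := by
    rw [← abs_of_pos hfv, ← abs_mul, abs_of_pos hfv, e1]
    refine (abs_add_le _ _).trans ?_
    rw [abs_mul, abs_mul, abs_of_pos hfv, abs_of_nonneg hg0]
    have b1 : |R * fac q v - Z * fac q u| * gam q a' b' ≤ ((len + 2) * fac q v) * 2 ^ n :=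
      mul_le_mul herr hgn hg0 (by positivity)
    have b2 := mul_le_mul_of_nonneg_right h hfv.le
    push_cast
    nlinarith
  exact le_of_mul_le_mul_right e2 hfv

/-- Exact, because `gauss q a b = gam q a b * q ^ (a * b)`: both added terms amount to `x * gauss q
a b * q ^ e`. The encoder adds a column with it, the decoder removes one. -/
theorem Approx.add_mul {q n e len s a b I Z : ℕ} (hq : 0 < q) (x : ℕ) :
    Approx q n e len s a b (I + x * gauss q a b) (Z + x * q ^ (e + a * b)) ↔
      Approx q n e len s a b I Z := by
  unfold Approx
  have : (((Z + x * q ^ (e + a * b) : ℕ) : ℝ)) * gam q a b -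
      (((I + x * gauss q a b : ℕ) : ℝ) + (q : ℝ)⁻¹) * (q : ℝ) ^ e =
      (Z : ℝ) * gam q a b - (I + (q : ℝ)⁻¹) * (q : ℝ) ^ e := by
    unfold gam
    push_cast
    rw [pow_add]
    have : (q : ℝ) ≠ 0 := by positivity
    field_simp
    ring
  rw [this]

theorem Approx.start {q n e len a b I : ℕ} (hq : 0 < q) (he : 1 ≤ e) (hab : gam q a b = 1) :
    Approx q n e len 0 a b I (I * q ^ e + q ^ (e - 1)) := by
  obtain ⟨e, rfl⟩ := Nat.exists_eq_add_of_le' he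
  unfold Approx
  have hq' : (q : ℝ) ≠ 0 := by positivity
  have : (((I * q ^ (e + 1) + q ^ (e + 1 - 1) : ℕ) : ℝ)) * gam q a b -
      (I + (q : ℝ)⁻¹) * (q : ℝ) ^ (e + 1) = 0 := by
    rw [hab]
    push_cast
    simp only [pow_succ]
    field_simp
    ring
  rw [this]
  simp

theorem Approx.mono {q n e len s s' a b I Z : ℕ} (hs : s ≤ s')
    (h : Approx q n e len s a b I Z) : Approx q n e len s' a b I Z := by
  unfold Approx at *
  refine h.trans ?_
  gcongr

/-- The count `3 * n` covers two rescalings per column and one for each of the `k ≤ n` steps between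
`(0, n - k)` and `(k, n - k)`. With `len + 2 ≤ 16 * 4 ^ n` the total is at most `48 * 2 ^ (4 * n)`,
which explains the choice of `4 * n + 8` fractional digits. -/
theorem error_small {q n N s len : ℕ} (hq : 2 ≤ q) (hN : N ≤ n * n) (hs : s ≤ 3 * n)
    (hlen : len = 4 * n + 8 + N + n) :
    s * (2 ^ n * (len + 2)) < q ^ (4 * n + 7) := by
  have h1 : n < 2 ^ n := Nat.lt_two_pow_self
  have h2 : 1 ≤ 2 ^ n := Nat.one_le_two_pow
  calc s * (2 ^ n * (len + 2)) ≤ (3 * 2 ^ n) * (2 ^ n * (16 * (2 ^ n * 2 ^ n))) := by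
        gcongr
        · omega
        · subst hlen
          generalize 2 ^ n = x at *
          nlinarith
    _ = 48 * 2 ^ (4 * n) := by ring
    _ < 2 ^ (4 * n + 7) := by
        rw [pow_add]
        have : 0 < 2 ^ (4 * n) := by positivity
        omega
    _ ≤ q ^ (4 * n + 7) := Nat.pow_le_pow_left hq _

/-- A sufficiently good approximation determines the index. -/
theorem Approx.bracket {q n N s a b I Z len : ℕ} (hq : 2 ≤ q) (hN : N ≤ n * n) (hs : s ≤ 3 * n)
    (hlen : len = 4 * n + 8 + N + n) (h : Approx q n (4 * n + 8) len s a b I Z) :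
    I * q ^ (4 * n + 8 + a * b) ≤ Z * gauss q a b ∧
      Z * gauss q a b < (I + 1) * q ^ (4 * n + 8 + a * b) := by
  have herr : (s : ℝ) * (2 ^ n * (len + 2)) < (q : ℝ) ^ (4 * n + 7) := by
    exact_mod_cast error_small hq hN hs hlen
  have hq0 : (0 : ℝ) < q := by positivity
  have hq2 : (2 : ℝ) ≤ q := by exact_mod_cast hq
  unfold Approx at h
  rw [abs_le] at h
  set P : ℝ := (q : ℝ) ^ (4 * n + 7) with hP
  have hP0 : 0 < P := by positivity
  have hPe : (q : ℝ) ^ (4 * n + 8) = q * P := by rw [hP]; ring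
  have e1 : (I + (q : ℝ)⁻¹) * (q : ℝ) ^ (4 * n + 8) = I * (q * P) + P := by
    rw [hPe]; field_simp
  rw [e1] at h
  -- The offset `1 / q` is worth `P` and the error is less than `P`, so the approximated value lies
  -- strictly between `I * (q * P)` and `I * (q * P) + 2 * P`. For `q ≥ 2` this stays below `(I + 1)
  -- * (q * P)`.
  have h2P : 2 * P ≤ q * P := by nlinarith
  have l1 : (I : ℝ) * (q * P) ≤ Z * gam q a b := by linarith [h.1]
  have l2 : (Z : ℝ) * gam q a b < (I + 1) * (q * P) := by linarith [h.2]
  have hU : (0 : ℝ) < (q : ℝ) ^ (a * b) := by positivity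
  have e2 : (Z : ℝ) * gam q a b * (q : ℝ) ^ (a * b) = Z * gauss q a b := by
    unfold gam; field_simp
  have m1 := mul_le_mul_of_nonneg_right l1 hU.le
  have m2 := mul_lt_mul_of_pos_right l2 hU
  rw [e2, ← hPe] at m1 m2
  rw [mul_assoc, ← pow_add] at m1 m2
  constructor
  · exact_mod_cast m1
  · exact_mod_cast m2

/-- The scaling by `q ^ (a * b) / gauss q a b ≤ 1` cannot lengthen the number, so `N + n` integer
and `4 * n + 8` fractional digits always hold it. -/
theorem Approx.lt_pow {q n N s a b I Z len : ℕ} (hq : 2 ≤ q) (hN : N ≤ n * n) (hs : s ≤ 3 * n)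
    (hlen : len = 4 * n + 8 + N + n) (hI : I < q ^ (N + n))
    (h : Approx q n (4 * n + 8) len s a b I Z) : Z < q ^ len := by
  have h1 := (h.bracket hq hN hs hlen).2
  have h2 := pow_le_gauss q a b
  have hU : 0 < q ^ (a * b) := Nat.pow_pos (by omega)
  rw [pow_add, ← mul_assoc] at h1
  have h3 : Z * q ^ (a * b) < (I + 1) * q ^ (4 * n + 8) * q ^ (a * b) :=
    (Nat.mul_le_mul_left _ h2).trans_lt h1
  have h4 := Nat.lt_of_mul_lt_mul_right h3
  calc Z < (I + 1) * q ^ (4 * n + 8) := h4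
    _ ≤ q ^ (N + n) * q ^ (4 * n + 8) := Nat.mul_le_mul_right _ hI
    _ = q ^ len := by rw [hlen, ← pow_add]; congr 1; omega

theorem gauss_le_pow {q n k a b : ℕ} (hq : 2 ≤ q) (hk : k ≤ n) (ha : a ≤ k) (hb : b ≤ n - k) :
    gauss q a b ≤ q ^ (k * (n - k) + n) := by
  calc gauss q a b ≤ gauss q k (n - k) := gauss_mono (by omega) ha hb
    _ ≤ 2 ^ (k + (n - k)) * q ^ (k * (n - k)) := gauss_le (by omega) _ _
    _ ≤ q ^ n * q ^ (k * (n - k)) := by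
        rw [Nat.add_sub_cancel' hk]; gcongr
    _ = _ := by rw [← pow_add, add_comm]

/-! ### Digit arrays -/

theorem digitArray_lt {q : ℕ} (hq : 0 < q) (Z t : ℕ) : digitArray q Z t < q := Nat.mod_lt _ hq

theorem digitArray_eq_zero {q Z m t : ℕ} (hq : 0 < q) (hZ : Z < q ^ m) (ht : m ≤ t) :
    digitArray q Z t = 0 := by
  have : Z < q ^ t := hZ.trans_le (Nat.pow_le_pow_right hq ht)
  simp [digitArray, Nat.div_eq_of_lt this]

theorem digitArray_add (q Z s t : ℕ) : digitArray q Z (t + s) = digitArray q (Z / q ^ s) t := by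
  unfold digitArray
  rw [Nat.div_div_eq_div_mul, ← pow_add, add_comm s t]

theorem sum_digitArray (q : ℕ) (Z m : ℕ) :
    ∑ t ∈ Finset.range m, digitArray q Z t * q ^ t = Z % q ^ m := by
  induction m with
  | zero => simp [Nat.mod_one]
  | succ m ih =>
    rw [Finset.sum_range_succ, ih, Nat.mod_pow_succ, mul_comm (q ^ m)]
    rfl

/-- No carry occurs between the two parts. This is what turns writing digits into free cells into an
addition. -/
theorem digitArray_low_high {q : ℕ} (hq : 0 < q) {lo hi p : ℕ} (hlo : lo < q ^ p) (t : ℕ) :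
    digitArray q (lo + hi * q ^ p) t =
      if t < p then digitArray q lo t else digitArray q hi (t - p) := by
  split_ifs with h
  · obtain ⟨d, rfl⟩ := Nat.exists_eq_add_of_lt h
    unfold digitArray
    have e : hi * q ^ (t + d + 1) = q ^ t * (q * (hi * q ^ d)) := by ring
    rw [e, Nat.add_mul_div_left _ _ (Nat.pow_pos hq), Nat.add_mul_mod_self_left]
  · obtain ⟨d, rfl⟩ := Nat.exists_eq_add_of_le (not_lt.mp h)
    rw [Nat.add_sub_cancel_left, add_comm p d, digitArray_add,
      Nat.add_mul_div_right _ _ (Nat.pow_pos hq), Nat.div_eq_of_lt hlo, zero_add]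

theorem digitArray_zero (q t : ℕ) : digitArray q 0 t = 0 := by simp [digitArray]

theorem digitArray_sum {q : ℕ} (hq : 0 < q) {d : ℕ → ℕ} {m : ℕ} (hd : ∀ t < m, d t < q) :
    (∑ t ∈ Finset.range m, d t * q ^ t) < q ^ m ∧
    ∀ t, digitArray q (∑ t ∈ Finset.range m, d t * q ^ t) t = if t < m then d t else 0 := by
  induction m with
  | zero => simp [digitArray]
  | succ m ih =>
    obtain ⟨h1, h2⟩ := ih fun t ht => hd t (by omega)
    have h3 := hd m (by omega)
    rw [Finset.sum_range_succ]
    constructor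
    · rw [pow_succ]
      nlinarith [Nat.pow_pos (n := m) hq]
    · intro t
      rw [digitArray_low_high hq h1, h2]
      by_cases ht : t < m
      · rw [if_pos ht, if_pos ht, if_pos (by omega)]
      · rw [if_neg ht]
        by_cases htm : t = m
        · subst htm
          simp [digitArray, Nat.mod_eq_of_lt h3]
        · rw [if_neg (by omega)]
          exact digitArray_eq_zero hq (m := 1) (by simpa using h3) (by omega)

theorem sum_digits_lt {q : ℕ} (hq : 0 < q) {d : ℕ → ℕ} {m : ℕ} (hd : ∀ t < m, d t < q) :
    (∑ t ∈ Finset.range m, d t * q ^ t) < q ^ m := (digitArray_sum hq hd).1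

end GrassEnc

namespace GrassEnc

/-! ### A program logic with costs -/

/-- `Tri q B P s c Q`: started in `s`, the program `P` halts in a state that satisfies `Q`, at a
cost of at most `c` linear operations on numbers that are at most `B`. -/
def Tri (q B : ℕ) (P : Prog) (s : State) (c : ℕ) (Q : State → Prop) : Prop :=
  ∃ s' t, Exec q P s s' t ∧ t ≤ c * (2 * digitLen q B) ∧ Q s'

theorem digitLen_mono (q : ℕ) {a b : ℕ} (h : a ≤ b) : digitLen q a ≤ digitLen q b :=
  Nat.add_le_add_right (Nat.log_mono_right h) 1

theorem digitLen_self {q : ℕ} (hq : 2 ≤ q) : digitLen q q = 2 := by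
  simp [digitLen, Nat.log_eq_one_iff.mpr ⟨by nlinarith, by omega, le_rfl⟩]

theorem digitLen_add_le {q a b B : ℕ} (ha : a ≤ B) (hb : b ≤ B) :
    digitLen q a + digitLen q b ≤ 1 * (2 * digitLen q B) := by
  have := digitLen_mono q ha
  have := digitLen_mono q hb
  omega

/-- The base `q` has two digits; this is the reason for the `2` in the cost unit `2 * digitLen q B`,
and it makes multiplication and division by `q` as cheap as an addition. -/
theorem digitLen_mul_self_le {q a B : ℕ} (hq : 2 ≤ q) (ha : a ≤ B) :
    digitLen q a * digitLen q q ≤ 1 * (2 * digitLen q B) := by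
  have := digitLen_mono q ha
  rw [digitLen_self hq]
  omega

/-- A general product costs `digitLen q B` units. Such products occur once in `setupProg` and once
per pivot column of the decoder, for an address. -/
theorem digitLen_mul_le {q a b B : ℕ} (ha : a ≤ B) (hb : b ≤ B) :
    digitLen q a * digitLen q b ≤ digitLen q B * (2 * digitLen q B) := by
  have h1 := digitLen_mono q ha
  have h2 := digitLen_mono q hb
  exact Nat.mul_le_mul h1 (by omega)

namespace State

variable (s : State) (x v A i : ℕ)

@[simp] theorem setVar_var (y : ℕ) :
    (s.setVar x v).var y = if y = x then v else s.var y := by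
  simp [setVar, Function.update_apply]

@[simp] theorem setVar_arr : (s.setVar x v).arr = s.arr := rfl

@[simp] theorem setArr_var : (s.setArr A i v).var = s.var := rfl

@[simp] theorem setArr_arr (A' : ℕ) :
    (s.setArr A i v).arr A' = if A' = A then Function.update (s.arr A) i v else s.arr A' := by
  by_cases h : A' = A
  · subst h; simp [setArr]
  · simp [setArr, h]

end State

@[simp] theorem Operand.val_lit (s : State) (c : ℕ) : (Operand.lit c).val s = c := rfl

@[simp] theorem Operand.val_var (s : State) (x : ℕ) : (Operand.var x).val s = s.var x := rfl

namespace Tri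

variable {q B c c₁ c₂ : ℕ} {P P₁ P₂ : Prog} {s : State} {Q Q₁ : State → Prop} {x A : ℕ}
  {a b : Operand}

theorem mono (h : Tri q B P s c₁ Q₁) (hc : c₁ ≤ c₂) (hQ : ∀ s', Q₁ s' → Q s') :
    Tri q B P s c₂ Q := by
  obtain ⟨s', t, h1, h2, h3⟩ := h
  exact ⟨s', t, h1, h2.trans (Nat.mul_le_mul_right _ hc), hQ _ h3⟩

theorem seq (h₁ : Tri q B P₁ s c₁ Q₁) (h₂ : ∀ s', Q₁ s' → Tri q B P₂ s' c₂ Q) :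
    Tri q B (.seq P₁ P₂) s (c₂ + c₁) Q := by
  obtain ⟨s', t, h1, h2, h3⟩ := h₁
  obtain ⟨s'', t', h1', h2', h3'⟩ := h₂ s' h3
  exact ⟨s'', t + t', h1.seq h1', by rw [add_mul]; omega, h3'⟩

/-- With the rest of the program as postcondition, a proof can walk through straight-line code one
instruction at a time without naming the intermediate states. -/
theorem step (h : Tri q B P₁ s c₁ fun s' => Tri q B P₂ s' c₂ Q) :
    Tri q B (.seq P₁ P₂) s (c₂ + c₁) Q :=
  h.seq fun _ h => h

theorem add (ha : a.val s ≤ B) (hb : b.val s ≤ B) (h : Q (s.setVar x (a.val s + b.val s))) :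
    Tri q B (.arith x .add a b) s 1 Q :=
  ⟨_, _, .arith s x .add a b, digitLen_add_le ha hb, h⟩

theorem sub (ha : a.val s ≤ B) (hb : b.val s ≤ B) (h : Q (s.setVar x (a.val s - b.val s))) :
    Tri q B (.arith x .sub a b) s 1 Q :=
  ⟨_, _, .arith s x .sub a b, digitLen_add_le ha hb, h⟩

theorem mulBase (hq : 2 ≤ q) (hb : b.val s = q) (ha : a.val s ≤ B)
    (h : Q (s.setVar x (a.val s * q))) : Tri q B (.arith x .mul a b) s 1 Q :=
  ⟨_, _, .arith s x .mul a b, by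
    rw [hb]; exact digitLen_mul_self_le hq ha, by rw [hb]; exact h⟩

theorem divBase (hq : 2 ≤ q) (hb : b.val s = q) (ha : a.val s ≤ B)
    (h : Q (s.setVar x (a.val s / q))) : Tri q B (.arith x .div a b) s 1 Q :=
  ⟨_, _, .arith s x .div a b, by
    rw [hb]; exact digitLen_mul_self_le hq ha, by rw [hb]; exact h⟩

theorem modBase (hq : 2 ≤ q) (hb : b.val s = q) (ha : a.val s ≤ B)
    (h : Q (s.setVar x (a.val s % q))) : Tri q B (.arith x .mod a b) s 1 Q :=
  ⟨_, _, .arith s x .mod a b, by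
    rw [hb]; exact digitLen_mul_self_le hq ha, by rw [hb]; exact h⟩

theorem mul (ha : a.val s ≤ B) (hb : b.val s ≤ B) (h : Q (s.setVar x (a.val s * b.val s))) :
    Tri q B (.arith x .mul a b) s (digitLen q B) Q :=
  ⟨_, _, .arith s x .mul a b, digitLen_mul_le ha hb, h⟩

theorem load (ha : a.val s ≤ B) (hb : s.arr A (a.val s) ≤ B)
    (h : Q (s.setVar x (s.arr A (a.val s)))) : Tri q B (.load x A a) s 1 Q :=
  ⟨_, _, .load s x A a, digitLen_add_le ha hb, h⟩

theorem store (ha : a.val s ≤ B) (hb : b.val s ≤ B) (h : Q (s.setArr A (a.val s) (b.val s))) :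
    Tri q B (.store A a b) s 1 Q :=
  ⟨_, _, .store s A a b, digitLen_add_le ha hb, h⟩

theorem ite (ha : a.val s ≤ B) (hb : b.val s ≤ B) (h₁ : a.val s < b.val s → Tri q B P₁ s c Q)
    (h₂ : ¬ a.val s < b.val s → Tri q B P₂ s c Q) : Tri q B (.ite a b P₁ P₂) s (c + 1) Q := by
  have hU := digitLen_add_le (q := q) ha hb
  by_cases h : a.val s < b.val s
  · obtain ⟨s', t, e1, e2, e3⟩ := h₁ h
    exact ⟨s', _, .ite_true h e1, by rw [add_mul]; omega, e3⟩
  · obtain ⟨s', t, e1, e2, e3⟩ := h₂ h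
    exact ⟨s', _, .ite_false h e1, by rw [add_mul]; omega, e3⟩

/-- A loop whose number of iterations is known. -/
theorem loop (Inv : ℕ → State → Prop) (N : ℕ) (h0 : Inv 0 s)
    (hbound : ∀ i ≤ N, ∀ s, Inv i s → a.val s ≤ B ∧ b.val s ≤ B)
    (hstep : ∀ i < N, ∀ s, Inv i s → a.val s < b.val s ∧ Tri q B P s c (Inv (i + 1)))
    (hend : ∀ s, Inv N s → ¬ a.val s < b.val s) :
    Tri q B (.while a b P) s (N * (c + 1) + 1) (Inv N) := by
  have key : ∀ m i, i + m = N → ∀ s, Inv i s →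
      Tri q B (.while a b P) s (m * (c + 1) + 1) (Inv N) := by
    intro m
    induction m with
    | zero =>
      intro i hi s hs
      obtain rfl : i = N := by omega
      obtain ⟨b1, b2⟩ := hbound i le_rfl s hs
      have hU := digitLen_add_le (q := q) b1 b2
      exact ⟨s, _, .while_false (hend s hs), by simpa using hU, hs⟩
    | succ m ih =>
      intro i hi s hs
      obtain ⟨hlt, s', t, e1, e2, e3⟩ := hstep i (by omega) s hs
      obtain ⟨s'', t', f1, f2, f3⟩ := ih (i + 1) (by omega) s' e3
      obtain ⟨b1, b2⟩ := hbound i (by omega) s hs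
      have hU := digitLen_add_le (q := q) b1 b2
      refine ⟨s'', _, .while_true hlt e1 f1, ?_, f3⟩
      have : ((m + 1) * (c + 1) + 1) * (2 * digitLen q B) =
        1 * (2 * digitLen q B) + c * (2 * digitLen q B) +
          (m * (c + 1) + 1) * (2 * digitLen q B) := by ring
      omega
  exact key N 0 (by omega) s h0

end Tri

/-- The states agree outside of the variables in `V` and the arrays in `A`. -/
def Frame (V A : List ℕ) (s s' : State) : Prop :=
  (∀ x, x ∉ V → s'.var x = s.var x) ∧ ∀ x, x ∉ A → s'.arr x = s.arr x

theorem Frame.refl (V A : List ℕ) (s : State) : Frame V A s s := ⟨fun _ _ => rfl, fun _ _ => rfl⟩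

theorem Frame.trans {V A V' A' : List ℕ} {s s' s'' : State} (h : Frame V A s s')
    (h' : Frame V' A' s' s'') (hV : V' ⊆ V) (hA : A' ⊆ A) : Frame V A s s'' :=
  ⟨fun x hx => (h'.1 x fun h => hx (hV h)).trans (h.1 x hx),
    fun x hx => (h'.2 x fun h => hx (hA h)).trans (h.2 x hx)⟩

theorem Frame.setVar {V A : List ℕ} {s s' : State} (h : Frame V A s s') {x : ℕ} (hx : x ∈ V)
    (v : ℕ) : Frame V A s (s'.setVar x v) :=
  ⟨fun y hy => by
    rw [State.setVar_var, if_neg (by rintro rfl; exact hy hx), h.1 y hy], h.2⟩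

theorem Frame.setArr {V A : List ℕ} {s s' : State} (h : Frame V A s s') {x : ℕ} (hx : x ∈ A)
    (i v : ℕ) : Frame V A s (s'.setArr x i v) :=
  ⟨h.1, fun y hy => by
    rw [State.setArr_arr, if_neg (by rintro rfl; exact hy hx), h.2 y hy]⟩

/-! ### The rescaling program

Variables: `0` is `q`, `4` the length of the number, `8` and `9` the exponents `u` and `v`, `15` and
`16` the carry offsets, `10`-`14` are scratch. The number is in array `2`. -/

infixr:60 ";;" => Prog.seq

/-- `Z[t] := Z[t] + Z[t + v]` for decreasing `t`. -/
def sumPass : Prog :=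
  .while (.lit 0) (.var 10)
    (.arith 10 .sub (.var 10) (.lit 1) ;; .load 11 2 (.var 10) ;;
     .arith 13 .add (.var 10) (.var 9) ;; .load 12 2 (.var 13) ;;
     .arith 11 .add (.var 11) (.var 12) ;; .store 2 (.var 10) (.var 11))

/-- `Z[t] := Z[t] - Z[t + u]` for increasing `t`, with carries. -/
def diffPass : Prog :=
  .while (.var 10) (.var 4)
    (.load 11 2 (.var 10) ;; .arith 13 .add (.var 10) (.var 8) ;; .load 12 2 (.var 13) ;;
     .arith 11 .add (.var 11) (.var 14) ;; .arith 11 .add (.var 11) (.var 16) ;;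
     .arith 11 .sub (.var 11) (.var 12) ;; .arith 12 .mod (.var 11) (.var 0) ;;
     .arith 14 .div (.var 11) (.var 0) ;; .store 2 (.var 10) (.var 12) ;;
     .arith 10 .add (.var 10) (.lit 1))

/-- The program that rescales the number in array `2`. -/
def rescaleProg : Prog :=
  .arith 10 .add (.var 4) (.lit 0) ;; sumPass ;; .arith 14 .add (.var 15) (.lit 0) ;; diffPass

/-- The unnormalized digits after `sumPass`. -/
def sumDigits (q len v Z t : ℕ) : ℕ := ∑ j ∈ Finset.range len, digitArray q Z (t + j * v)

section

variable {q len u v Z : ℕ}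

theorem sumDigits_eq_zero (hq : 2 ≤ q) (hZ : Z < q ^ len) {t : ℕ} (ht : len ≤ t) :
    sumDigits q len v Z t = 0 :=
  Finset.sum_eq_zero fun j _ => digitArray_eq_zero (by omega) hZ (by omega)

/-- Shift the summation index by one. The extra term `j = len` that appears is a digit at a position
`≥ len * v ≥ len`, hence zero. -/
theorem sumDigits_rec (hq : 2 ≤ q) (hv : 1 ≤ v) (hZ : Z < q ^ len) (t : ℕ) :
    sumDigits q len v Z t = digitArray q Z t + sumDigits q len v Z (t + v) := by
  unfold sumDigits
  have h := Finset.sum_range_succ (fun j => digitArray q Z (t + j * v)) len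
  rw [Finset.sum_range_succ'] at h
  have h0 : digitArray q Z (t + len * v) = 0 :=
    digitArray_eq_zero (by omega) hZ (by nlinarith)
  rw [h0, add_zero] at h
  rw [← h, add_comm, zero_mul, add_zero]
  congr 1
  refine Finset.sum_congr rfl fun j _ => ?_
  congr 1
  ring

theorem sumDigits_le (hq : 2 ≤ q) (t : ℕ) : sumDigits q len v Z t ≤ len * q := by
  calc sumDigits q len v Z t ≤ ∑ j ∈ Finset.range len, q :=
        Finset.sum_le_sum fun j _ => (digitArray_lt (by omega) _ _).le
    _ = len * q := by simp

/-- Interchange the sums: for fixed `j`, the digits from position `j * v + w` on are those of a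
quotient of `Z`. The cases `w = 0` and `w = u` give the two halves of `rescale`. -/
theorem sum_sumDigits (hZ : Z < q ^ len) (w : ℕ) :
    ∑ t ∈ Finset.range len, sumDigits q len v Z (t + w) * q ^ t =
      ∑ j ∈ Finset.range len, Z / q ^ (j * v + w) := by
  unfold sumDigits
  simp_rw [Finset.sum_mul]
  rw [Finset.sum_comm]
  refine Finset.sum_congr rfl fun j _ => ?_
  have : ∀ t, digitArray q Z (t + w + j * v) = digitArray q (Z / q ^ (j * v + w)) t := by
    intro t; rw [← digitArray_add]; congr 1; omega
  simp_rw [this]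
  rw [sum_digitArray, Nat.mod_eq_of_lt ((Nat.div_le_self _ _).trans_lt hZ)]

/-- The value of the lowest `i` differences of unnormalized digits. -/
def partialDiff (q u : ℕ) (c : ℕ → ℕ) (i : ℕ) : ℤ :=
  ∑ t ∈ Finset.range i, ((c t : ℤ) - c (t + u)) * (q : ℤ) ^ t

theorem partialDiff_sumDigits (hq : 2 ≤ q) (hZ : Z < q ^ len) :
    partialDiff q u (sumDigits q len v Z) len = rescale q len u v Z := by
  unfold partialDiff rescale
  simp_rw [sub_mul]
  rw [Finset.sum_sub_distrib]
  have h1 := sum_sumDigits (v := v) hZ 0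
  have h2 := sum_sumDigits (v := v) hZ u
  simp only [add_zero] at h1
  have e : ((∑ j ∈ Finset.range len, (Z / q ^ (j * v) - Z / q ^ (j * v + u)) : ℕ) : ℤ) =
      ((∑ j ∈ Finset.range len, Z / q ^ (j * v) : ℕ) : ℤ) -
        ((∑ j ∈ Finset.range len, Z / q ^ (j * v + u) : ℕ) : ℤ) := by
    rw [Nat.cast_sum, Nat.cast_sum, Nat.cast_sum, ← Finset.sum_sub_distrib]
    refine Finset.sum_congr rfl fun j _ => ?_
    rw [Nat.cast_sub]
    exact Nat.div_le_div_left (Nat.pow_le_pow_right (by omega) (by omega))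
      (Nat.pow_pos (by omega))
  rw [e, ← h1, ← h2]
  push_cast
  rfl

variable {c : ℕ → ℕ} {i : ℕ}

/-- The floor of the partial sum by `q ^ i` is the running signed carry, and this is its recursion.
-/
theorem partialDiff_succ_div (hq : 2 ≤ q) :
    partialDiff q u c (i + 1) / (q : ℤ) ^ i =
      (c i : ℤ) - c (i + u) + partialDiff q u c i / (q : ℤ) ^ i := by
  unfold partialDiff
  rw [Finset.sum_range_succ, Int.add_mul_ediv_right _ _ (by positivity), add_comm]

theorem partialDiff_succ_div_succ (hq : 2 ≤ q) :
    partialDiff q u c (i + 1) / (q : ℤ) ^ (i + 1) =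
      (partialDiff q u c (i + 1) / (q : ℤ) ^ i) / q := by
  rw [Int.ediv_ediv_of_nonneg (by positivity), pow_succ]

theorem abs_partialDiff_le {M : ℕ} (hq : 2 ≤ q) (hc : ∀ t, c t ≤ M) (i : ℕ) :
    |partialDiff q u c i| ≤ M * ((q : ℤ) ^ i - 1) := by
  induction i with
  | zero => simp [partialDiff]
  | succ i ih =>
    unfold partialDiff at *
    rw [Finset.sum_range_succ]
    have h1 : |((c i : ℤ) - c (i + u)) * (q : ℤ) ^ i| ≤ M * (q : ℤ) ^ i := by
      rw [abs_mul, abs_of_nonneg (by positivity : (0 : ℤ) ≤ (q : ℤ) ^ i)]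
      refine mul_le_mul_of_nonneg_right ?_ (by positivity)
      have := hc i
      have := hc (i + u)
      rw [abs_le]
      constructor <;> omega
    refine (abs_add_le _ _).trans ((add_le_add ih h1).trans ?_)
    have hP : (0 : ℤ) ≤ M * (q : ℤ) ^ i := by positivity
    have hq2 : (2 : ℤ) ≤ q := by exact_mod_cast hq
    rw [pow_succ]
    nlinarith

/-- The carry may be negative but never drops below `-M`; stored with the offset `M` it is a natural
number. -/
theorem partialDiff_div_bounds {M : ℕ} (hq : 2 ≤ q) (hc : ∀ t, c t ≤ M) (i : ℕ) :
    -(M : ℤ) ≤ partialDiff q u c i / (q : ℤ) ^ i ∧ partialDiff q u c i / (q : ℤ) ^ i ≤ M := by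
  have hP : (0 : ℤ) < (q : ℤ) ^ i := by positivity
  have hM : (0 : ℤ) ≤ M := by positivity
  have h := abs_le.mp (abs_partialDiff_le (u := u) hq hc i)
  constructor
  · rw [Int.le_ediv_iff_mul_le hP]; linarith [h.1]
  · have := Int.ediv_le_ediv hP (h.2.trans (by linarith : _ ≤ (M : ℤ) * (q : ℤ) ^ i))
    rwa [Int.mul_ediv_cancel _ hP.ne'] at this

/-- The terms after the `i`-th are multiples of `q ^ (i + 1)` and do not affect digit `i`. So the
digits emitted with carries are those of the total, although the differences are neither reduced nor
nonnegative. -/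
theorem partialDiff_digit {Y : ℕ} (hq : 2 ≤ q) (hY : partialDiff q u c len = Y) (hi : i < len) :
    partialDiff q u c (i + 1) / (q : ℤ) ^ i % q = digitArray q Y i := by
  have hdvd : ∃ H : ℤ, partialDiff q u c len = partialDiff q u c (i + 1) + (q * H) * (q : ℤ) ^ i := by
    obtain ⟨d, rfl⟩ := Nat.exists_eq_add_of_lt hi
    unfold partialDiff
    rw [show i + d + 1 = (i + 1) + d by ring, Finset.sum_range_add]
    refine ⟨∑ x ∈ Finset.range d, ((c (i + 1 + x) : ℤ) - c (i + 1 + x + u)) * (q : ℤ) ^ x, ?_⟩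
    congr 1
    rw [Finset.mul_sum, Finset.sum_mul]
    refine Finset.sum_congr rfl fun x _ => ?_
    ring
  obtain ⟨H, hH⟩ := hdvd
  have : (Y : ℤ) / (q : ℤ) ^ i % q = partialDiff q u c (i + 1) / (q : ℤ) ^ i % q := by
    rw [← hY, hH, Int.add_mul_ediv_right _ _ (by positivity), Int.add_mul_emod_self_left]
  rw [← this]
  unfold digitArray
  push_cast
  rfl

end

/-- The variables that the rescaling program changes. -/
abbrev scratch : List ℕ := [10, 11, 12, 13, 14]

theorem sumPass_spec {q B len v Z : ℕ} {s : State} (hq : 2 ≤ q) (hv : 1 ≤ v) (hZ : Z < q ^ len)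
    (h4 : s.var 10 = len) (h9 : s.var 9 = v)
    (h2 : s.arr 2 = digitArray q Z) (hB1 : len + v ≤ B) (hB2 : 2 * (len * q) ≤ B) :
    Tri q B sumPass s (len * 7 + 1) fun s' =>
      s'.var 10 = 0 ∧ s'.arr 2 = sumDigits q len v Z ∧ Frame scratch [2] s s' := by
  refine (Tri.loop (c := 6) (fun i s' => s'.var 10 = len - i ∧
    (s'.arr 2 = fun t => if len - i ≤ t then sumDigits q len v Z t else digitArray q Z t) ∧
    Frame scratch [2] s s') len ?_ ?_ ?_ ?_).mono le_rfl ?_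
  · refine ⟨by simpa using h4, ?_, Frame.refl _ _ _⟩
    rw [h2]
    funext t
    split_ifs with h
    · rw [sumDigits_eq_zero hq hZ (by omega), digitArray_eq_zero (by omega) hZ (by omega)]
    · rfl
  · rintro i hi s' ⟨h10, -, -⟩
    simp only [Operand.val_lit, Operand.val_var, h10]
    omega
  · rintro i hi s' ⟨h10, harr, hF⟩
    refine ⟨by simp [h10]; omega, ?_⟩
    have hv' : s'.var 9 = v := by rw [hF.1 9 (by simp), h9]
    have hle := sumDigits_le (len := len) (v := v) (Z := Z) hq
    have hd : ∀ t, digitArray q Z t ≤ len * q := fun t => by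
      by_cases ht : len ≤ t
      · rw [digitArray_eq_zero (by omega) hZ ht]; omega
      · exact (digitArray_lt (by omega) Z t).le.trans (Nat.le_mul_of_pos_left _ (by omega))
    have hx1 : s'.arr 2 (len - i - 1) = digitArray q Z (len - i - 1) := by
      rw [harr]; simp only; rw [if_neg (by omega)]
    -- Since `v ≥ 1`, the downward pass has already updated this cell.
    have hx2 : s'.arr 2 (len - i - 1 + v) = sumDigits q len v Z (len - i - 1 + v) := by
      rw [harr]; simp only; rw [if_pos (by omega)]
    have b1 := hle (len - i - 1 + v)
    have b2 := hd (len - i - 1)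
    refine Tri.step (Tri.sub ?_ ?_ ?_)
    · simp [h10]; omega
    · simp; omega
    refine Tri.step (Tri.load ?_ ?_ ?_)
    · simp [h10]; omega
    · simp [h10, hx1]; omega
    refine Tri.step (Tri.add ?_ ?_ ?_)
    · simp [h10]; omega
    · simp [hv']; omega
    refine Tri.step (Tri.load ?_ ?_ ?_)
    · simp [h10, hv']; omega
    · simp [h10, hv', hx2]; omega
    refine Tri.step (Tri.add ?_ ?_ ?_)
    · simp [h10, hx1]; omega
    · simp [h10, hv', hx2]; omega
    refine Tri.store ?_ ?_ ?_
    · simp [h10]; omega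
    · simp [h10, hv', hx1, hx2]; omega
    refine ⟨?_, ?_, ?_⟩
    · simp [h10]; omega
    · simp only [State.setArr_arr, if_true, State.setVar_arr, Operand.val_var, State.setVar_var,
        h10, hv', hx1, Operand.val_lit]
      funext t
      simp only [Function.update_apply]
      simp
      by_cases ht : t = len - i - 1
      · subst ht
        rw [if_pos rfl, if_pos (by omega), sumDigits_rec hq hv hZ, hx2]
      · rw [if_neg ht, harr]
        simp only
        by_cases ht2 : len - i ≤ t
        · rw [if_pos ht2, if_pos (by omega)]
        · rw [if_neg ht2, if_neg (by omega)]
    · refine Frame.setArr ?_ (by simp) _ _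
      repeat refine Frame.setVar ?_ (by simp) _
      exact hF
  · rintro s' ⟨h10, -, -⟩
    simp [h10]
  · rintro s' ⟨h10, harr, hF⟩
    exact ⟨by simpa using h10, by simpa using harr, hF⟩

theorem diffPass_spec {q B len u Y M : ℕ} {c : ℕ → ℕ} {s : State} (hq : 2 ≤ q)
    (hc : ∀ t, c t ≤ M) (hc0 : ∀ t, len ≤ t → c t = 0) (hY : partialDiff q u c len = Y)
    (hYlt : Y < q ^ len) (h0 : s.var 0 = q) (h4 : s.var 4 = len) (h8 : s.var 8 = u)
    (h10 : s.var 10 = 0) (h14 : s.var 14 = M) (h16 : s.var 16 = M * q - M)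
    (h2 : s.arr 2 = c) (hB1 : len + u + 1 ≤ B) (hB2 : 3 * M + M * q + q ≤ B) :
    Tri q B diffPass s (len * 11 + 1) fun s' =>
      s'.arr 2 = digitArray q Y ∧ Frame scratch [2] s s' := by
  -- Variable 14 holds the signed carry increased by `M`.
  refine (Tri.loop (c := 10) (fun i s' => s'.var 10 = i ∧
    ((s'.var 14 : ℤ) = M + partialDiff q u c i / (q : ℤ) ^ i) ∧
    (s'.arr 2 = fun t => if t < i then digitArray q Y t else c t) ∧
    Frame scratch [2] s s') len ?_ ?_ ?_ ?_).mono le_rfl ?_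
  · refine ⟨h10, by simp [h14, partialDiff], ?_, Frame.refl _ _ _⟩
    rw [h2]; simp
  · rintro i hi s' ⟨h10', -, -, hF⟩
    simp only [Operand.val_var, h10', hF.1 4 (by simp), h4]
    omega
  · rintro i hi s' ⟨h10', h14', harr, hF⟩
    have g4 : s'.var 4 = len := by rw [hF.1 4 (by simp), h4]
    have g0 : s'.var 0 = q := by rw [hF.1 0 (by simp), h0]
    have g8 : s'.var 8 = u := by rw [hF.1 8 (by simp), h8]
    have g16 : s'.var 16 = M * q - M := by rw [hF.1 16 (by simp), h16]
    refine ⟨by simp [h10', g4]; omega, ?_⟩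
    obtain ⟨p1, p2⟩ := partialDiff_div_bounds (u := u) hq hc i
    have e1 := partialDiff_succ_div (u := u) (c := c) (i := i) hq
    have e2 := partialDiff_succ_div_succ (u := u) (c := c) (i := i) hq
    have e3 := partialDiff_digit hq hY hi
    -- The upward pass has overwritten only cells below `i`, so both cells that are read still hold
    -- unreduced digits, and the subtraction can be done in place.
    have hx1 : s'.arr 2 i = c i := by rw [harr]; simp
    have hx2 : s'.arr 2 (i + u) = c (i + u) := by rw [harr]; simp
    have b1 := hc i
    have b2 := hc (i + u)
    have hMq : 2 * M ≤ M * q := by nlinarith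
    obtain ⟨cr, hcr⟩ : ∃ cr, cr = s'.var 14 := ⟨_, rfl⟩
    rw [← hcr] at h14'
    set D := partialDiff q u c (i + 1) / (q : ℤ) ^ i with hD
    -- Variable 16 completes the offset `M` of the carry to `M * q`. This keeps the truncated
    -- subtraction exact, vanishes modulo `q`, and turns back into the offset `M` after the division
    -- by `q`.
    have hX : ((c i + cr + (M * q - M) - c (i + u) : ℕ) : ℤ) = D + M * q := by
      rw [e1]; push_cast [show M ≤ M * q by omega, show c (i + u) ≤ c i + cr + (M * q - M) by omega]
      rw [h14']; ring
    have hXmod : (c i + cr + (M * q - M) - c (i + u)) % q = digitArray q Y i := by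
      zify; rw [hX, Int.add_mul_emod_self_right]; exact e3
    have hXdiv : (((c i + cr + (M * q - M) - c (i + u)) / q : ℕ) : ℤ) = D / q + M := by
      push_cast; rw [hX, Int.add_mul_ediv_right _ _ (by positivity)]
    refine Tri.step (Tri.load ?_ ?_ ?_)
    · simp [h10']; omega
    · simp [h10', hx1]; omega
    refine Tri.step (Tri.add ?_ ?_ ?_)
    · simp [h10']; omega
    · simp [g8]; omega
    refine Tri.step (Tri.load ?_ ?_ ?_)
    · simp [h10', g8]; omega
    · simp [h10', g8, hx2]; omega
    refine Tri.step (Tri.add ?_ ?_ ?_)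
    · simp [h10', hx1]; omega
    · simp [← hcr]; omega
    refine Tri.step (Tri.add ?_ ?_ ?_)
    · simp [h10', hx1, ← hcr]; omega
    · simp [g16]; omega
    refine Tri.step (Tri.sub ?_ ?_ ?_)
    · simp [h10', hx1, ← hcr, g16]; omega
    · simp [h10', g8, hx2]; omega
    refine Tri.step (Tri.modBase hq ?_ ?_ ?_)
    · simp [g0]
    · simp [h10', hx1, hx2, ← hcr, g16, g8]; omega
    refine Tri.step (Tri.divBase hq ?_ ?_ ?_)
    · simp [g0]
    · simp [h10', hx1, hx2, ← hcr, g16, g8]; omega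
    have hdl := digitArray_lt (by omega : 0 < q) Y i
    refine Tri.step (Tri.store ?_ ?_ ?_)
    · simp [h10']; omega
    · simp [h10', hx1, hx2, ← hcr, g16, g8, hXmod]; omega
    refine Tri.add ?_ ?_ ?_
    · simp [h10']; omega
    · simp; omega
    refine ⟨?_, ?_, ?_, ?_⟩
    · simp [h10']
    · refine (congrArg (Nat.cast : ℕ → ℤ) ?_).trans (hXdiv.trans ?_)
      · simp [h10', hx1, hx2, ← hcr, g16, g8]
      · rw [e2, add_comm]
    · simp only [State.setArr_arr, if_true, State.setVar_arr, Operand.val_var, State.setVar_var,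
        State.setArr_var, h10', g8, hx1, ← hcr, g16]
      simp [hx2, hXmod]
      funext t
      simp only [Function.update_apply]
      by_cases ht : t = i
      · subst ht
        rw [if_pos rfl, if_pos (by omega)]
      · rw [if_neg ht, harr]
        simp only
        by_cases ht2 : t < i
        · rw [if_pos ht2, if_pos (by omega)]
        · rw [if_neg ht2, if_neg (by omega)]
    · refine Frame.setVar ?_ (by simp) _
      refine Frame.setArr ?_ (by simp) _ _
      repeat refine Frame.setVar ?_ (by simp) _
      exact hF
  · rintro s' ⟨h10', -, -, hF⟩
    simp [h10', hF.1 4, h4]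
  · rintro s' ⟨-, -, harr, hF⟩
    refine ⟨?_, hF⟩
    rw [harr]
    funext t
    split_ifs with h
    · rfl
    · rw [hc0 t (by omega), digitArray_eq_zero (by omega) hYlt (by omega)]

theorem rescaleProg_spec {q B len u v Z : ℕ} {s : State} (hq : 2 ≤ q) (hv : 1 ≤ v)
    (hZ : Z < q ^ len) (hY : rescale q len u v Z < q ^ len) (h0 : s.var 0 = q)
    (h4 : s.var 4 = len) (h8 : s.var 8 = u) (h9 : s.var 9 = v) (h15 : s.var 15 = len * q)
    (h16 : s.var 16 = len * q * q - len * q) (h2 : s.arr 2 = digitArray q Z)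
    (hB1 : len + u + v + 1 ≤ B) (hB2 : 3 * (len * q) + len * q * q + q ≤ B) :
    Tri q B rescaleProg s (len * 18 + 4) fun s' =>
      s'.arr 2 = digitArray q (rescale q len u v Z) ∧ Frame scratch [2] s s' := by
  refine Tri.mono (c₁ := len * 11 + 1 + 1 + (len * 7 + 1) + 1) ?_ (by omega) fun _ h => h
  refine Tri.step (Tri.add ?_ ?_ ?_)
  · simp [h4]; omega
  · simp
  refine Tri.seq (sumPass_spec (len := len) (v := v) (Z := Z) hq hv hZ ?_ ?_ ?_ (by omega)
    (by omega)) ?_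
  · simp [h4]
  · simp [h9]
  · simp [h2]
  rintro s' ⟨g10, garr, gF⟩
  have hF : Frame scratch [2] s s' :=
    ((Frame.refl _ _ s).setVar (by simp) _).trans gF (by simp) (by simp)
  refine Tri.step (Tri.add ?_ ?_ ?_)
  · simp [hF.1 15, h15]; omega
  · simp
  refine (diffPass_spec (Y := rescale q len u v Z) (u := u) (M := len * q) hq
    (sumDigits_le (len := len) (v := v) (Z := Z) hq) (fun t ht => sumDigits_eq_zero hq hZ ht)
    (partialDiff_sumDigits hq hZ) hY ?_ ?_ ?_ ?_ ?_ ?_ ?_ (by omega) hB2).mono le_rfl ?_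
  · simp [hF.1 0, h0]
  · simp [hF.1 4, h4]
  · simp [hF.1 8, h8]
  · simp [g10]
  · simp [hF.1 15, h15]
  · simp [hF.1 16, h16]
  · simp [garr]
  · rintro s'' ⟨a1, a2⟩
    exact ⟨a1, (hF.setVar (by simp) _).trans a2 (by simp) (by simp)⟩

end GrassEnc

namespace GrassEnc

/-! ### Extended representations as arrays of digits -/

/-- The number of ones among the first `c` entries of the first row. -/
def wt (E : ℕ → ℕ → ℕ) (c : ℕ) : ℕ := ∑ j ∈ Finset.range c, E 0 j

/-- The number with the digits `E 1 c, …, E a c`, most significant digit first. -/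
def colNum (q : ℕ) (E : ℕ → ℕ → ℕ) (a c : ℕ) : ℕ := ∑ t ∈ Finset.range a, E (a - t) c * q ^ t

/-- The contribution of a column to the index. -/
def colTerm (q : ℕ) (E : ℕ → ℕ → ℕ) (c : ℕ) : ℕ :=
  if E 0 c = 0 then colNum q E (wt E c) c * gauss q (wt E c) (c - wt E c)
  else if c = wt E c then 0 else q ^ (wt E c + 1) * gauss q (wt E c + 1) (c - wt E c - 1)

/-- The index of the matrix formed by the first `c` columns. -/
def idx (q : ℕ) (E : ℕ → ℕ → ℕ) (c : ℕ) : ℕ := ∑ j ∈ Finset.range c, colTerm q E j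

/-- The properties that characterize extended representations with `n` columns. -/
structure Valid (q n : ℕ) (E : ℕ → ℕ → ℕ) : Prop where
  lt : ∀ r c, E r c < q
  le_one : ∀ c < n, E 0 c ≤ 1
  free : ∀ c < n, E 0 c = 0 → ∀ r, wt E c ≤ r → E (r + 1) c = 0
  pivot : ∀ c < n, E 0 c = 1 → ∀ r, E (r + 1) c = if r = wt E c then 1 else 0
  out : ∀ r c, n ≤ c → E r c = 0

theorem wt_succ (E : ℕ → ℕ → ℕ) (c : ℕ) : wt E (c + 1) = wt E c + E 0 c :=
  Finset.sum_range_succ _ _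

theorem idx_succ (q : ℕ) (E : ℕ → ℕ → ℕ) (c : ℕ) :
    idx q E (c + 1) = idx q E c + colTerm q E c :=
  Finset.sum_range_succ _ _

theorem wt_mono (E : ℕ → ℕ → ℕ) : Monotone (wt E) :=
  monotone_nat_of_le_succ fun c => by rw [wt_succ]; omega

theorem wt_congr {E E' : ℕ → ℕ → ℕ} {c : ℕ} (h : ∀ j < c, E 0 j = E' 0 j) :
    wt E c = wt E' c :=
  Finset.sum_congr rfl fun j hj => h j (Finset.mem_range.mp hj)

theorem colTerm_congr {q : ℕ} {E E' : ℕ → ℕ → ℕ} {c : ℕ} (h : ∀ r, E r c = E' r c)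
    (hwt : wt E c = wt E' c) : colTerm q E c = colTerm q E' c := by
  simp only [colTerm, colNum, h, hwt]

theorem idx_congr {q : ℕ} {E E' : ℕ → ℕ → ℕ} {c : ℕ} (h : ∀ r, ∀ j < c, E r j = E' r j) :
    idx q E c = idx q E' c :=
  Finset.sum_congr rfl fun j hj => by
    have hj := Finset.mem_range.mp hj
    exact colTerm_congr (fun r => h r j hj) (wt_congr fun i hi => h 0 i (by omega))

theorem colTerm_free {q : ℕ} {E : ℕ → ℕ → ℕ} {c a b : ℕ} (h : E 0 c = 0) (ha : wt E c = a)
    (hc : c = a + b) : colTerm q E c = colNum q E a c * gauss q a b := by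
  unfold colTerm
  rw [if_pos h, ha, show c - a = b by omega]

theorem colTerm_pivot_self {q : ℕ} {E : ℕ → ℕ → ℕ} {c : ℕ} (h : E 0 c = 1) (ha : wt E c = c) :
    colTerm q E c = 0 := by
  simp [colTerm, h, ha]

theorem colTerm_pivot {q : ℕ} {E : ℕ → ℕ → ℕ} {c a b : ℕ} (h : E 0 c = 1) (ha : wt E c = a)
    (hc : c = a + b + 1) : colTerm q E c = q ^ (a + 1) * gauss q (a + 1) b := by
  unfold colTerm
  rw [if_neg (by omega), ha, if_neg (by omega), show c - a - 1 = b by omega]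

/-! ### Range and monotonicity of the index -/

namespace Valid

variable {q n : ℕ} {E E' : ℕ → ℕ → ℕ}

theorem wt_le (h : Valid q n E) {c : ℕ} (hc : c ≤ n) : wt E c ≤ c := by
  calc wt E c ≤ ∑ j ∈ Finset.range c, 1 :=
        Finset.sum_le_sum fun j hj => h.le_one j (by have := Finset.mem_range.mp hj; omega)
    _ = c := by simp

theorem colNum_lt (h : Valid q n E) (a c : ℕ) : colNum q E a c < q ^ a :=
  sum_digits_lt (by have := h.lt 0 0; omega) fun t _ => h.lt _ _

theorem digitArray_colNum (h : Valid q n E) (a c t : ℕ) :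
    digitArray q (colNum q E a c) t = if t < a then E (a - t) c else 0 :=
  (digitArray_sum (by have := h.lt 0 0; omega) fun t _ => h.lt _ _).2 t

theorem zero_or_one (h : Valid q n E) {c : ℕ} (hc : c < n) : E 0 c = 0 ∨ E 0 c = 1 := by
  have := h.le_one c hc
  omega

/-- Follow the recursion of `gauss` column by column. After a free column the index is below `(x +
1) * gauss q a b` with `x < q ^ a`; a pivot column adds the whole first summand of the recursion to
an index below the second one. -/
theorem idx_lt (h : Valid q n E) {c a b : ℕ} (hc : c ≤ n) (ha : wt E c = a) (hab : c = a + b) :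
    idx q E c < gauss q a b := by
  have hq : 0 < q := by have := h.lt 0 0; omega
  induction c generalizing a b with
  | zero =>
    obtain ⟨rfl, rfl⟩ : a = 0 ∧ b = 0 := by omega
    simp [idx]
  | succ c ih =>
    have hw := h.wt_le (c := c) (by omega)
    rw [wt_succ] at ha
    rw [idx_succ]
    rcases h.zero_or_one (show c < n by omega) with h0 | h1
    · rw [h0, add_zero] at ha
      obtain ⟨b, rfl⟩ : ∃ b', b = b' + 1 := ⟨b - 1, by omega⟩
      have hcol := h.colNum_lt a c
      have ih := ih (by omega) ha (by omega : c = a + b)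
      rw [colTerm_free h0 ha (by omega : c = a + b)]
      have hstep : q ^ a * gauss q a b ≤ gauss q a (b + 1) := by
        cases a with
        | zero => simp
        | succ a => rw [gauss_succ_succ]; exact Nat.le_add_right _ _
      calc _ < (colNum q E a c + 1) * gauss q a b := by rw [add_mul, one_mul]; omega
        _ ≤ q ^ a * gauss q a b := Nat.mul_le_mul_right _ hcol
        _ ≤ _ := hstep
    · rw [h1] at ha
      subst ha
      have ih := ih (by omega) rfl (by omega : c = wt E c + b)
      cases b with
      | zero =>
        rw [colTerm_pivot_self h1 (by omega)]
        simpa using ih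
      | succ b =>
        rw [colTerm_pivot h1 rfl (by omega : c = wt E c + b + 1), gauss_succ_succ]
        omega

/-- The integer formed by a column of the matrix. -/
theorem colNum_succ_free (h : Valid q n E) {k c : ℕ} (hc : c < n) (h0 : E 0 c = 0)
    (hk : wt E c ≤ k) :
    ∑ t ∈ Finset.range (k + 1), E (k - t) c * q ^ t = q ^ (k - wt E c) * colNum q E (wt E c) c := by
  have hfree := h.free c hc h0
  generalize wt E c = a at *
  obtain ⟨d, rfl⟩ := Nat.exists_eq_add_of_le' hk
  rw [Finset.sum_range_succ, Nat.sub_self, h0, zero_mul, add_zero, Finset.sum_range_add]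
  have hlow : ∑ t ∈ Finset.range d, E (d + a - t) c * q ^ t = 0 :=
    Finset.sum_eq_zero fun t ht => by
      have ht := Finset.mem_range.mp ht
      rw [show d + a - t = (d + a - t - 1) + 1 by omega, hfree _ (by omega), zero_mul]
  rw [hlow, zero_add, Nat.add_sub_cancel, colNum, Finset.mul_sum]
  refine Finset.sum_congr rfl fun t _ => ?_
  rw [show d + a - (d + t) = a - t by omega]
  ring

theorem colTerm_le_of_free (h : Valid q n E) {c a b : ℕ} (hc : c < n) (h0 : E 0 c = 0)
    (ha : wt E c = a) (hab : c = a + b) : idx q E (c + 1) < (colNum q E a c + 1) * gauss q a b := by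
  rw [idx_succ, colTerm_free h0 ha hab, add_mul, one_mul]
  have := h.idx_lt hc.le ha hab
  omega

/-- The index is strictly monotone for the comparison of columns from right to left. -/
theorem idx_lt_idx (h : Valid q n E) (h' : Valid q n E') {k c : ℕ} (hk : wt E n = k)
    (hk' : wt E' n = k) (hc : c < n) (hag : ∀ c', c < c' → c' < n → ∀ r, E r c' = E' r c')
    (hlt : ∑ t ∈ Finset.range (k + 1), E (k - t) c * q ^ t <
      ∑ t ∈ Finset.range (k + 1), E' (k - t) c * q ^ t) :
    idx q E n < idx q E' n := by
  have hq : 0 < q := by have := h.lt 0 0; omega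
  -- Going left from column `n`, where both weights are `k`, equal columns lower both weights
  -- equally and contribute equally. So it suffices to compare the first `c + 1` columns.
  have key : ∀ d, d ≤ n - (c + 1) → wt E (n - d) = wt E' (n - d) ∧
      idx q E n + idx q E' (n - d) = idx q E' n + idx q E (n - d) := by
    intro d
    induction d with
    | zero => intro _; exact ⟨by rw [Nat.sub_zero, hk, hk'], by simp [add_comm]⟩
    | succ d ih =>
      intro hd
      obtain ⟨i1, i2⟩ := ih (by omega)
      obtain ⟨m, hm⟩ : ∃ m, n - d = m + 1 := ⟨n - d - 1, by omega⟩
      have hm' : n - (d + 1) = m := by omega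
      have hcol := hag m (by omega) (by omega)
      rw [hm, wt_succ, wt_succ, hcol 0] at i1
      have hwt : wt E m = wt E' m := by omega
      rw [hm, idx_succ, idx_succ, colTerm_congr hcol hwt] at i2
      rw [hm']
      exact ⟨hwt, by omega⟩
  obtain ⟨k1, k2⟩ := key (n - (c + 1)) le_rfl
  rw [show n - (n - (c + 1)) = c + 1 by omega] at k1 k2
  suffices idx q E (c + 1) < idx q E' (c + 1) by omega
  have w1 := h.wt_le hc.le
  have w2 := h'.wt_le hc.le
  have wk : wt E (c + 1) ≤ k := hk ▸ wt_mono E (by omega)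
  rw [wt_succ, wt_succ] at k1
  rw [wt_succ] at wk
  -- The weights after column `c` agree. If only the larger column is a pivot, the other matrix has
  -- one more pivot before `c`, and its index stays below the pivot contribution. If only the
  -- smaller one is a pivot, its top digit `q ^ k` contradicts `hlt`; two pivot columns would be
  -- equal.
  rcases h.zero_or_one hc with e0 | e1 <;> rcases h'.zero_or_one hc with f0 | f1
  · have hwt : wt E c = wt E' c := by omega
    rw [h.colNum_succ_free hc e0 (by omega), h'.colNum_succ_free hc f0 (by omega), hwt] at hlt
    have hlt := Nat.lt_of_mul_lt_mul_left hlt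
    obtain ⟨b, hb⟩ := Nat.exists_eq_add_of_le w2
    calc idx q E (c + 1) < (colNum q E (wt E' c) c + 1) * gauss q (wt E' c) b :=
          h.colTerm_le_of_free hc e0 hwt hb
      _ ≤ colNum q E' (wt E' c) c * gauss q (wt E' c) b := Nat.mul_le_mul_right _ hlt
      _ ≤ idx q E' (c + 1) := by
          rw [idx_succ, colTerm_free f0 rfl hb]; exact Nat.le_add_left _ _
  · have hwt : wt E c = wt E' c + 1 := by omega
    obtain ⟨b, hb⟩ := Nat.exists_eq_add_of_le w1
    calc idx q E (c + 1) < (colNum q E (wt E c) c + 1) * gauss q (wt E c) b :=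
          h.colTerm_le_of_free hc e0 rfl hb
      _ ≤ q ^ (wt E c) * gauss q (wt E c) b := Nat.mul_le_mul_right _ (h.colNum_lt _ _)
      _ ≤ idx q E' (c + 1) := by
          rw [idx_succ, colTerm_pivot (b := b) f1 rfl (by omega), hwt]; exact Nat.le_add_left _ _
  · exfalso
    rw [h'.colNum_succ_free hc f0 (by omega)] at hlt
    have h1 : q ^ k ≤ ∑ t ∈ Finset.range (k + 1), E (k - t) c * q ^ t := by
      rw [Finset.sum_range_succ, Nat.sub_self, e1, one_mul]; exact Nat.le_add_left _ _
    have h2 : q ^ (k - wt E' c) * colNum q E' (wt E' c) c < q ^ (k - wt E' c) * q ^ wt E' c :=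
      Nat.mul_lt_mul_of_pos_left (h'.colNum_lt _ _) (Nat.pow_pos hq)
    rw [← pow_add, Nat.sub_add_cancel (by omega)] at h2
    omega
  · exfalso
    have hwt : wt E c = wt E' c := by omega
    have heq : ∀ r, E r c = E' r c := by
      intro r
      cases r with
      | zero => rw [e1, f1]
      | succ r => rw [h.pivot c hc e1, h'.pivot c hc f1, hwt]
    simp only [heq, lt_irrefl] at hlt

theorem row_eq_zero (h : Valid q n E) {k r c : ℕ} (hk : wt E n = k) (hr : k < r) : E r c = 0 := by
  by_cases hc : c < n
  · obtain ⟨r, rfl⟩ : ∃ r', r = r' + 1 := ⟨r - 1, by omega⟩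
    have hw : wt E c + E 0 c ≤ k := by rw [← wt_succ, ← hk]; exact wt_mono E hc
    rcases h.zero_or_one hc with h0 | h1
    · exact h.free c hc h0 r (by omega)
    · rw [h.pivot c hc h1, if_neg (by omega)]
  · exact h.out r c (by omega)

/-- Two distinct extended representations differ in a rightmost column, and there the integers
formed by the columns are different. -/
theorem exists_last_ne (h : Valid q n E) (h' : Valid q n E') {k : ℕ} (hk : wt E n = k)
    (hk' : wt E' n = k) (hne : E ≠ E') :
    ∃ c < n, (∀ c', c < c' → c' < n → ∀ r, E r c' = E' r c') ∧
      ∑ t ∈ Finset.range (k + 1), E (k - t) c * q ^ t ≠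
        ∑ t ∈ Finset.range (k + 1), E' (k - t) c * q ^ t := by
  have hq : 0 < q := by have := h.lt 0 0; omega
  classical
  set S := (Finset.range n).filter fun c => ∃ r, E r c ≠ E' r c
  have hS : S.Nonempty := by
    by_contra hS
    rw [Finset.not_nonempty_iff_eq_empty] at hS
    apply hne
    funext r c
    by_cases hc : c < n
    · by_contra hrc
      have : c ∈ S := Finset.mem_filter.mpr ⟨Finset.mem_range.mpr hc, r, hrc⟩
      simp [hS] at this
    · rw [h.out r c (by omega), h'.out r c (by omega)]
  obtain ⟨hm1, r, hr⟩ := Finset.mem_filter.mp (S.max'_mem hS)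
  refine ⟨S.max' hS, Finset.mem_range.mp hm1, ?_, ?_⟩
  · intro c' hc' hn r
    by_contra hrc
    have : c' ∈ S := Finset.mem_filter.mpr ⟨Finset.mem_range.mpr hn, r, hrc⟩
    exact absurd (S.le_max' c' this) (by omega)
  · intro heq
    apply hr
    have hrk : r ≤ k := by
      by_contra hrk
      rw [h.row_eq_zero hk (by omega), h'.row_eq_zero hk' (by omega)] at hr
      exact hr rfl
    have d1 := (digitArray_sum hq (m := k + 1) (d := fun t => E (k - t) (S.max' hS))
      fun t _ => h.lt _ _).2 (k - r)
    have d2 := (digitArray_sum hq (m := k + 1) (d := fun t => E' (k - t) (S.max' hS))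
      fun t _ => h'.lt _ _).2 (k - r)
    rw [if_pos (by omega), show k - (k - r) = r by omega] at d1 d2
    rw [← d1, ← d2, heq]

end Valid

/-- Replace column `n`. -/
def setCol (E : ℕ → ℕ → ℕ) (n : ℕ) (w : ℕ → ℕ) : ℕ → ℕ → ℕ :=
  fun r c => if c = n then w r else E r c

theorem Valid.setCol {q n : ℕ} {E : ℕ → ℕ → ℕ} (h : Valid q n E) {w : ℕ → ℕ}
    (hlt : ∀ r, w r < q) (hle : w 0 ≤ 1) (hfree : w 0 = 0 → ∀ r, wt E n ≤ r → w (r + 1) = 0)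
    (hpiv : w 0 = 1 → ∀ r, w (r + 1) = if r = wt E n then 1 else 0) :
    Valid q (n + 1) (setCol E n w) := by
  have hwt : ∀ c ≤ n, wt (GrassEnc.setCol E n w) c = wt E c := fun c hc =>
    wt_congr fun j hj => by simp [GrassEnc.setCol, show j ≠ n by omega]
  have e1 : ∀ r, GrassEnc.setCol E n w r n = w r := fun r => by simp [GrassEnc.setCol]
  have e2 : ∀ r c, c ≠ n → GrassEnc.setCol E n w r c = E r c := fun r c hc => by
    simp [GrassEnc.setCol, hc]
  refine ⟨?_, ?_, ?_, ?_, ?_⟩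
  · intro r c
    by_cases hc : c = n
    · subst hc; rw [e1]; exact hlt r
    · rw [e2 _ _ hc]; exact h.lt r c
  · intro c hc
    by_cases hcn : c = n
    · subst hcn; rw [e1]; exact hle
    · rw [e2 _ _ hcn]; exact h.le_one c (by omega)
  · intro c hc h0 r hr
    rw [hwt c (by omega)] at hr
    by_cases hcn : c = n
    · subst hcn; rw [e1] at *; exact hfree h0 r hr
    · rw [e2 _ _ hcn] at *; exact h.free c (by omega) h0 r hr
  · intro c hc h0 r
    rw [hwt c (by omega)]
    by_cases hcn : c = n
    · subst hcn; rw [e1] at *; exact hpiv h0 r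
    · rw [e2 _ _ hcn] at *; exact h.pivot c (by omega) h0 r
  · intro r c hc
    rw [e2 _ _ (by omega)]; exact h.out r c (by omega)

/-- Every number below the Gaussian binomial coefficient is an index. -/
theorem exists_valid_idx {q : ℕ} (hq : 2 ≤ q) : ∀ n a b, n = a + b → ∀ i < gauss q a b,
    ∃ E, Valid q n E ∧ wt E n = a ∧ idx q E n = i := by
  intro n
  induction n with
  | zero =>
    intro a b hab i hi
    obtain ⟨rfl, rfl⟩ : a = 0 ∧ b = 0 := by omega
    have hi : i = 0 := by simpa using hi
    refine ⟨fun _ _ => 0, ⟨?_, ?_, ?_, ?_, ?_⟩, ?_, ?_⟩ <;> simp [wt, idx, hi]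
    omega
  | succ n ih =>
    have free : ∀ a b x y, n = a + b → x < q ^ a → y < gauss q a b →
        ∃ E, Valid q (n + 1) E ∧ wt E (n + 1) = a ∧
          idx q E (n + 1) = y + x * gauss q a b := by
      intro a b x y hab hx hy
      obtain ⟨E, hE, hw, hi⟩ := ih a b hab y hy
      set w : ℕ → ℕ := fun r => if r = 0 then 0 else if r ≤ a then digitArray q x (a - r) else 0
        with hwdef
      have hcongr : ∀ r, ∀ j < n, setCol E n w r j = E r j := fun r j hj => by
        simp [setCol, show j ≠ n by omega]
      have hwt : wt (setCol E n w) n = a := by rw [wt_congr (hcongr 0), hw]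
      have hcol : ∀ r, setCol E n w r n = w r := fun r => by simp [setCol]
      refine ⟨setCol E n w, hE.setCol ?_ ?_ ?_ ?_, ?_, ?_⟩
      · intro r
        simp only [hwdef]
        split_ifs
        · omega
        · exact digitArray_lt (by omega) _ _
        · omega
      · simp [hwdef]
      · intro _ r hr
        simp only [hwdef]
        rw [if_neg (by omega), if_neg (by omega)]
      · simp [hwdef]
      · rw [wt_succ, hwt, hcol]; simp [hwdef]
      · rw [idx_succ, colTerm_free (by rw [hcol]; simp [hwdef]) hwt hab,
          idx_congr hcongr, hi]
        congr 2
        unfold colNum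
        conv_rhs => rw [← Nat.mod_eq_of_lt hx, ← sum_digitArray]
        refine Finset.sum_congr rfl fun t ht => ?_
        have ht := Finset.mem_range.mp ht
        rw [hcol]
        simp only [hwdef]
        rw [if_neg (by omega), if_pos (by omega), show a - (a - t) = t by omega]
    have pivot : ∀ a b y, n = a + b → y < gauss q a b →
        ∃ E, Valid q (n + 1) E ∧ wt E (n + 1) = a + 1 ∧
          idx q E (n + 1) = y + if b = 0 then 0 else q ^ (a + 1) * gauss q (a + 1) (b - 1) := by
      intro a b y hab hy
      obtain ⟨E, hE, hw, hi⟩ := ih a b hab y hy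
      set w : ℕ → ℕ := fun r => if r = 0 then 1 else if r = a + 1 then 1 else 0 with hwdef
      have hcongr : ∀ r, ∀ j < n, setCol E n w r j = E r j := fun r j hj => by
        simp [setCol, show j ≠ n by omega]
      have hwt : wt (setCol E n w) n = a := by rw [wt_congr (hcongr 0), hw]
      have hcol : ∀ r, setCol E n w r n = w r := fun r => by simp [setCol]
      have h1 : setCol E n w 0 n = 1 := by rw [hcol]; simp [hwdef]
      refine ⟨setCol E n w, hE.setCol ?_ ?_ ?_ ?_, ?_, ?_⟩
      · intro r
        simp only [hwdef]
        split_ifs <;> omega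
      · simp [hwdef]
      · simp [hwdef]
      · intro _ r
        simp [hwdef, hw]
      · rw [wt_succ, hwt, h1]
      · rw [idx_succ, idx_congr hcongr, hi]
        congr 1
        split_ifs with hb
        · exact colTerm_pivot_self h1 (by omega)
        · exact colTerm_pivot h1 hwt (by omega)
    intro a b hab i hi
    cases b with
    | zero =>
      obtain ⟨a, rfl⟩ : ∃ a', a = a' + 1 := ⟨a - 1, by omega⟩
      simpa using pivot a 0 i (by omega) (by simpa using hi)
    | succ b =>
      -- Below this threshold the last column is free: its digits are the quotient by `gauss q a b`,
      -- and the remainder is the index of the other columns. From the threshold on, the last column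
      -- is a pivot.
      by_cases hi2 : i < q ^ a * gauss q a b
      · have hg := gauss_pos (show 0 < q by omega) a b
        obtain ⟨E, h1, h2, h3⟩ := free a b (i / gauss q a b) (i % gauss q a b) (by omega)
          ((Nat.div_lt_iff_lt_mul hg).mpr hi2) (Nat.mod_lt _ hg)
        exact ⟨E, h1, h2, by rw [h3, mul_comm, Nat.mod_add_div]⟩
      · cases a with
        | zero => simp at hi hi2; omega
        | succ a =>
          rw [gauss_succ_succ] at hi
          obtain ⟨E, h1, h2, h3⟩ := pivot a (b + 1) (i - q ^ (a + 1) * gauss q (a + 1) b)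
            (by omega) (by omega)
          refine ⟨E, h1, h2, ?_⟩
          rw [h3, if_neg (by omega), Nat.add_sub_cancel]
          omega

end GrassEnc

namespace GrassEnc

/-! ### Reduced row echelon form -/

section Echelon

variable {F : Type*} [Field F] {n k : ℕ}

/-- `M` is in reduced row echelon form without zero rows, with leading ones in the columns `p`. -/
structure HasPivots (M : Matrix (Fin k) (Fin n) F) (p : Fin k → Fin n) : Prop where
  strictMono : StrictMono p
  apply_pivot : ∀ r s, M r (p s) = if r = s then 1 else 0
  eq_zero : ∀ r c, c < p r → M r c = 0

theorem exists_hasPivots {M : Matrix (Fin k) (Fin n) F} (h : M.IsReducedRowEchelon)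
    (h0 : ∀ r, M r ≠ 0) : ∃ p, HasPivots M p := by
  choose p hp using fun r => Matrix.row_ne_zero_iff_exists_isLeadingEntry.mp (h0 r)
  refine ⟨p, ?_, ?_, fun r c hc => (hp r).1 c hc⟩
  · intro i j hij
    by_contra hle
    exact (hp j).2 (h.isRowEchelon hij fun c hc => (hp i).1 c (hc.trans_le (not_lt.mp hle)))
  · intro r s
    split_ifs with hrs
    · subst hrs; exact h.eq_one (hp r)
    · exact h.eq_zero_of_ne_of_isLeadingEntry hrs (hp s)

namespace HasPivots

variable {M M' : Matrix (Fin k) (Fin n) F} {p p' : Fin k → Fin n}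

theorem isLeadingEntry (h : HasPivots M p) (r : Fin k) : M.IsLeadingEntry r (p r) :=
  ⟨fun c hc => h.eq_zero r c hc, by rw [h.apply_pivot, if_pos rfl]; exact one_ne_zero⟩

theorem eq_of_isLeadingEntry (h : HasPivots M p) {r : Fin k} {c : Fin n}
    (hc : M.IsLeadingEntry r c) : c = p r :=
  hc.unique (h.isLeadingEntry r)

theorem isReducedRowEchelon (h : HasPivots M p) : M.IsReducedRowEchelon where
  isRowEchelon := by
    intro i j hij c hc
    refine h.eq_zero j c ?_
    have h1 : c ≤ p i := by
      by_contra hlt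
      exact (h.isLeadingEntry i).2 (hc _ (not_le.mp hlt))
    exact h1.trans_lt (h.strictMono hij)
  eq_one := by
    intro i c hc
    rw [h.eq_of_isLeadingEntry hc, h.apply_pivot, if_pos rfl]
  eq_zero := by
    intro i j c hij hc
    rw [h.eq_of_isLeadingEntry hc, h.apply_pivot, if_neg hij.ne]

theorem sum_apply_pivot (h : HasPivots M p) (a : Fin k → F) (s : Fin k) :
    (∑ r, a r • M r) (p s) = a s := by
  rw [Finset.sum_apply]
  simp [h.apply_pivot]

theorem linearIndependent (h : HasPivots M p) : LinearIndependent F fun r => M r := by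
  rw [Fintype.linearIndependent_iff]
  intro a ha s
  have := h.sum_apply_pivot a s
  rw [ha] at this
  exact this.symm

theorem finrank_span (h : HasPivots M p) :
    Module.finrank F (Submodule.span F (Set.range fun r => M r)) = k := by
  rw [finrank_span_eq_card h.linearIndependent, Fintype.card_fin]

theorem eq_sum (h : HasPivots M p) {x : Fin n → F}
    (hx : x ∈ Submodule.span F (Set.range fun r => M r)) : x = ∑ r, x (p r) • M r := by
  obtain ⟨a, rfl⟩ := (Submodule.mem_span_range_iff_exists_fun F).mp hx
  refine Finset.sum_congr rfl fun r _ => ?_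
  rw [h.sum_apply_pivot]

/-- Expand `x` in the rows, with its entries at the pivots as coefficients. Rows with a pivot left
of `c` get coefficient zero, and rows with a pivot right of `c` vanish at `c`, so some pivot is at
`c`. -/
theorem mem_range_of_leading (h : HasPivots M p) {x : Fin n → F} {c : Fin n}
    (hx : x ∈ Submodule.span F (Set.range fun r => M r)) (h0 : ∀ j < c, x j = 0) (hc : x c ≠ 0) :
    c ∈ Set.range p := by
  classical
  have hsum := h.eq_sum hx
  by_contra hcp
  apply hc
  rw [hsum, Finset.sum_apply]
  refine Finset.sum_eq_zero fun r _ => ?_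
  rcases lt_trichotomy (p r) c with hlt | heq | hgt
  · simp [h0 _ hlt]
  · exact absurd ⟨r, heq⟩ hcp
  · simp [h.eq_zero r c hgt]

theorem range_subset (h : HasPivots M p) (h' : HasPivots M' p')
    (hs : Submodule.span F (Set.range fun r => M r) =
      Submodule.span F (Set.range fun r => M' r)) : Set.range p ⊆ Set.range p' := by
  rintro _ ⟨r, rfl⟩
  refine h'.mem_range_of_leading (x := M r) ?_ (h.isLeadingEntry r).1 (h.isLeadingEntry r).2
  rw [← hs]
  exact Submodule.subset_span ⟨r, rfl⟩

/-- The set of pivots depends only on the span, and an increasing enumeration is determined by its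
range, so `p = p'`. A row of `M`, expanded in the rows of `M'` by its pivot entries, is then the row
of `M'` with the same number. -/
theorem unique (h : HasPivots M p) (h' : HasPivots M' p')
    (hs : Submodule.span F (Set.range fun r => M r) =
      Submodule.span F (Set.range fun r => M' r)) : M = M' := by
  obtain rfl : p = p' := (h.strictMono.range_inj h'.strictMono).mp
    ((h.range_subset h' hs).antisymm (h'.range_subset h hs.symm))
  funext r
  have hr : M r ∈ Submodule.span F (Set.range fun r => M' r) := by
    rw [← hs]; exact Submodule.subset_span ⟨r, rfl⟩
  have := h'.eq_sum hr
  rw [this]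
  simp only [h.apply_pivot, ite_smul, one_smul, zero_smul]
  exact (Finset.sum_ite_eq Finset.univ r M').trans (if_pos (Finset.mem_univ r))

end HasPivots

/-! ### Existence of the reduced row echelon form -/

/-- The positions of the leading entries of the vectors of `X`. -/
def leadSet (X : Submodule F (Fin n → F)) : Set (Fin n) :=
  {c | ∃ x ∈ X, (∀ j < c, x j = 0) ∧ x c ≠ 0}

theorem exists_leading {x : Fin n → F} (hx : x ≠ 0) : ∃ c, (∀ j < c, x j = 0) ∧ x c ≠ 0 :=
  (Matrix.row_ne_zero_iff_exists_isLeadingEntry (A := fun _ : Unit => x) (i := ())).mp hx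

/-- Downward induction on `c`: normalise a vector leading at `c` and clear its entries at later
leading positions by their reduced vectors. These vanish up to `c` and at each other's leading
positions, so the clearings do not interfere. -/
theorem exists_reduced_vector (X : Submodule F (Fin n → F)) (c : Fin n) : c ∈ leadSet X →
    ∃ y ∈ X, (∀ j < c, y j = 0) ∧ y c = 1 ∧ ∀ d ∈ leadSet X, d ≠ c → y d = 0 := by
  classical
  induction c using WellFoundedGT.induction with
  | ind c ih =>
  rintro ⟨x, hxX, hx0, hxc⟩
  -- For irrelevant `d` the zero vector serves as default, so that `choose` yields a function on all
  -- positions.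
  have hY : ∀ d, ∃ y ∈ X, c < d → d ∈ leadSet X →
      (∀ j < d, y j = 0) ∧ y d = 1 ∧ ∀ e ∈ leadSet X, e ≠ d → y e = 0 := by
    intro d
    by_cases hd : c < d ∧ d ∈ leadSet X
    · obtain ⟨y, h1, h2⟩ := ih d hd.1 hd.2
      exact ⟨y, h1, fun _ _ => h2⟩
    · exact ⟨0, X.zero_mem, fun h1 h2 => absurd ⟨h1, h2⟩ hd⟩
  choose Y hYX hYp using hY
  set x' := (x c)⁻¹ • x with hx'
  set S := Finset.univ.filter fun d => c < d ∧ d ∈ leadSet X with hS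
  have hmem : ∀ {d}, d ∈ S → c < d ∧ d ∈ leadSet X := fun hd => (Finset.mem_filter.mp hd).2
  have hlow : ∀ j ≤ c, (∑ d ∈ S, x' d • Y d) j = 0 := by
    intro j hj
    rw [Finset.sum_apply]
    refine Finset.sum_eq_zero fun d hd => ?_
    obtain ⟨h1, h2⟩ := hmem hd
    simp [(hYp d h1 h2).1 j (hj.trans_lt h1)]
  refine ⟨x' - ∑ d ∈ S, x' d • Y d,
    X.sub_mem (X.smul_mem _ hxX) (X.sum_mem fun d _ => X.smul_mem _ (hYX d)), ?_, ?_, ?_⟩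
  · intro j hj
    rw [Pi.sub_apply, hlow j hj.le, hx']
    simp [hx0 j hj]
  · rw [Pi.sub_apply, hlow c le_rfl, hx']
    simp [hxc]
  · intro e he hec
    rcases lt_or_gt_of_ne hec with hlt | hgt
    · rw [Pi.sub_apply, hlow e hlt.le, hx']
      simp [hx0 e hlt]
    · have heS : e ∈ S := Finset.mem_filter.mpr ⟨Finset.mem_univ _, hgt, he⟩
      rw [Pi.sub_apply, Finset.sum_apply, Finset.sum_eq_single_of_mem e heS]
      · simp [(hYp e hgt he).2.1]
      · intro d hd hde
        obtain ⟨h1, h2⟩ := hmem hd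
        simp [(hYp d h1 h2).2.2 e he hde.symm]

/-- The reduced vectors span: `x` minus the combination with coefficients `x (p r)` vanishes at
every leading position of `X`, so it has no leading entry and is zero. The number of rows is then
forced to be `k` by the dimension. -/
theorem exists_generator (X : Submodule F (Fin n → F)) (hX : Module.finrank F X = k) :
    ∃ (M : Matrix (Fin k) (Fin n) F) (p : Fin k → Fin n), HasPivots M p ∧
      Submodule.span F (Set.range fun r => M r) = X := by
  classical
  set S := (Finset.univ : Finset (Fin n)).filter fun d => d ∈ leadSet X with hS
  have hmem : ∀ d, d ∈ S ↔ d ∈ leadSet X := fun d => by simp [hS]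
  set p := S.orderEmbOfFin rfl with hp
  have hpm : ∀ r, p r ∈ leadSet X := fun r => (hmem _).mp (S.orderEmbOfFin_mem rfl r)
  choose y hyX hy0 hy1 hy2 using fun r => exists_reduced_vector X (p r) (hpm r)
  have hpiv : HasPivots (Matrix.of y) p := by
    refine ⟨p.strictMono, ?_, fun r c hc => hy0 r c hc⟩
    intro r s
    split_ifs with hrs
    · subst hrs; exact hy1 r
    · exact hy2 r _ (hpm s) fun h => hrs (p.injective h).symm
  have hspan : Submodule.span F (Set.range fun r => Matrix.of y r) = X := by
    apply le_antisymm
    · rw [Submodule.span_le]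
      rintro _ ⟨r, rfl⟩
      exact hyX r
    · intro x hx
      have hz : x - ∑ r, x (p r) • Matrix.of y r = 0 := by
        by_contra hne
        obtain ⟨c, h0, hc⟩ := exists_leading hne
        have hzX : x - ∑ r, x (p r) • Matrix.of y r ∈ X :=
          X.sub_mem hx (X.sum_mem fun r _ => X.smul_mem _ (hyX r))
        have hcS : c ∈ S := (hmem c).mpr ⟨_, hzX, h0, hc⟩
        obtain ⟨s, rfl⟩ : ∃ s, p s = c := by
          have : c ∈ Set.range p := by rw [hp, Finset.range_orderEmbOfFin]; exact hcS
          exact this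
        apply hc
        rw [Pi.sub_apply, hpiv.sum_apply_pivot, sub_self]
      rw [sub_eq_zero.mp hz]
      exact Submodule.sum_mem _ fun r _ => Submodule.smul_mem _ _ (Submodule.subset_span ⟨r, rfl⟩)
  have hk : S.card = k := by rw [← hpiv.finrank_span, hspan, hX]
  subst hk
  exact ⟨_, _, hpiv, hspan⟩

theorem RE_spec {X : Submodule F (Fin n → F)} (hX : X ∈ Gr F n k) :
    (∃ p, HasPivots (RE k X) p) ∧ Submodule.span F (Set.range fun r => RE k X r) = X := by
  have hex : ∃ M : Matrix (Fin k) (Fin n) F,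
      M.IsReducedRowEchelon ∧ Submodule.span F (Set.range fun r => M r) = X := by
    obtain ⟨M, p, h1, h2⟩ := exists_generator X hX
    exact ⟨M, h1.isReducedRowEchelon, h2⟩
  obtain ⟨h1, h2⟩ := Classical.epsilon_spec hex
  refine ⟨exists_hasPivots h1 ?_, h2⟩
  -- The `k` rows span a space of dimension `k`, so they are independent, and in particular nonzero.
  have hli : LinearIndependent F fun r => RE k X r := by
    rw [linearIndependent_iff_card_eq_finrank_span, Fintype.card_fin]
    have hX' : Module.finrank F X = k := hX
    exact hX'.symm.trans (congrArg (fun Y : Submodule F (Fin n → F) => Module.finrank F Y) h2.symm)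
  exact fun r => hli.ne_zero r

theorem RE_eq {X : Submodule F (Fin n → F)} {M : Matrix (Fin k) (Fin n) F} {p : Fin k → Fin n}
    (h : HasPivots M p) (hs : Submodule.span F (Set.range fun r => M r) = X) : RE k X = M := by
  have hX : X ∈ Gr F n k := by
    subst hs
    exact h.finrank_span
  obtain ⟨⟨p', h'⟩, hs'⟩ := RE_spec hX
  exact h'.unique h (hs'.trans hs.symm)

theorem idVec_eq_one_iff {X : Submodule F (Fin n → F)} {p : Fin k → Fin n}
    (h : HasPivots (RE k X) p) (c : Fin n) : idVec k X c = 1 ↔ c ∈ Set.range p := by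
  unfold idVec
  have : (∃ r, (RE k X).IsLeadingEntry r c) ↔ c ∈ Set.range p :=
    ⟨fun ⟨r, hr⟩ => ⟨r, (h.eq_of_isLeadingEntry hr).symm⟩,
      fun ⟨r, hr⟩ => ⟨r, hr ▸ h.isLeadingEntry r⟩⟩
  rw [← this]
  split_ifs with hc <;> simp [hc]

theorem idVec_le_one (k : ℕ) (X : Submodule F (Fin n → F)) (c : Fin n) : idVec k X c ≤ 1 := by
  unfold idVec
  split_ifs <;> simp

end Echelon

/-! ### The index of a subspace -/

/-- A matrix, extended by zeros. -/
def extendMat {a b : ℕ} (M : Matrix (Fin a) (Fin b) ℕ) (r c : ℕ) : ℕ :=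
  if h : r < a ∧ c < b then M ⟨r, h.1⟩ ⟨c, h.2⟩ else 0

theorem extendMat_apply {a b : ℕ} (M : Matrix (Fin a) (Fin b) ℕ) (r : Fin a) (c : Fin b) :
    extendMat M r c = M r c := by
  simp [extendMat]

theorem matArray_eq {a b : ℕ} (M : Matrix (Fin a) (Fin b) ℕ) (t : ℕ) :
    matArray M t = extendMat M (t / b) (t % b) := by
  unfold matArray extendMat
  by_cases h : t < a * b
  · have hb : 0 < b := by
      rcases Nat.eq_zero_or_pos b with rfl | hb
      · simp at h
      · exact hb
    have h1 : t / b < a ∧ t % b < b :=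
      ⟨(Nat.div_lt_iff_lt_mul hb).mpr h, Nat.mod_lt _ hb⟩
    rw [dif_pos h, dif_pos h1]
    rfl
  · rw [dif_neg h, dif_neg]
    rintro ⟨h1, h2⟩
    exact h ((Nat.div_lt_iff_lt_mul (by omega)).mp h1)

section Index

variable {F : Type*} [Field F] [Fintype F] {n k : ℕ} (σ : F ≃ Fin (Fintype.card F))

/-- The extended representation of `X`, extended by zeros. -/
noncomputable def extArr (k : ℕ) (X : Submodule F (Fin n → F)) : ℕ → ℕ → ℕ :=
  extendMat (EXT σ k X)

variable {σ}

theorem extArr_zero (X : Submodule F (Fin n → F)) (c : Fin n) :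
    extArr σ k X 0 c = idVec k X c := by
  simpa [extArr, EXT] using extendMat_apply (EXT σ k X) 0 c

theorem extArr_succ (X : Submodule F (Fin n → F)) (r : Fin k) (c : Fin n) :
    extArr σ k X (r + 1) c = σ (RE k X r c) := by
  simpa [extArr, EXT] using extendMat_apply (EXT σ k X) r.succ c

theorem extArr_of_le (X : Submodule F (Fin n → F)) {r c : ℕ} (h : k < r ∨ n ≤ c) :
    extArr σ k X r c = 0 := by
  unfold extArr extendMat
  rw [dif_neg (by omega)]

/-- As `p` is increasing, the rows whose pivots lie left of column `c` form an initial segment, and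
`wt` is its length. This links the digit array to the pivots. -/
theorem lt_wt_iff {X : Submodule F (Fin n → F)} {p : Fin k → Fin n} (h : HasPivots (RE k X) p)
    {c : ℕ} (hc : c ≤ n) : wt (extArr σ k X) c ≤ k ∧
      ∀ r : Fin k, (r : ℕ) < wt (extArr σ k X) c ↔ (p r : ℕ) < c := by
  induction c with
  | zero => simp [wt]
  | succ c ih =>
    obtain ⟨ih1, ih2⟩ := ih (by omega)
    have he := extArr_zero (σ := σ) (k := k) X ⟨c, hc⟩
    have hiff := idVec_eq_one_iff h ⟨c, hc⟩
    have hle := idVec_le_one k X ⟨c, hc⟩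
    simp only at he
    rw [wt_succ, he]
    by_cases hr : (⟨c, hc⟩ : Fin n) ∈ Set.range p
    · rw [hiff.mpr hr]
      obtain ⟨r₀, hr₀⟩ := hr
      have hr₀' : (p r₀ : ℕ) = c := by rw [hr₀]
      have hw : wt (extArr σ k X) c = r₀ := by
        by_contra hne
        rcases lt_or_gt_of_ne hne with hlt | hgt
        · have h1 := ih2 ⟨wt (extArr σ k X) c, by omega⟩
          have h2 : p ⟨wt (extArr σ k X) c, by omega⟩ < p r₀ := h.strictMono hlt
          rw [Fin.lt_def] at h2
          simp only at h1
          omega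
        · have := (ih2 r₀).mp hgt
          omega
      rw [hw]
      refine ⟨r₀.2, fun r => ?_⟩
      have h3 : p r ≤ p r₀ ↔ r ≤ r₀ := h.strictMono.le_iff_le
      rw [Fin.le_def, Fin.le_def] at h3
      omega
    · have h0 : idVec k X ⟨c, hc⟩ = 0 := by
        have : idVec k X ⟨c, hc⟩ ≠ 1 := fun h1 => hr (hiff.mp h1)
        omega
      rw [h0]
      refine ⟨ih1, fun r => ?_⟩
      have hne : (p r : ℕ) ≠ c := fun h1 => hr ⟨r, Fin.ext h1⟩
      have := ih2 r
      omega

theorem wt_extArr {X : Submodule F (Fin n → F)} (hX : X ∈ Gr F n k) :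
    wt (extArr σ k X) n = k := by
  obtain ⟨⟨p, h⟩, -⟩ := RE_spec hX
  obtain ⟨h1, h2⟩ := lt_wt_iff (σ := σ) h le_rfl
  by_contra hne
  have := (h2 ⟨wt (extArr σ k X) n, by omega⟩).mpr (p _).2
  simp at this

theorem valid_extArr (h0 : (σ 0 : ℕ) = 0) (h1 : (σ 1 : ℕ) = 1) {X : Submodule F (Fin n → F)}
    (hX : X ∈ Gr F n k) : Valid (Fintype.card F) n (extArr σ k X) := by
  obtain ⟨⟨p, h⟩, -⟩ := RE_spec hX
  have hq : 1 < Fintype.card F := Fintype.one_lt_card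
  refine ⟨?_, ?_, ?_, ?_, fun r c hc => extArr_of_le X (Or.inr hc)⟩
  · intro r c
    by_cases hrc : k < r ∨ n ≤ c
    · rw [extArr_of_le X hrc]; omega
    · push Not at hrc
      cases r with
      | zero =>
        have := extArr_zero (σ := σ) (k := k) X ⟨c, hrc.2⟩
        have hle := idVec_le_one k X ⟨c, hrc.2⟩
        simp only at this
        omega
      | succ r =>
        have := extArr_succ (σ := σ) X ⟨r, hrc.1⟩ ⟨c, hrc.2⟩
        simp only at this
        rw [this]
        exact (σ _).2
  · intro c hc
    have := extArr_zero (σ := σ) (k := k) X ⟨c, hc⟩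
    have hle := idVec_le_one k X ⟨c, hc⟩
    simp only at this
    omega
  · intro c hc hE r hr
    by_cases hrk : r < k
    · have he := extArr_zero (σ := σ) (k := k) X ⟨c, hc⟩
      have hs := extArr_succ (σ := σ) X ⟨r, hrk⟩ ⟨c, hc⟩
      have hiff := idVec_eq_one_iff h ⟨c, hc⟩
      have hw := (lt_wt_iff (σ := σ) h hc.le).2 ⟨r, hrk⟩
      simp only at he hs hw
      have hne : p ⟨r, hrk⟩ ≠ ⟨c, hc⟩ := fun hp => by
        have := hiff.mpr ⟨_, hp⟩
        omega
      have hlt : (⟨c, hc⟩ : Fin n) < p ⟨r, hrk⟩ := by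
        rw [Fin.lt_def]
        rw [Ne, Fin.ext_iff] at hne
        simp only at hne ⊢
        omega
      rw [hs, h.eq_zero _ _ hlt, h0]
    · exact extArr_of_le X (Or.inl (by omega))
  · intro c hc hE r
    have he := extArr_zero (σ := σ) (k := k) X ⟨c, hc⟩
    simp only at he
    obtain ⟨r₀, hr₀⟩ := (idVec_eq_one_iff h ⟨c, hc⟩).mp (he.symm.trans hE)
    have hw : wt (extArr σ k X) c = r₀ := by
      have hr₀' : (p r₀ : ℕ) = c := by rw [hr₀]
      obtain ⟨w1, w2⟩ := lt_wt_iff (σ := σ) h hc.le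
      by_contra hne
      rcases lt_or_gt_of_ne hne with hlt | hgt
      · have h1 := w2 ⟨wt (extArr σ k X) c, by omega⟩
        have h2 : p ⟨wt (extArr σ k X) c, by omega⟩ < p r₀ := h.strictMono hlt
        rw [Fin.lt_def] at h2
        simp only at h1
        omega
      · have := (w2 r₀).mp hgt
        omega
    rw [hw]
    by_cases hrk : r < k
    · have hs := extArr_succ (σ := σ) X ⟨r, hrk⟩ ⟨c, hc⟩
      simp only at hs
      rw [hs, ← hr₀, h.apply_pivot]
      by_cases hrr : r = r₀
      · rw [if_pos (Fin.ext hrr), if_pos hrr, h1]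
      · rw [if_neg (fun h => hrr (Fin.ext_iff.mp h)), if_neg hrr, h0]
    · rw [extArr_of_le X (Or.inl (by omega)), if_neg (by omega)]

theorem extArr_injOn : Set.InjOn (fun X : Submodule F (Fin n → F) => extArr σ k X) (Gr F n k) := by
  intro X hX Y hY hXY
  have hRE : RE k X = RE k Y := by
    funext r c
    apply σ.injective
    apply Fin.ext
    rw [← extArr_succ X r c, ← extArr_succ Y r c]
    exact congrFun (congrFun hXY _) _
  rw [← (RE_spec hX).2, ← (RE_spec hY).2, hRE]

/-- The weight grows by at most one per column, so it jumps from `r` to `r + 1` where it first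
exceeds `r`. -/
theorem exists_pivot_column {E : ℕ → ℕ → ℕ} {q : ℕ} (hE : Valid q n E) {r : ℕ} (hr : r < wt E n) :
    ∃ c < n, E 0 c = 1 ∧ wt E c = r := by
  have hex : ∃ c, r < wt E c := ⟨n, hr⟩
  classical
  obtain ⟨c, hc⟩ : ∃ c, Nat.find hex = c + 1 := by
    refine ⟨Nat.find hex - 1, ?_⟩
    have : Nat.find hex ≠ 0 := fun h => by
      have := Nat.find_spec hex
      rw [h] at this
      simp [wt] at this
    omega
  have h1 : r < wt E (c + 1) := hc ▸ Nat.find_spec hex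
  have h2 : ¬ r < wt E c := Nat.find_min hex (by omega)
  have h3 : c + 1 ≤ n := hc ▸ Nat.find_min' hex hr
  rw [wt_succ] at h1
  have := hE.le_one c h3
  exact ⟨c, h3, by omega, by omega⟩

/-- Read the lower rows through `σ.symm`; the normalisation of `σ` at `0` and `1` makes the pivot
columns unit vectors. By the uniqueness in `RE_eq`, this matrix is the echelon form of its own span.
-/
theorem exists_extArr_eq (h0 : (σ 0 : ℕ) = 0) (h1 : (σ 1 : ℕ) = 1) {E : ℕ → ℕ → ℕ}
    (hE : Valid (Fintype.card F) n E) (hk : wt E n = k) :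
    ∃ X ∈ Gr F n k, extArr σ k X = E := by
  have hs0 : ∀ h, σ.symm ⟨0, h⟩ = 0 := fun h => by
    rw [Equiv.symm_apply_eq]; exact Fin.ext h0.symm
  have hs1 : ∀ h, σ.symm ⟨1, h⟩ = 1 := fun h => by
    rw [Equiv.symm_apply_eq]; exact Fin.ext h1.symm
  have hval : ∀ a (ha : a < Fintype.card F), a = 0 → σ.symm ⟨a, ha⟩ = 0 := by
    rintro a ha rfl; exact hs0 ha
  have hval1 : ∀ a (ha : a < Fintype.card F), a = 1 → σ.symm ⟨a, ha⟩ = 1 := by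
    rintro a ha rfl; exact hs1 ha
  have hex : ∀ r : Fin k, ∃ c : Fin n, E 0 c = 1 ∧ wt E c = r := fun r => by
    obtain ⟨c, hc, h⟩ := exists_pivot_column hE (r := r) (by rw [hk]; exact r.2)
    exact ⟨⟨c, hc⟩, h⟩
  choose p hp1 hp2 using hex
  set M : Matrix (Fin k) (Fin n) F := fun r c => σ.symm ⟨E (r + 1) c, hE.lt _ _⟩ with hM
  have hpiv : HasPivots M p := by
    refine ⟨?_, ?_, ?_⟩
    · intro r s hrs
      by_contra hle
      have := wt_mono E (Fin.le_def.mp (not_lt.mp hle))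
      rw [hp2, hp2] at this
      exact absurd hrs (not_lt.mpr (Fin.le_def.mpr this))
    · intro r s
      have := hE.pivot (p s) (p s).2 (hp1 s) r
      rw [hp2] at this
      split_ifs with hrs
      · exact hval1 _ _ (by rw [this, if_pos (by rw [hrs])])
      · exact hval _ _ (by rw [this, if_neg (fun h => hrs (Fin.ext h))])
    · intro r c hc
      apply hval
      have hw := wt_mono E (Nat.succ_le_of_lt (Fin.lt_def.mp hc))
      rw [hp2, Nat.succ_eq_add_one, wt_succ] at hw
      rcases hE.zero_or_one c.2 with e0 | e1
      · exact hE.free c c.2 e0 r (by omega)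
      · rw [hE.pivot c c.2 e1, if_neg (by omega)]
  refine ⟨Submodule.span F (Set.range fun r => M r), hpiv.finrank_span, ?_⟩
  have hRE := RE_eq hpiv rfl
  funext r c
  by_cases hrc : k < r ∨ n ≤ c
  · rw [extArr_of_le _ hrc]
    rcases hrc with h | h
    · exact (hE.row_eq_zero hk h).symm
    · exact (hE.out r c h).symm
  · push Not at hrc
    cases r with
    | zero =>
      have he := extArr_zero (σ := σ) (k := k) (Submodule.span F (Set.range fun r => M r)) ⟨c, hrc.2⟩
      simp only at he
      have hiff := idVec_eq_one_iff (k := k) (X := Submodule.span F (Set.range fun r => M r))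
        (p := p) (by rw [hRE]; exact hpiv) ⟨c, hrc.2⟩
      have hle := idVec_le_one k (Submodule.span F (Set.range fun r => M r)) ⟨c, hrc.2⟩
      have hle' := hE.le_one c hrc.2
      have key : (⟨c, hrc.2⟩ : Fin n) ∈ Set.range p ↔ E 0 c = 1 := by
        constructor
        · rintro ⟨r, hr⟩
          have := hp1 r
          rw [hr] at this
          exact this
        · intro h1
          have hw : wt E c + 1 ≤ k := by
            rw [← h1, ← wt_succ, ← hk]
            exact wt_mono E hrc.2
          refine ⟨⟨wt E c, hw⟩, Fin.ext ?_⟩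
          have g1 := hp1 ⟨wt E c, hw⟩
          have g2 := hp2 ⟨wt E c, hw⟩
          simp only at g2 ⊢
          by_contra hne
          rcases lt_or_gt_of_ne hne with hlt | hgt
          · have := wt_mono E (Nat.succ_le_of_lt hlt)
            rw [Nat.succ_eq_add_one, wt_succ] at this
            omega
          · have := wt_mono E (Nat.succ_le_of_lt hgt)
            rw [Nat.succ_eq_add_one, wt_succ] at this
            omega
      rw [he]
      rw [key] at hiff
      omega
    | succ r =>
      have hs := extArr_succ (σ := σ) (Submodule.span F (Set.range fun r => M r))
        ⟨r, hrc.1⟩ ⟨c, hrc.2⟩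
      simp only at hs
      rw [hs, hRE, hM]
      simp

/-! ### The lexicographic index as a value of `idx` -/

theorem colValue_eq (X : Submodule F (Fin n → F)) (q : ℕ) (c : Fin n) :
    colValue q (EXT σ k X) c =
      ∑ t ∈ Finset.range (k + 1), extArr σ k X (k - t) c * q ^ t := by
  unfold colValue
  rw [← Finset.sum_range_reflect, ← Fin.sum_univ_eq_sum_range
    (fun j => extArr σ k X (k - (k + 1 - 1 - j)) c * q ^ (k + 1 - 1 - j))]
  refine Finset.sum_congr rfl fun r _ => ?_
  have hr := r.2
  rw [show k - (k + 1 - 1 - (r : ℕ)) = r by omega, show k + 1 - 1 - (r : ℕ) = k - r by omega,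
    extArr, extendMat_apply]

/-- One direction is `idx_lt_idx`. For the other, distinct arrays differ in a last column; if the
comparison there went the wrong way, the first direction would reverse the inequality of indices. -/
theorem extLT_iff (h0 : (σ 0 : ℕ) = 0) (h1 : (σ 1 : ℕ) = 1) {X Y : Submodule F (Fin n → F)}
    (hX : X ∈ Gr F n k) (hY : Y ∈ Gr F n k) :
    extLT σ k X Y ↔
      idx (Fintype.card F) (extArr σ k X) n < idx (Fintype.card F) (extArr σ k Y) n := by
  have vX := valid_extArr h0 h1 hX
  have vY := valid_extArr h0 h1 hY
  have wX := wt_extArr (σ := σ) hX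
  have wY := wt_extArr (σ := σ) hY
  have hfwd : ∀ {X Y : Submodule F (Fin n → F)}, X ∈ Gr F n k → Y ∈ Gr F n k → extLT σ k X Y →
      idx (Fintype.card F) (extArr σ k X) n < idx (Fintype.card F) (extArr σ k Y) n := by
    rintro X Y hX hY ⟨c, hag, hlt⟩
    rw [colValue_eq, colValue_eq] at hlt
    refine (valid_extArr h0 h1 hX).idx_lt_idx (valid_extArr h0 h1 hY) (wt_extArr hX)
      (wt_extArr hY) c.2 ?_ hlt
    intro c' hc hc' r
    by_cases hr : r < k + 1
    · have := hag ⟨c', hc'⟩ hc ⟨r, hr⟩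
      rw [← extendMat_apply (EXT σ k X), ← extendMat_apply (EXT σ k Y)] at this
      exact this
    · rw [extArr_of_le _ (Or.inl (by omega)), extArr_of_le _ (Or.inl (by omega))]
  refine ⟨hfwd hX hY, fun hlt => ?_⟩
  have hne : extArr σ k X ≠ extArr σ k Y := fun h => by rw [h] at hlt; exact lt_irrefl _ hlt
  obtain ⟨c, hc, hag, hcol⟩ := vX.exists_last_ne vY wX wY hne
  have hag' : ∀ c' : Fin n, (⟨c, hc⟩ : Fin n) < c' → ∀ r, EXT σ k X r c' = EXT σ k Y r c' := by
    intro c' hc' r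
    rw [← extendMat_apply (EXT σ k X), ← extendMat_apply (EXT σ k Y)]
    exact hag c' hc' c'.2 r
  rcases lt_or_gt_of_ne hcol with h | h
  · exact ⟨⟨c, hc⟩, hag', by rw [colValue_eq, colValue_eq]; exact h⟩
  · exfalso
    have := hfwd hY hX ⟨⟨c, hc⟩, fun c' hc' r => (hag' c' hc' r).symm, by
      rw [colValue_eq, colValue_eq]; exact h⟩
    omega

theorem bijOn_idx (h0 : (σ 0 : ℕ) = 0) (h1 : (σ 1 : ℕ) = 1) (hkn : k ≤ n) :
    Set.BijOn (fun X : Submodule F (Fin n → F) => idx (Fintype.card F) (extArr σ k X) n)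
      (Gr F n k) (Set.Iio (gauss (Fintype.card F) k (n - k))) := by
  refine ⟨?_, ?_, ?_⟩
  · intro X hX
    exact (valid_extArr h0 h1 hX).idx_lt le_rfl (wt_extArr hX) (by omega)
  · intro X hX Y hY hXY
    by_contra hne
    have hE : extArr σ k X ≠ extArr σ k Y := fun h => hne (extArr_injOn hX hY h)
    obtain ⟨c, hc, hag, hcol⟩ := (valid_extArr h0 h1 hX).exists_last_ne (valid_extArr h0 h1 hY)
      (wt_extArr hX) (wt_extArr hY) hE
    rcases lt_or_gt_of_ne hcol with h | h
    · exact (((valid_extArr h0 h1 hX).idx_lt_idx (valid_extArr h0 h1 hY) (wt_extArr hX)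
        (wt_extArr hY) hc hag h).ne hXY)
    · exact (((valid_extArr h0 h1 hY).idx_lt_idx (valid_extArr h0 h1 hX) (wt_extArr hY)
        (wt_extArr hX) hc (fun c' h h' r => (hag c' h h' r).symm) h).ne hXY.symm)
  · intro i hi
    obtain ⟨E, hE, hw, hidx⟩ := exists_valid_idx (q := Fintype.card F) Fintype.one_lt_card n k
      (n - k) (by omega) i hi
    obtain ⟨X, hX, rfl⟩ := exists_extArr_eq h0 h1 hE hw
    exact ⟨X, hX, hidx⟩

theorem ncard_Gr (h0 : (σ 0 : ℕ) = 0) (h1 : (σ 1 : ℕ) = 1) (hkn : k ≤ n) :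
    (Gr F n k).ncard = gauss (Fintype.card F) k (n - k) := by
  have h := bijOn_idx (n := n) (k := k) h0 h1 hkn
  rw [← h.injOn.ncard_image, h.image_eq, ← Finset.coe_range,
    Set.ncard_coe_finset, Finset.card_range]

/-- By monotonicity and the bijection onto an initial segment of `ℕ`, the predecessors of `X`
correspond to all numbers below `idx`. -/
theorem Ind₂_eq (h0 : (σ 0 : ℕ) = 0) (h1 : (σ 1 : ℕ) = 1) (hkn : k ≤ n)
    {X : Submodule F (Fin n → F)} (hX : X ∈ Gr F n k) :
    Ind₂ σ k X = idx (Fintype.card F) (extArr σ k X) n := by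
  have h := bijOn_idx (n := n) (k := k) h0 h1 hkn
  have hsub : {Y | Y ∈ Gr F n k ∧ extLT σ k Y X} ⊆ Gr F n k := fun Y hY => hY.1
  unfold Ind₂
  rw [← (h.injOn.mono hsub).ncard_image]
  have himg : (fun X : Submodule F (Fin n → F) => idx (Fintype.card F) (extArr σ k X) n) ''
      {Y | Y ∈ Gr F n k ∧ extLT σ k Y X} =
      ((Finset.range (idx (Fintype.card F) (extArr σ k X) n) : Finset ℕ) : Set ℕ) := by
    ext i
    simp only [Set.mem_image, Set.mem_ofPred_eq, Finset.coe_range, Set.mem_Iio]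
    constructor
    · rintro ⟨Y, ⟨hY, hlt⟩, rfl⟩
      exact (extLT_iff h0 h1 hY hX).mp hlt
    · intro hi
      obtain ⟨Y, hY, rfl⟩ := h.surjOn (hi.trans (h.mapsTo hX))
      exact ⟨Y, ⟨hY, (extLT_iff h0 h1 hY hX).mpr hi⟩, rfl⟩
  rw [himg, Set.ncard_coe_finset, Finset.card_range]

end Index

end GrassEnc

namespace GrassEnc

/-! ### The common part of the two programs

Variables: `0`-`2` hold `q, n, k`, variable `3` the number of fractional digits, `4` the number of
digits of the number in array `2`, `5` and `6` the current `a` and `b`, `7` the position of the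
units digit, `17` the current column. -/

/-- By `gauss_ratios` the quotient of the two coefficients is `(q ^ (a + 1) - 1) / (q ^ (b + 1) -
1)`. The bound says that the index before a pivot column is below that column's contribution, which
therefore shows up as a single separate digit `1`. -/
theorem gauss_le_pow_mul_gauss {q : ℕ} (hq : 2 ≤ q) (a b : ℕ) :
    gauss q a (b + 1) ≤ q ^ (a + 1) * gauss q (a + 1) b := by
  obtain ⟨h1, h2⟩ := gauss_ratios q _ a b rfl
  have h3 : ((q : ℝ) ^ (b + 1) - 1) * gauss q a (b + 1) =
    ((q : ℝ) ^ (a + 1) - 1) * gauss q (a + 1) b := h1.symm.trans h2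
  have hq2 : (2 : ℝ) ≤ q := by exact_mod_cast hq
  have hb : (2 : ℝ) ≤ (q : ℝ) ^ (b + 1) :=
    hq2.trans (le_self_pow₀ (by linarith) (by omega))
  have g1 : (0 : ℝ) ≤ gauss q a (b + 1) := by positivity
  have g2 : (0 : ℝ) ≤ gauss q (a + 1) b := by positivity
  have : (gauss q a (b + 1) : ℝ) ≤ (q : ℝ) ^ (a + 1) * gauss q (a + 1) b := by nlinarith
  exact_mod_cast this

theorem gam_zero_right (q a : ℕ) : gam q a 0 = 1 := by simp [gam]

/-- The number of digits of the fixed point numbers. -/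
def numLen (n k : ℕ) : ℕ := 4 * n + 8 + k * (n - k) + n

/-- `B` bounds all numbers that the programs handle. -/
structure Sizes (q n k B : ℕ) : Prop where
  hq : 2 ≤ q
  hk : k ≤ n
  digits : 3 * (numLen n k * q) + numLen n k * q * q + q ≤ B
  positions : numLen n k + 2 * n + 8 ≤ B
  addresses : (n + 2) * (n + 2) ≤ B

theorem Sizes.mul_le {q n k B : ℕ} (h : Sizes q n k B) : k * (n - k) ≤ n * n :=
  Nat.mul_le_mul h.hk (Nat.sub_le _ _)

theorem Sizes.le_numLen (n k : ℕ) : 5 * n + 8 + k * (n - k) = numLen n k := by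
  unfold numLen; omega

/-- The constants that the programs keep in their variables. -/
structure Ctx (q n k : ℕ) (s : State) : Prop where
  v0 : s.var 0 = q
  v1 : s.var 1 = n
  v2 : s.var 2 = k
  v3 : s.var 3 = 4 * n + 8
  v4 : s.var 4 = numLen n k
  v15 : s.var 15 = numLen n k * q
  v16 : s.var 16 = numLen n k * q * q - numLen n k * q

theorem Ctx.setVar {q n k : ℕ} {s : State} (h : Ctx q n k s) {x : ℕ}
    (hx : x ∉ [0, 1, 2, 3, 4, 15, 16]) (v : ℕ) : Ctx q n k (s.setVar x v) := by
  simp only [List.mem_cons, List.not_mem_nil, not_or] at hx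
  obtain ⟨v0, v1, v2, v3, v4, v15, v16⟩ := h
  constructor <;> rw [State.setVar_var, if_neg (by omega)] <;> assumption

theorem Ctx.setArr {q n k : ℕ} {s : State} (h : Ctx q n k s) (A i v : ℕ) :
    Ctx q n k (s.setArr A i v) :=
  ⟨h.v0, h.v1, h.v2, h.v3, h.v4, h.v15, h.v16⟩

theorem Ctx.frame {q n k : ℕ} {s s' : State} {V A : List ℕ} (h : Ctx q n k s)
    (hF : Frame V A s s') (hV : ∀ x ∈ [0, 1, 2, 3, 4, 15, 16], x ∉ V) : Ctx q n k s' := by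
  obtain ⟨v0, v1, v2, v3, v4, v15, v16⟩ := h
  constructor <;> rw [hF.1 _ (hV _ (by simp))] <;> assumption

/-- Array `2` holds a fixed point number that represents the index `I`. -/
def Holds (q n k : ℕ) (s : State) (m a b I : ℕ) : Prop :=
  ∃ Z, s.arr 2 = digitArray q Z ∧ Approx q n (4 * n + 8) (numLen n k) m a b I Z

theorem Holds.of_arr {q n k m a b I : ℕ} {s s' : State} (h : Holds q n k s m a b I)
    (harr : s'.arr 2 = s.arr 2) : Holds q n k s' m a b I := by
  obtain ⟨Z, h1, h2⟩ := h
  exact ⟨Z, harr.trans h1, h2⟩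

theorem Holds.mono {q n k m m' a b I : ℕ} {s : State} (h : Holds q n k s m a b I)
    (hm : m ≤ m') : Holds q n k s m' a b I := by
  obtain ⟨Z, h1, h2⟩ := h
  exact ⟨Z, h1, h2.mono hm⟩

theorem rescale_move {q n k B m a b a' b' I u v : ℕ} {s : State} (hS : Sizes q n k B)
    (hC : Ctx q n k s) (h8 : s.var 8 = u) (h9 : s.var 9 = v) (hv : 1 ≤ v) (hu : u ≤ n)
    (hvn : v ≤ n) (hg : gam q a' b' * fac q u = gam q a b * fac q v) (hab : a' + b' ≤ n)
    (hm : m + 1 ≤ 3 * n) (hI : I < q ^ (k * (n - k) + n)) (hH : Holds q n k s m a b I) :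
    Tri q B rescaleProg s (numLen n k * 18 + 4) fun s' =>
      Holds q n k s' (m + 1) a' b' I ∧ Frame scratch [2] s s' := by
  obtain ⟨Z, h2, hZ⟩ := hH
  have hq := hS.hq
  have hZlt : Z < q ^ numLen n k := hZ.lt_pow hq hS.mul_le (by omega) rfl hI
  have hZ' := hZ.rescale hq hv hZlt hab hg
  have hZ'lt : rescale q (numLen n k) u v Z < q ^ numLen n k := hZ'.lt_pow hq hS.mul_le hm rfl hI
  have := hS.positions
  refine (rescaleProg_spec hq hv hZlt hZ'lt hC.v0 hC.v4 h8 h9 hC.v15 hC.v16 h2 (by omega)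
    hS.digits).mono le_rfl ?_
  rintro s' ⟨g1, g2⟩
  exact ⟨⟨_, g1, hZ'⟩, g2⟩

/-- Computation of the constants, and the digit `1` after the radix point. -/
def setupProg : Prog :=
  .arith 6 .sub (.var 1) (.var 2) ;; .arith 3 .add (.var 1) (.var 1) ;;
  .arith 3 .add (.var 3) (.var 3) ;; .arith 3 .add (.var 3) (.lit 8) ;;
  .arith 4 .mul (.var 2) (.var 6) ;; .arith 4 .add (.var 4) (.var 3) ;;
  .arith 4 .add (.var 4) (.var 1) ;; .arith 15 .mul (.var 4) (.var 0) ;;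
  .arith 16 .mul (.var 15) (.var 0) ;; .arith 16 .sub (.var 16) (.var 15) ;;
  .arith 13 .sub (.var 3) (.lit 1) ;; .store 2 (.var 13) (.lit 1)

theorem setupProg_spec {q n k B : ℕ} {input : ℕ → ℕ} (hS : Sizes q n k B) :
    Tri q B setupProg (initState q n k input) (digitLen q B + 11) fun s =>
      Ctx q n k s ∧ s.var 5 = 0 ∧ s.var 6 = n - k ∧ s.var 17 = 0 ∧ s.arr 0 = input ∧
      (s.arr 1 = fun _ => 0) ∧ s.arr 2 = Function.update (fun _ => 0) (4 * n + 7) 1 := by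
  obtain ⟨hq, hk, h1, h2, h3⟩ := hS
  have hlen := Sizes.le_numLen n k
  have i0 : (initState q n k input).var 0 = q := rfl
  have i1 : (initState q n k input).var 1 = n := rfl
  have i2 : (initState q n k input).var 2 = k := rfl
  refine Tri.mono (c₁ := 1+1+1+1+1+1+1+digitLen q B+1+1+1+1) ?_ (by omega) fun _ h => h
  refine Tri.step (Tri.sub ?_ ?_ ?_)
  · simp [i1]; omega
  · simp [i2]; omega
  refine Tri.step (Tri.add ?_ ?_ ?_)
  · simp [i1]; omega
  · simp [i1]; omega
  refine Tri.step (Tri.add ?_ ?_ ?_)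
  · simp [i1]; omega
  · simp [i1]; omega
  refine Tri.step (Tri.add ?_ ?_ ?_)
  · simp [i1]; omega
  · simp; omega
  refine Tri.step (Tri.mul ?_ ?_ ?_)
  · simp [i2]; omega
  · simp [i1, i2]; omega
  refine Tri.step (Tri.add ?_ ?_ ?_)
  · simp [i1, i2]; omega
  · simp [i1]; omega
  refine Tri.step (Tri.add ?_ ?_ ?_)
  · simp [i1, i2]; omega
  · simp [i1]; omega
  have e4 : k * (n - k) + (n + n + (n + n) + 8) + n = numLen n k := by omega
  refine Tri.step (Tri.mulBase hq ?_ ?_ ?_)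
  · simp [i0]
  · simp [i1, i2, e4]; omega
  refine Tri.step (Tri.mulBase hq ?_ ?_ ?_)
  · simp [i0]
  · simp [i1, i2, e4]; omega
  refine Tri.step (Tri.sub ?_ ?_ ?_)
  · simp [i1, i2, e4]; omega
  · simp [i1, i2, e4]; omega
  refine Tri.step (Tri.sub ?_ ?_ ?_)
  · simp [i1]; omega
  · simp; omega
  refine Tri.store ?_ ?_ ?_
  · simp [i1]; omega
  · simp; omega
  refine ⟨⟨?_, ?_, ?_, ?_, ?_, ?_, ?_⟩, ?_, ?_, ?_, ?_, ?_, ?_⟩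
  · simp [i0]
  · simp [i1]
  · simp [i2]
  · simp [i1]; omega
  · simp [i1, i2, e4]
  · simp [i1, i2, e4]
  · simp [i1, i2, e4]
  · simp [initState]
  · simp [i1, i2]
  · simp [initState]
  · simp [initState]
  · simp [initState]
  · simp only [State.setArr_arr, State.setVar_arr, if_true, Operand.val_var, Operand.val_lit,
      State.setVar_var, i1]
    simp only [initState]
    congr 1
    simp
    omega

/-- The step from `(a, b)` to `(a, b + 1)`. -/
def advanceProg : Prog :=
  .arith 8 .add (.var 6) (.lit 1) ;; .arith 9 .add (.var 8) (.var 5) ;; rescaleProg ;;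
  .arith 7 .add (.var 7) (.var 5) ;; .arith 6 .add (.var 6) (.lit 1)

theorem advanceProg_spec {q n k B m a b I : ℕ} {s : State} (hS : Sizes q n k B)
    (hC : Ctx q n k s) (h5 : s.var 5 = a) (h6 : s.var 6 = b) (h7 : s.var 7 = 4 * n + 8 + a * b)
    (ha : a ≤ k) (hb : b ≤ n - k) (hab : a + b + 1 ≤ n)
    (hm : m + 1 ≤ 3 * n) (hI : I < q ^ (k * (n - k) + n)) (hH : Holds q n k s m a b I) :
    Tri q B advanceProg s (numLen n k * 18 + 8) fun s' =>
      s'.var 6 = b + 1 ∧ s'.var 7 = 4 * n + 8 + a * (b + 1) ∧ Holds q n k s' (m + 1) a (b + 1) I ∧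
        Frame [6, 7, 8, 9, 10, 11, 12, 13, 14] [2] s s' := by
  have h1 := hS.positions
  have hlen := Sizes.le_numLen n k
  have hmul : a * b ≤ k * (n - k) := Nat.mul_le_mul ha hb
  refine Tri.mono (c₁ := 1 + 1 + (numLen n k * 18 + 4) + 1 + 1) ?_ (by omega) fun _ h => h
  refine Tri.step (Tri.add ?_ ?_ ?_)
  · simp [h6]; omega
  · simp; omega
  refine Tri.step (Tri.add ?_ ?_ ?_)
  · simp [h6]; omega
  · simp [h5]; omega
  refine Tri.seq (rescale_move (a' := a) (b' := b + 1) (u := b + 1) (v := a + b + 1) hS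
    ((hC.setVar (by simp) _).setVar (by simp) _) ?_ ?_ (by omega) (by omega) (by omega)
    (gam_succ_right (by have := hS.hq; omega) a b) (by omega) hm hI (hH.of_arr rfl)) ?_
  · simp [h6]
  · simp [h5, h6]; omega
  rintro s' ⟨g1, g2⟩
  have g5 : s'.var 5 = a := by rw [g2.1 5 (by simp)]; simp [h5]
  have g6 : s'.var 6 = b := by rw [g2.1 6 (by simp)]; simp [h6]
  have g7 : s'.var 7 = 4 * n + 8 + a * b := by rw [g2.1 7 (by simp)]; simp [h7]
  refine Tri.step (Tri.add ?_ ?_ ?_)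
  · simp [g7]; omega
  · simp [g5]; omega
  refine Tri.add ?_ ?_ ?_
  · simp [g6]; omega
  · simp; omega
  refine ⟨?_, ?_, g1.of_arr rfl, ?_⟩
  · simp [g6]
  · simp [g5, g7]; ring
  · refine Frame.setVar (Frame.setVar (Frame.trans ?_ g2 (by simp [scratch]) (by simp))
      (by simp) _) (by simp) _
    exact Frame.setVar (Frame.setVar (Frame.refl _ _ _) (by simp) _) (by simp) _

/-! ### The encoding program -/

/-- Copy the digits of the current column into the number. -/
def loadColProg : Prog :=
  .arith 13 .add (.var 7) (.var 5) ;; .arith 18 .add (.var 17) (.lit 0) ;;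
  .arith 10 .add (.lit 0) (.lit 0) ;;
  .while (.var 10) (.var 5)
    (.arith 13 .sub (.var 13) (.lit 1) ;; .arith 18 .add (.var 18) (.var 1) ;;
     .load 12 0 (.var 18) ;; .store 2 (.var 13) (.var 12) ;; .arith 10 .add (.var 10) (.lit 1))

/-- The array that holds the extended representation row by row. -/
def rowArr (n : ℕ) (E : ℕ → ℕ → ℕ) (t : ℕ) : ℕ := E (t / n) (t % n)

theorem rowArr_apply {n c : ℕ} (hc : c < n) (E : ℕ → ℕ → ℕ) (r : ℕ) :
    rowArr n E (r * n + c) = E r c := by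
  unfold rowArr
  rw [mul_comm, Nat.mul_add_div (by omega), Nat.div_eq_of_lt hc, Nat.mul_add_mod,
    Nat.mod_eq_of_lt hc, add_zero]

theorem loadColProg_spec {q n k B a p c Z : ℕ} {E : ℕ → ℕ → ℕ} {s : State} (hS : Sizes q n k B)
    (hC : Ctx q n k s) (hE : ∀ r c, E r c < q) (hc : c < n) (ha : a ≤ k)
    (hp : p + a ≤ numLen n k) (h5 : s.var 5 = a) (h7 : s.var 7 = p) (h17 : s.var 17 = c)
    (h0 : s.arr 0 = rowArr n E) (h2 : s.arr 2 = digitArray q Z) :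
    Tri q B loadColProg s (6 * n + 4) fun s' =>
      (s'.arr 2 = fun t => if p ≤ t ∧ t < p + a then E (p + a - t) c else digitArray q Z t) ∧
        Frame [10, 12, 13, 18] [2] s s' := by
  have hk := hS.hk
  have b1 := hS.positions
  have b2 := hS.digits
  have b3 := hS.addresses
  refine Tri.mono (c₁ := a * (5 + 1) + 1 + 1 + 1 + 1) ?_ (by omega) fun _ h => h
  refine Tri.step (Tri.add ?_ ?_ ?_)
  · simp [h7]; omega
  · simp [h5]; omega
  refine Tri.step (Tri.add ?_ ?_ ?_)
  · simp [h17]; omega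
  · simp
  refine Tri.step (Tri.add ?_ ?_ ?_)
  · simp
  · simp
  refine (Tri.loop (c := 5) (fun i s' => s'.var 10 = i ∧ s'.var 13 = p + a - i ∧
    s'.var 18 = i * n + c ∧
    (s'.arr 2 = fun t => if p + a - i ≤ t ∧ t < p + a then E (p + a - t) c else digitArray q Z t) ∧
    Frame [10, 12, 13, 18] [2] s s') a ?_ ?_ ?_ ?_).mono le_rfl ?_
  · refine ⟨by simp, by simp [h5, h7], by simp [h17], ?_, ?_⟩
    · simp only [State.setVar_arr, h2]
      funext t
      rw [if_neg (by omega)]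
    · exact Frame.setVar (Frame.setVar (Frame.setVar (Frame.refl _ _ _) (by simp) _)
        (by simp) _) (by simp) _
  · rintro i hi s' ⟨g10, -, -, -, hF⟩
    have g5 : s'.var 5 = a := by rw [hF.1 5 (by simp), h5]
    simp only [Operand.val_var, g10, g5]
    omega
  · rintro i hi s' ⟨g10, g13, g18, g2, hF⟩
    have g5 : s'.var 5 = a := by rw [hF.1 5 (by simp), h5]
    have g1 : s'.var 1 = n := by rw [hF.1 1 (by simp), hC.v1]
    have g0 : s'.arr 0 = rowArr n E := by rw [hF.2 0 (by simp), h0]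
    have hx : s'.arr 0 (i * n + c + n) = E (i + 1) c := by
      rw [g0, show i * n + c + n = (i + 1) * n + c by ring, rowArr_apply hc]
    have hxq := hE (i + 1) c
    have haddr : i * n + c + n ≤ B := by
      have : (i + 1) * n ≤ n * n := Nat.mul_le_mul_right n (by omega)
      nlinarith
    refine ⟨by simp [g10, g5]; omega, ?_⟩
    refine Tri.step (Tri.sub ?_ ?_ ?_)
    · simp [g13]; omega
    · simp; omega
    refine Tri.step (Tri.add ?_ ?_ ?_)
    · simp [g18]; omega
    · simp [g1]; omega
    refine Tri.step (Tri.load ?_ ?_ ?_)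
    · simp [g18, g1]; omega
    · simp [g18, g1, hx]; omega
    refine Tri.step (Tri.store ?_ ?_ ?_)
    · simp [g13]; omega
    · simp [g18, g1, hx]; omega
    refine Tri.add ?_ ?_ ?_
    · simp [g10]; omega
    · simp; omega
    refine ⟨?_, ?_, ?_, ?_, ?_⟩
    · simp [g10]
    · simp [g13]; omega
    · simp [g18, g1]; ring
    · simp [g13, g18, g1, hx]
      funext t
      rw [Function.update_apply, g2]
      by_cases ht : t = p + a - i - 1
      · rw [if_pos ht, if_pos (by omega), show p + a - t = i + 1 by omega]
      · rw [if_neg ht]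
        simp only
        by_cases ht2 : p + a - i ≤ t ∧ t < p + a
        · rw [if_pos ht2, if_pos (by omega)]
        · rw [if_neg ht2, if_neg (by omega)]
    · refine Frame.setVar ?_ (by simp) _
      refine Frame.setArr ?_ (by simp) _ _
      repeat refine Frame.setVar ?_ (by simp) _
      exact hF
  · rintro s' ⟨g10, -, -, -, hF⟩
    simp [g10, hF.1 5, h5]
  · rintro s' ⟨-, -, -, g2, hF⟩
    refine ⟨?_, hF⟩
    rw [g2]
    simp

theorem digitArray_add_colNum {q n p a c Z : ℕ} {E : ℕ → ℕ → ℕ} (hE : Valid q n E)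
    (hZ : Z < q ^ p) : (fun t => if p ≤ t ∧ t < p + a then E (p + a - t) c else digitArray q Z t) =
      digitArray q (Z + colNum q E a c * q ^ p) := by
  have hq : 0 < q := by have := hE.lt 0 0; omega
  funext t
  rw [digitArray_low_high hq hZ, hE.digitArray_colNum]
  by_cases h1 : t < p
  · rw [if_pos h1, if_neg (by omega)]
  · rw [if_neg h1]
    by_cases h2 : t < p + a
    · rw [if_pos (by omega), if_pos (by omega), show a - (t - p) = p + a - t by omega]
    · rw [if_neg (by omega), if_neg (by omega), digitArray_eq_zero hq hZ (by omega)]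

/-- Together with `Approx.le_unit` this translates bounds for the index in units of `gauss q a b`
into bounds for the digits above the units position. -/
theorem Approx.lt_unit {q n k B m a b I Z x : ℕ} (hS : Sizes q n k B) (hm : m ≤ 3 * n)
    (h : Approx q n (4 * n + 8) (numLen n k) m a b I Z) (hI : I < x * gauss q a b) :
    Z < x * q ^ (4 * n + 8 + a * b) := by
  have hb := (h.bracket hS.hq hS.mul_le hm rfl).2
  have : Z * gauss q a b < (x * q ^ (4 * n + 8 + a * b)) * gauss q a b :=
    hb.trans_le ((Nat.mul_le_mul_right _ hI).trans_eq (by ring))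
  exact Nat.lt_of_mul_lt_mul_right this

theorem Approx.le_unit {q n k B m a b I Z x : ℕ} (hS : Sizes q n k B) (hm : m ≤ 3 * n)
    (h : Approx q n (4 * n + 8) (numLen n k) m a b I Z) (hI : x * gauss q a b ≤ I) :
    x * q ^ (4 * n + 8 + a * b) ≤ Z := by
  have hb := (h.bracket hS.hq hS.mul_le hm rfl).1
  have : (x * q ^ (4 * n + 8 + a * b)) * gauss q a b ≤ Z * gauss q a b :=
    le_trans (by rw [mul_right_comm]; exact Nat.mul_le_mul_right _ hI) hb
  exact Nat.le_of_mul_le_mul_right this (gauss_pos (by have := hS.hq; omega) a b)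

theorem update_digitArray {q w d Z : ℕ} (hq : 0 < q) (hd : d < q) (hZ : Z < q ^ w) :
    Function.update (digitArray q Z) w d = digitArray q (Z + d * q ^ w) := by
  funext t
  rw [Function.update_apply, digitArray_low_high hq hZ]
  by_cases h1 : t = w
  · subst h1
    simp [digitArray, Nat.mod_eq_of_lt hd]
  · rw [if_neg h1]
    by_cases h2 : t < w
    · rw [if_pos h2]
    · rw [if_neg h2, digitArray_eq_zero hq hZ (by omega),
        digitArray_eq_zero hq (m := 1) (by simpa using hd) (by omega)]

end GrassEnc

/-! ### Encoding one column and the whole matrix -/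

namespace GrassEnc

/-- Handle a column with a leading one. -/
def encPivotProg : Prog :=
  .ite (.lit 0) (.var 6)
    (.arith 8 .add (.var 5) (.lit 1) ;; .arith 9 .add (.var 6) (.lit 0) ;; rescaleProg ;;
     .arith 5 .add (.var 5) (.lit 1) ;; .arith 7 .add (.var 7) (.var 6) ;;
     .arith 7 .sub (.var 7) (.var 5) ;; .arith 6 .sub (.var 6) (.lit 1) ;;
     .arith 13 .add (.var 7) (.var 5) ;; .store 2 (.var 13) (.lit 1) ;; advanceProg)
    (.arith 5 .add (.var 5) (.lit 1))

/-- The state of the encoding program after `c` columns. -/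
structure EncInv (q n k : ℕ) (E : ℕ → ℕ → ℕ) (c m : ℕ) (s : State) : Prop where
  ctx : Ctx q n k s
  v5 : s.var 5 = wt E c
  v6 : s.var 6 = c - wt E c
  v7 : s.var 7 = 4 * n + 8 + wt E c * (c - wt E c)
  holds : Holds q n k s m (wt E c) (c - wt E c) (idx q E c)
  input : s.arr 0 = rowArr n E
  output : s.arr 1 = fun _ => 0

variable {q n k B : ℕ} {E : ℕ → ℕ → ℕ}

theorem Valid.counts (hE : Valid q n E) (hk : wt E n = k) {c : ℕ} (hc : c ≤ n) :
    wt E c ≤ k ∧ c - wt E c ≤ n - k := by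
  refine ⟨hk ▸ wt_mono E hc, ?_⟩
  have : ∀ d, c + d ≤ n → wt E (c + d) ≤ wt E c + d := by
    intro d
    induction d with
    | zero => simp
    | succ d ih =>
      intro h
      have h1 := ih (by omega)
      have h2 := hE.le_one (c + d) (by omega)
      rw [← add_assoc, wt_succ]
      omega
  have h1 := this (n - c) (by omega)
  rw [Nat.add_sub_cancel' hc, hk] at h1
  omega

theorem Valid.idx_lt_pow (hS : Sizes q n k B) (hE : Valid q n E) (hk : wt E n = k) {c : ℕ}
    (hc : c ≤ n) : idx q E c < q ^ (k * (n - k) + n) := by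
  obtain ⟨h1, h2⟩ := hE.counts hk hc
  have hw := hE.wt_le hc
  exact (hE.idx_lt hc rfl (by omega : c = wt E c + (c - wt E c))).trans_le
    (gauss_le_pow hS.hq hS.hk h1 h2)

theorem encPivotProg_spec (hS : Sizes q n k B) (hE : Valid q n E) (hk : wt E n = k) {c : ℕ}
    (hc : c < n) (h1 : E 0 c = 1) {s : State} (hI : EncInv q n k E c (2 * c) s) :
    Tri q B encPivotProg s (numLen n k * 36 + 21) fun s' =>
      EncInv q n k E (c + 1) (2 * (c + 1)) s' ∧ s'.var 17 = s.var 17 := by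
  have hq := hS.hq
  have b1 := hS.positions
  have hlen := Sizes.le_numLen n k
  have hw := hE.wt_le hc.le
  obtain ⟨hak, hbk⟩ := hE.counts hk hc.le
  obtain ⟨hak', hbk'⟩ := hE.counts hk (Nat.succ_le_of_lt hc)
  have hidx := hE.idx_lt_pow hS hk hc.le
  have hidx' := hE.idx_lt_pow hS hk (Nat.succ_le_of_lt hc)
  obtain ⟨hC, h5, h6, h7, hH, hin, hout⟩ := hI
  have hws : wt E (c + 1) = wt E c + 1 := by rw [wt_succ, h1]
  rw [Nat.succ_eq_add_one, hws] at hak' hbk'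
  obtain ⟨a, ha⟩ : ∃ a, a = wt E c := ⟨_, rfl⟩
  obtain ⟨b, hb⟩ : ∃ b, b = c - wt E c := ⟨_, rfl⟩
  rw [← hb, ← ha] at h7 hH
  rw [← ha] at h5 hw hak hws hak' hbk'
  rw [← hb] at h6 hbk
  have hmul : a * b ≤ k * (n - k) := Nat.mul_le_mul hak hbk
  refine Tri.mono (c₁ := numLen n k * 36 + 20 + 1) ?_ (by omega) fun _ h => h
  refine Tri.ite ?_ ?_ ?_ ?_
  · simp
  · simp [h6]; omega
  · intro hpos
    simp only [Operand.val_lit, Operand.val_var, h6] at hpos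
    obtain ⟨b, rfl⟩ : ∃ b', b = b' + 1 := ⟨b - 1, by omega⟩
    refine Tri.mono (c₁ := numLen n k * 18 + 8 + 1 + 1 + 1 + 1 + 1 + 1 + (numLen n k * 18 + 4)
      + 1 + 1) ?_ (by omega) fun _ h => h
    refine Tri.step (Tri.add ?_ ?_ ?_)
    · simp [h5]; omega
    · simp; omega
    refine Tri.step (Tri.add ?_ ?_ ?_)
    · simp [h6]; omega
    · simp
    -- The contribution of a pivot is a multiple of `gauss q (a + 1) b`. So the number moves there
    -- first, and `advanceProg` follows after the addition: two rescalings for this column.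
    refine Tri.seq (rescale_move (a' := a + 1) (b' := b) (u := a + 1) (v := b + 1) hS
      ((hC.setVar (by simp) _).setVar (by simp) _) ?_ ?_ (by omega) (by omega) (by omega)
      (gam_exchange (by omega) a b) (by omega) (by omega) hidx (hH.of_arr rfl)) ?_
    · simp [h5]
    · simp [h6]
    rintro s₁ ⟨⟨Z, hZarr, hZ⟩, hF⟩
    have hC₁ : Ctx q n k s₁ := ((hC.setVar (by simp) _).setVar (by simp) _).frame hF (by simp)
    have g5 : s₁.var 5 = a := by rw [hF.1 5 (by simp)]; simp [h5]
    have g6 : s₁.var 6 = b + 1 := by rw [hF.1 6 (by simp)]; simp [h6]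
    have g7 : s₁.var 7 = 4 * n + 8 + a * (b + 1) := by rw [hF.1 7 (by simp)]; simp [h7]
    have g17 : s₁.var 17 = s.var 17 := by rw [hF.1 17 (by simp)]; simp
    have gin : s₁.arr 0 = rowArr n E := by rw [hF.2 0 (by simp)]; simp [hin]
    have gout : s₁.arr 1 = fun _ => 0 := by rw [hF.2 1 (by simp)]; simp [hout]
    have hexp : a * (b + 1) = a * b + a := by ring
    have hexp' : (a + 1) * b = a * b + b := by ring
    have hmul' : (a + 1) * b ≤ k * (n - k) := Nat.mul_le_mul hak' (by omega)
    have hp : 4 * n + 8 + a * (b + 1) + (b + 1) - (a + 1) = 4 * n + 8 + (a + 1) * b := by omega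
    -- The cell that receives the digit `1` is still zero, so the store is an addition.
    have hZlt : Z < q ^ (4 * n + 8 + (a + 1) * b + (a + 1)) := by
      have := hZ.lt_unit (x := q ^ (a + 1)) hS (by omega)
        ((hE.idx_lt hc.le ha.symm (by omega : c = a + (b + 1))).trans_le
          (gauss_le_pow_mul_gauss hq a b))
      rwa [← pow_add, add_comm (a + 1)] at this
    have hupd := update_digitArray (d := 1) (by omega) (by omega) hZlt
    have hterm := colTerm_pivot (q := q) h1 ha.symm (by omega : c = a + b + 1)
    have hZ2 := (Approx.add_mul (by omega) (q ^ (a + 1))).mpr hZ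
    rw [← hterm, ← idx_succ, ← pow_add, add_comm (a + 1)] at hZ2
    rw [one_mul] at hupd
    refine Tri.step (Tri.add ?_ ?_ ?_)
    · simp [g5]; omega
    · simp; omega
    refine Tri.step (Tri.add ?_ ?_ ?_)
    · simp [g7]; omega
    · simp [g6]; omega
    refine Tri.step (Tri.sub ?_ ?_ ?_)
    · simp [g7, g6]; omega
    · simp [g5]; omega
    refine Tri.step (Tri.sub ?_ ?_ ?_)
    · simp [g6]; omega
    · simp; omega
    refine Tri.step (Tri.add ?_ ?_ ?_)
    · simp [g5, g6, g7]; omega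
    · simp [g5]; omega
    refine Tri.step (Tri.store ?_ ?_ ?_)
    · simp [g5, g6, g7]; omega
    · simp; omega
    refine (advanceProg_spec (a := a + 1) (b := b) (m := 2 * c + 1) (I := idx q E (c + 1)) hS
      ?_ ?_ ?_ ?_ (by omega) (by omega) (by omega) (by omega) hidx' ?_).mono le_rfl ?_
    · refine Ctx.setArr ?_ _ _ _
      repeat refine Ctx.setVar ?_ (by simp) _
      exact hC₁
    · simp [g5]
    · simp [g6]
    · simp [g5, g6, g7]; omega
    · refine ⟨_, ?_, hZ2⟩
      rw [← hupd]
      simp only [State.setArr_arr, if_true, State.setVar_arr, hZarr, Operand.val_var,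
        Operand.val_lit, State.setVar_var, g5, g6, g7]
      simp [hp]
    · rintro s₂ ⟨f6, f7, fH, fF⟩
      have hb' : c + 1 - (a + 1) = b + 1 := by omega
      refine ⟨⟨?_, ?_, ?_, ?_, ?_, ?_, ?_⟩, ?_⟩
      · refine Ctx.frame ?_ fF (by simp)
        refine Ctx.setArr ?_ _ _ _
        repeat refine Ctx.setVar ?_ (by simp) _
        exact hC₁
      · rw [fF.1 5 (by simp), hws]; simp [g5]
      · rw [f6, hws, hb']
      · rw [f7, hws, hb']
      · rw [hws, hb']; exact fH.mono (by omega)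
      · rw [fF.2 0 (by simp)]; simp [gin]
      · rw [fF.2 1 (by simp)]; simp [gout]
      · rw [fF.1 17 (by simp)]; simp [g17]
  · intro hpos
    simp only [Operand.val_lit, Operand.val_var, h6] at hpos
    -- All columns so far are pivots: nothing is added, and since `gam q a 0 = 1` for every `a` the
    -- number need not change.
    obtain rfl : b = 0 := by omega
    refine Tri.mono (c₁ := 1) ?_ (by omega) fun _ h => h
    have hca : c = a := by omega
    refine Tri.add ?_ ?_ ?_
    · simp [h5]; omega
    · simp; omega
    have hb' : c + 1 - (a + 1) = 0 := by omega
    refine ⟨⟨hC.setVar (by simp) _, ?_, ?_, ?_, ?_, ?_, ?_⟩, ?_⟩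
    · simp [h5, hws]
    · rw [hws, hb']; simp [h6]
    · rw [hws, hb']; simp [h7]
    · rw [hws, hb', idx_succ, colTerm_pivot_self h1 (by omega), add_zero]
      obtain ⟨Z, hZ1, hZ2⟩ := hH
      refine ⟨Z, hZ1, Approx.mono (by omega : 2 * c ≤ _) ?_⟩
      unfold Approx at *
      rwa [gam_zero_right] at *
    · simp [hin]
    · simp [hout]
    · simp

/-- Handle a column. -/
def encColProg : Prog :=
  .load 19 0 (.var 17) ;;
  .ite (.lit 0) (.var 19) encPivotProg (loadColProg ;; advanceProg) ;;
  .arith 17 .add (.var 17) (.lit 1)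

theorem encColProg_spec (hS : Sizes q n k B) (hE : Valid q n E) (hk : wt E n = k) {c : ℕ}
    (hc : c < n) {s : State} (hI : EncInv q n k E c (2 * c) s) (h17 : s.var 17 = c) :
    Tri q B encColProg s (numLen n k * 36 + 6 * n + 24) fun s' =>
      EncInv q n k E (c + 1) (2 * (c + 1)) s' ∧ s'.var 17 = c + 1 := by
  have hq := hS.hq
  have b1 := hS.positions
  have b2 := hS.digits
  have hlen := Sizes.le_numLen n k
  have hx : s.arr 0 c = E 0 c := by
    have := rowArr_apply hc E 0
    rw [zero_mul, zero_add] at this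
    rw [hI.input, this]
  have hxq := hE.lt 0 c
  refine Tri.mono (c₁ := 1 + (numLen n k * 36 + 6 * n + 21 + 1) + 1) ?_ (by omega) fun _ h => h
  refine Tri.step (Tri.load ?_ ?_ ?_)
  · simp [h17]; omega
  · simp [h17, hx]; omega
  have hI' : EncInv q n k E c (2 * c) (s.setVar 19 (s.arr 0 (Operand.val s (.var 17)))) := by
    obtain ⟨hC, h5, h6, h7, hH, hin, hout⟩ := hI
    exact ⟨hC.setVar (by simp) _, by simp [h5], by simp [h6], by simp [h7], hH.of_arr rfl,
      hin, hout⟩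
  have g19 : (s.setVar 19 (s.arr 0 (Operand.val s (.var 17)))).var 19 = E 0 c := by
    simp [h17, hx]
  have g17 : (s.setVar 19 (s.arr 0 (Operand.val s (.var 17)))).var 17 = c := by
    simp [h17]
  generalize s.setVar 19 (s.arr 0 (Operand.val s (.var 17))) = s at hI' g19 g17
  refine Tri.seq (Q₁ := fun s' => EncInv q n k E (c + 1) (2 * (c + 1)) s' ∧ s'.var 17 = c)
    (Tri.ite ?_ ?_ ?_ ?_) ?_
  · simp
  · simp [g19]; omega
  · intro hpos
    simp only [Operand.val_lit, Operand.val_var, g19] at hpos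
    have := hE.le_one c hc
    refine (encPivotProg_spec hS hE hk hc (by omega) hI').mono (by omega) ?_
    rintro s' ⟨f1, f2⟩
    exact ⟨f1, f2.trans g17⟩
  · intro hpos
    simp only [Operand.val_lit, Operand.val_var, g19] at hpos
    have h0 : E 0 c = 0 := by omega
    obtain ⟨hak, hbk⟩ := hE.counts hk hc.le
    obtain ⟨hak', hbk'⟩ := hE.counts hk (Nat.succ_le_of_lt hc)
    have hidx := hE.idx_lt_pow hS hk (Nat.succ_le_of_lt hc)
    have hw := hE.wt_le hc.le
    obtain ⟨hC, h5, h6, h7, ⟨Z, hZarr, hZ⟩, hin, hout⟩ := hI'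
    have hws : wt E (c + 1) = wt E c := by rw [wt_succ, h0, add_zero]
    have hbs : c + 1 - wt E c = c - wt E c + 1 := by omega
    rw [Nat.succ_eq_add_one, hws] at hbk'
    have hmul : wt E c * (c - wt E c) ≤ k * (n - k) := Nat.mul_le_mul hak hbk
    -- The index is below one unit `gauss`, so the cells from the units position on are empty and
    -- can take the column.
    have hZlt : Z < q ^ (4 * n + 8 + wt E c * (c - wt E c)) := by
      have := hZ.lt_unit (x := 1) hS (by omega) (by
        rw [one_mul]; exact hE.idx_lt hc.le rfl (by omega))
      rwa [one_mul] at this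
    have hZ2 := (Approx.add_mul (by omega) (colNum q E (wt E c) c)).mpr hZ
    rw [← colTerm_free h0 rfl (by omega), ← idx_succ] at hZ2
    refine Tri.mono (c₁ := numLen n k * 18 + 8 + (6 * n + 4)) ?_ (by omega) fun _ h => h
    refine Tri.seq (loadColProg_spec hS hC hE.lt hc hak
      (by have := hS.hk; omega) h5 h7 g17 hin hZarr) ?_
    rintro s₁ ⟨f2, fF⟩
    rw [digitArray_add_colNum hE hZlt] at f2
    have hC₁ := hC.frame fF (by simp)
    refine (advanceProg_spec (m := 2 * c) (I := idx q E (c + 1)) (a := wt E c)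
      (b := c - wt E c) hS hC₁ (by rw [fF.1 5 (by simp), h5])
      (by rw [fF.1 6 (by simp), h6]) (by rw [fF.1 7 (by simp), h7]) hak hbk (by omega) (by omega)
      hidx ⟨_, f2, hZ2⟩).mono le_rfl ?_
    rintro s₂ ⟨e6, e7, eH, eF⟩
    refine ⟨⟨hC₁.frame eF (by simp), ?_, ?_, ?_, ?_, ?_, ?_⟩, ?_⟩
    · rw [eF.1 5 (by simp), fF.1 5 (by simp), h5, hws]
    · rw [e6, hws, hbs]
    · rw [e7, hws, hbs]
    · rw [hws, hbs]; exact eH.mono (by omega)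
    · rw [eF.2 0 (by simp), fF.2 0 (by simp), hin]
    · rw [eF.2 1 (by simp), fF.2 1 (by simp), hout]
    · rw [eF.1 17 (by simp), fF.1 17 (by simp), g17]
  · rintro s' ⟨⟨hC, h5, h6, h7, hH, hin, hout⟩, f17⟩
    refine Tri.add ?_ ?_ ?_
    · simp [f17]; omega
    · simp; omega
    exact ⟨⟨hC.setVar (by simp) _, by simp [h5], by simp [h6], by simp [h7], hH.of_arr rfl,
      hin, hout⟩, by simp [f17]⟩

/-- Go from `(a, b)` down to `(0, b)`. -/
def shrinkProg : Prog :=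
  .while (.lit 0) (.var 5)
    (.arith 9 .add (.var 5) (.lit 0) ;; .arith 8 .add (.var 5) (.var 6) ;; rescaleProg ;;
     .arith 5 .sub (.var 5) (.lit 1))

theorem shrinkProg_spec {I : ℕ} {s : State} (hS : Sizes q n k B) (hC : Ctx q n k s)
    (h5 : s.var 5 = k) (h6 : s.var 6 = n - k) (hI : I < q ^ (k * (n - k) + n))
    (hH : Holds q n k s (2 * n) k (n - k) I) :
    Tri q B shrinkProg s (k * (numLen n k * 18 + 8) + 1) fun s' =>
      Ctx q n k s' ∧ Holds q n k s' (3 * n) 0 (n - k) I ∧ s'.arr 1 = s.arr 1 := by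
  have hq := hS.hq
  have hk := hS.hk
  have b1 := hS.positions
  have hlen := Sizes.le_numLen n k
  refine (Tri.loop (c := numLen n k * 18 + 7) (fun i s' => Ctx q n k s' ∧ s'.var 5 = k - i ∧
    s'.var 6 = n - k ∧ Holds q n k s' (2 * n + i) (k - i) (n - k) I ∧ s'.arr 1 = s.arr 1)
    k ?_ ?_ ?_ ?_).mono le_rfl ?_
  · exact ⟨hC, by simpa using h5, h6, by simpa using hH, rfl⟩
  · rintro i hi s' ⟨-, g5, -⟩
    simp only [Operand.val_lit, Operand.val_var, g5]
    omega
  · rintro i hi s₁ ⟨hC₁, g5, g6, gH, gout⟩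
    refine ⟨by simp [g5]; omega, ?_⟩
    obtain ⟨a, ha⟩ : ∃ a, k - i = a + 1 := ⟨k - i - 1, by omega⟩
    rw [ha] at g5 gH
    have ha' : k - (i + 1) = a := by omega
    refine Tri.mono (c₁ := 1 + (numLen n k * 18 + 4) + 1 + 1) ?_ (by omega) fun _ h => h
    refine Tri.step (Tri.add ?_ ?_ ?_)
    · simp [g5]; omega
    · simp
    refine Tri.step (Tri.add ?_ ?_ ?_)
    · simp [g5]; omega
    · simp [g6]; omega
    refine Tri.seq (rescale_move (a' := a) (b' := n - k) (u := a + (n - k) + 1) (v := a + 1) hS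
      ((hC₁.setVar (by simp) _).setVar (by simp) _) ?_ ?_ (by omega) (by omega) (by omega)
      (gam_succ_left (by omega) a (n - k)).symm (by omega) (by omega) hI (gH.of_arr rfl)) ?_
    · simp [g5, g6]; omega
    · simp [g5]
    rintro s₂ ⟨fH, fF⟩
    have f5 : s₂.var 5 = a + 1 := by rw [fF.1 5 (by simp)]; simp [g5]
    refine Tri.sub ?_ ?_ ?_
    · simp [f5]; omega
    · simp; omega
    refine ⟨?_, ?_, ?_, ?_, ?_⟩
    · exact Ctx.setVar (((hC₁.setVar (by simp) _).setVar (by simp) _).frame fF (by simp))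
        (by simp) _
    · simp [f5, ha']
    · simp [fF.1 6, g6]
    · rw [ha']; exact fH.of_arr rfl
    · simp [fF.2 1, gout]
  · rintro s' ⟨-, g5, -⟩
    simp [g5]
  · rintro s' ⟨hC', -, -, gH, gout⟩
    exact ⟨hC', by simpa using gH.mono (by omega : 2 * n + k ≤ 3 * n), gout⟩

/-- Copy the integer part of the number to the output. -/
def outputProg : Prog :=
  .arith 10 .add (.lit 0) (.lit 0) ;; .arith 13 .add (.var 3) (.lit 0) ;;
  .while (.var 13) (.var 4)
    (.load 12 2 (.var 13) ;; .store 1 (.var 10) (.var 12) ;;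
     .arith 10 .add (.var 10) (.lit 1) ;; .arith 13 .add (.var 13) (.lit 1))

theorem outputProg_spec {I b : ℕ} {s : State} (hS : Sizes q n k B) (hC : Ctx q n k s)
    (hI : I < q ^ (k * (n - k) + n)) (hH : Holds q n k s (3 * n) 0 b I)
    (hout : s.arr 1 = fun _ => 0) :
    Tri q B outputProg s (5 * numLen n k + 3) fun s' => s'.arr 1 = digitArray q I := by
  have hq := hS.hq
  have b1 := hS.positions
  have b2 := hS.digits
  have hlen := Sizes.le_numLen n k
  obtain ⟨Z, hZarr, hZ⟩ := hH
  have hZdiv : Z / q ^ (4 * n + 8) = I := by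
    have hbr := hZ.bracket hq hS.mul_le le_rfl rfl
    simp only [gauss_zero_left, mul_one, zero_mul, add_zero] at hbr
    exact Nat.div_eq_of_lt_le hbr.1 hbr.2
  refine Tri.mono (c₁ := (k * (n - k) + n) * (4 + 1) + 1 + 1 + 1) ?_ (by omega) fun _ h => h
  refine Tri.step (Tri.add ?_ ?_ ?_)
  · simp
  · simp
  refine Tri.step (Tri.add ?_ ?_ ?_)
  · simp [hC.v3]; omega
  · simp
  refine (Tri.loop (c := 4) (fun i s' => s'.var 10 = i ∧ s'.var 13 = 4 * n + 8 + i ∧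
    s'.var 4 = numLen n k ∧ s'.arr 2 = digitArray q Z ∧
    (s'.arr 1 = fun t => if t < i then digitArray q I t else 0))
    (k * (n - k) + n) ?_ ?_ ?_ ?_).mono le_rfl ?_
  · refine ⟨by simp, by simp [hC.v3], by simp [hC.v4], by simp [hZarr], by simp [hout]⟩
  · rintro i hi s' ⟨-, g13, g4, -⟩
    simp only [Operand.val_var, g13, g4]
    omega
  · rintro i hi s' ⟨g10, g13, g4, g2, g1⟩
    have hx : s'.arr 2 (4 * n + 8 + i) = digitArray q I i := by
      rw [g2, add_comm, digitArray_add, hZdiv]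
    have hxq := digitArray_lt (by omega : 0 < q) I i
    refine ⟨by simp [g13, g4]; omega, ?_⟩
    refine Tri.step (Tri.load ?_ ?_ ?_)
    · simp [g13]; omega
    · simp [g13, hx]; omega
    refine Tri.step (Tri.store ?_ ?_ ?_)
    · simp [g10]; omega
    · simp [g13, hx]; omega
    refine Tri.step (Tri.add ?_ ?_ ?_)
    · simp [g10]; omega
    · simp; omega
    refine Tri.add ?_ ?_ ?_
    · simp [g13]; omega
    · simp; omega
    refine ⟨by simp [g10], by simp [g13]; omega, by simp [g4], by simp [g2], ?_⟩
    simp [g10, g13, hx]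
    funext t
    rw [Function.update_apply, g1]
    by_cases ht : t = i
    · rw [if_pos ht, if_pos (by omega), ht]
    · rw [if_neg ht]
      simp only
      by_cases ht2 : t < i
      · rw [if_pos ht2, if_pos (by omega)]
      · rw [if_neg ht2, if_neg (by omega)]
  · rintro s' ⟨-, g13, g4, -⟩
    simp only [Operand.val_var, g13, g4]
    omega
  · rintro s' ⟨-, -, -, -, g1⟩
    rw [g1]
    funext t
    split_ifs with ht
    · rfl
    · exact (digitArray_eq_zero (by omega) hI (by omega)).symm

/-- The encoding program. -/
def encodeProg : Prog :=
  setupProg ;; .arith 6 .add (.lit 0) (.lit 0) ;; .arith 7 .add (.var 3) (.lit 0) ;;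
  .while (.var 17) (.var 1) encColProg ;; shrinkProg ;; outputProg

theorem digitArray_pow {q w : ℕ} (hq : 2 ≤ q) :
    Function.update (fun _ => 0) w 1 = digitArray q (q ^ w) := by
  have h := update_digitArray (q := q) (w := w) (d := 1) (Z := 0) (by omega) (by omega)
    (Nat.pow_pos (by omega))
  rw [one_mul, zero_add] at h
  rw [← h]
  congr 1
  funext t
  exact (digitArray_zero q t).symm

theorem encodeProg_spec (hS : Sizes q n k B) (hE : Valid q n E) (hk : wt E n = k) :
    Tri q B encodeProg (initState q n k (rowArr n E))
      (digitLen q B + 100 * ((n + 1) * numLen n k)) fun s =>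
        s.arr 1 = digitArray q (idx q E n) := by
  have hq := hS.hq
  have hkn := hS.hk
  have b1 := hS.positions
  have hlen := Sizes.le_numLen n k
  have hidx := hE.idx_lt_pow hS hk le_rfl
  have hcost : 5 * numLen n k + 3 + (k * (numLen n k * 18 + 8) + 1) +
      (n * (numLen n k * 36 + 6 * n + 24 + 1) + 1) + 1 + 1 + (digitLen q B + 11) ≤
      digitLen q B + 100 * ((n + 1) * numLen n k) := by
    have h1 : k * (numLen n k * 18 + 8) ≤ n * (numLen n k * 18 + 8) := Nat.mul_le_mul_right _ hkn
    have h2 : n * (numLen n k * 36 + 6 * n + 24 + 1) ≤ n * (numLen n k * 42) :=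
      Nat.mul_le_mul_left _ (by omega)
    have h3 : n * (numLen n k * 18 + 8) ≤ n * (numLen n k * 19) := Nat.mul_le_mul_left _ (by omega)
    nlinarith
  refine Tri.mono ?_ hcost fun _ h => h
  refine Tri.seq (setupProg_spec hS) ?_
  rintro s ⟨hC, h5, h6, h17, hin, hout, h2⟩
  refine Tri.step (Tri.add ?_ ?_ ?_)
  · simp
  · simp
  refine Tri.step (Tri.add ?_ ?_ ?_)
  · simp [hC.v3]; omega
  · simp
  refine Tri.seq (Tri.loop (c := numLen n k * 36 + 6 * n + 24) (fun c s' =>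
    EncInv q n k E c (2 * c) s' ∧ s'.var 17 = c) n ?_ ?_ ?_ ?_) ?_
  · refine ⟨⟨(hC.setVar (by simp) _).setVar (by simp) _, ?_, ?_, ?_, ?_, ?_, ?_⟩, ?_⟩
    · simp [h5, wt]
    · simp
    · simp [hC.v3, wt]
    · refine ⟨q ^ (4 * n + 8 - 1), ?_, ?_⟩
      · rw [← digitArray_pow hq]; simp [h2]
      · have := Approx.start (q := q) (n := n) (e := 4 * n + 8) (len := numLen n k) (a := 0)
          (b := 0) (I := 0) (by omega) (by omega) (by simp)
        simpa [wt, idx] using this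
    · simp [hin]
    · simp [hout]
    · simp [h17]
  · rintro c hc s' ⟨hI, g17⟩
    simp only [Operand.val_var, g17, hI.ctx.v1]
    omega
  · rintro c hc s' ⟨hI, g17⟩
    refine ⟨by simpa [g17, hI.ctx.v1] using hc, ?_⟩
    exact encColProg_spec hS hE hk hc hI g17
  · rintro s' ⟨hI, g17⟩
    simp [g17, hI.ctx.v1]
  rintro s₁ ⟨⟨hC₁, g5, g6, -, gH, -, gout⟩, -⟩
  rw [hk] at g5 g6 gH
  refine Tri.seq (shrinkProg_spec hS hC₁ g5 g6 hidx gH) ?_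
  rintro s₂ ⟨hC₂, fH, fout⟩
  exact outputProg_spec hS hC₂ hidx fH (fout.trans gout)

end GrassEnc

namespace GrassEnc

/-! ### The decoding program -/

variable {q n k B : ℕ} {E : ℕ → ℕ → ℕ}

/-- Copy the input to the integer part of the number. -/
def inputProg : Prog :=
  .arith 10 .add (.lit 0) (.lit 0) ;; .arith 13 .add (.var 3) (.lit 0) ;;
  .while (.var 13) (.var 4)
    (.load 12 0 (.var 10) ;; .store 2 (.var 13) (.var 12) ;;
     .arith 10 .add (.var 10) (.lit 1) ;; .arith 13 .add (.var 13) (.lit 1))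

theorem inputProg_spec {I : ℕ} {s : State} (hS : Sizes q n k B) (hC : Ctx q n k s)
    (hI : I < q ^ (k * (n - k) + n)) (hin : s.arr 0 = digitArray q I)
    (h2 : s.arr 2 = Function.update (fun _ => 0) (4 * n + 7) 1) :
    Tri q B inputProg s (5 * numLen n k + 3) fun s' =>
      s'.arr 2 = digitArray q (I * q ^ (4 * n + 8) + q ^ (4 * n + 8 - 1)) ∧
        Frame [10, 12, 13] [2] s s' := by
  have hq := hS.hq
  have b1 := hS.positions
  have b2 := hS.digits
  have hlen := Sizes.le_numLen n k
  -- The digit stored by `setupProg` is the offset `1 / q` of the fixed point number.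
  rw [digitArray_pow hq] at h2
  have hplt : q ^ (4 * n + 7) < q ^ (4 * n + 8) := Nat.pow_lt_pow_right (by omega) (by omega)
  refine Tri.mono (c₁ := (k * (n - k) + n) * (4 + 1) + 1 + 1 + 1) ?_ (by omega) fun _ h => h
  refine Tri.step (Tri.add ?_ ?_ ?_)
  · simp
  · simp
  refine Tri.step (Tri.add ?_ ?_ ?_)
  · simp [hC.v3]; omega
  · simp
  refine (Tri.loop (c := 4) (fun i s' => s'.var 10 = i ∧ s'.var 13 = 4 * n + 8 + i ∧
    (s'.arr 2 = fun t => if 4 * n + 8 ≤ t ∧ t < 4 * n + 8 + i then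
      digitArray q I (t - (4 * n + 8)) else digitArray q (q ^ (4 * n + 7)) t) ∧
    Frame [10, 12, 13] [2] s s')
    (k * (n - k) + n) ?_ ?_ ?_ ?_).mono le_rfl ?_
  · refine ⟨by simp, by simp [hC.v3], ?_, ?_⟩
    · simp only [State.setVar_arr, h2]
      funext t
      rw [if_neg (by omega)]
    · exact Frame.setVar (Frame.setVar (Frame.refl _ _ _) (by simp) _) (by simp) _
  · rintro i hi s' ⟨-, g13, -, hF⟩
    simp only [Operand.val_var, g13, hF.1 4 (by simp), hC.v4]
    omega
  · rintro i hi s' ⟨g10, g13, g2, hF⟩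
    have g4 : s'.var 4 = numLen n k := by rw [hF.1 4 (by simp), hC.v4]
    have g0 : s'.arr 0 = digitArray q I := by rw [hF.2 0 (by simp), hin]
    have hxq := digitArray_lt (by omega : 0 < q) I i
    refine ⟨by simp [g13, g4]; omega, ?_⟩
    refine Tri.step (Tri.load ?_ ?_ ?_)
    · simp [g10]; omega
    · simp [g10, g0]; omega
    refine Tri.step (Tri.store ?_ ?_ ?_)
    · simp [g13]; omega
    · simp [g10, g0]; omega
    refine Tri.step (Tri.add ?_ ?_ ?_)
    · simp [g10]; omega
    · simp; omega
    refine Tri.add ?_ ?_ ?_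
    · simp [g13]; omega
    · simp; omega
    refine ⟨by simp [g10], by simp [g13]; omega, ?_, ?_⟩
    · simp [g10, g13, g0]
      funext t
      rw [Function.update_apply, g2]
      by_cases ht : t = 4 * n + 8 + i
      · rw [if_pos ht, if_pos (by omega), ht, Nat.add_sub_cancel_left]
      · rw [if_neg ht]
        simp only
        by_cases ht2 : 4 * n + 8 ≤ t ∧ t < 4 * n + 8 + i
        · rw [if_pos ht2, if_pos (by omega)]
        · rw [if_neg ht2, if_neg (by omega)]
    · refine Frame.setVar (Frame.setVar ?_ (by simp) _) (by simp) _
      exact Frame.setArr (Frame.setVar hF (by simp) _) (by simp) _ _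
  · rintro s' ⟨-, g13, -, hF⟩
    simp only [Operand.val_var, g13, hF.1 4 (by simp), hC.v4]
    omega
  · rintro s' ⟨-, -, g2, hF⟩
    refine ⟨?_, hF⟩
    rw [g2, show 4 * n + 8 - 1 = 4 * n + 7 by omega, add_comm (I * _)]
    funext t
    rw [digitArray_low_high (by omega) hplt]
    by_cases h1 : t < 4 * n + 8
    · rw [if_pos h1, if_neg (by omega)]
    · rw [if_neg h1]
      by_cases ht2 : t < 4 * n + 8 + (k * (n - k) + n)
      · rw [if_pos (by omega)]
      · rw [if_neg (by omega), digitArray_eq_zero (by omega) hplt (by omega),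
          digitArray_eq_zero (by omega) hI (by omega)]

/-- Go from `(0, b)` up to `(k, b)`. -/
def growProg : Prog :=
  .while (.var 5) (.var 2)
    (.arith 8 .add (.var 5) (.lit 1) ;; .arith 9 .add (.var 8) (.var 6) ;; rescaleProg ;;
     .arith 5 .add (.var 5) (.lit 1))

theorem growProg_spec {I : ℕ} {s : State} (hS : Sizes q n k B) (hC : Ctx q n k s)
    (h5 : s.var 5 = 0) (h6 : s.var 6 = n - k) (hI : I < q ^ (k * (n - k) + n))
    (hH : Holds q n k s 0 0 (n - k) I) :
    Tri q B growProg s (k * (numLen n k * 18 + 8) + 1) fun s' =>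
      Ctx q n k s' ∧ s'.var 5 = k ∧ s'.var 6 = n - k ∧ Holds q n k s' k k (n - k) I ∧
        s'.arr 1 = s.arr 1 := by
  have hq := hS.hq
  have hk := hS.hk
  have b1 := hS.positions
  have hlen := Sizes.le_numLen n k
  refine Tri.loop (c := numLen n k * 18 + 7) (fun i s' => Ctx q n k s' ∧ s'.var 5 = i ∧
    s'.var 6 = n - k ∧ Holds q n k s' i i (n - k) I ∧ s'.arr 1 = s.arr 1) k ?_ ?_ ?_ ?_
  · exact ⟨hC, h5, h6, hH, rfl⟩
  · rintro i hi s' ⟨hC', g5, -⟩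
    simp only [Operand.val_var, g5, hC'.v2]
    omega
  · rintro a hi s₁ ⟨hC₁, g5, g6, gH, gout⟩
    refine ⟨by simp [g5, hC₁.v2]; omega, ?_⟩
    refine Tri.mono (c₁ := 1 + (numLen n k * 18 + 4) + 1 + 1) ?_ (by omega) fun _ h => h
    refine Tri.step (Tri.add ?_ ?_ ?_)
    · simp [g5]; omega
    · simp; omega
    refine Tri.step (Tri.add ?_ ?_ ?_)
    · simp [g5]; omega
    · simp [g6]; omega
    refine Tri.seq (rescale_move (a' := a + 1) (b' := n - k) (u := a + 1) (v := a + (n - k) + 1)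
      hS ((hC₁.setVar (by simp) _).setVar (by simp) _) ?_ ?_ (by omega) (by omega) (by omega)
      (gam_succ_left (by omega) a (n - k)) (by omega) (by omega) hI (gH.of_arr rfl)) ?_
    · simp [g5]
    · simp [g5, g6]; omega
    rintro s₂ ⟨fH, fF⟩
    have f5 : s₂.var 5 = a := by rw [fF.1 5 (by simp)]; simp [g5]
    refine Tri.add ?_ ?_ ?_
    · simp [f5]; omega
    · simp; omega
    refine ⟨?_, ?_, ?_, fH.of_arr rfl, ?_⟩
    · exact Ctx.setVar (((hC₁.setVar (by simp) _).setVar (by simp) _).frame fF (by simp))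
        (by simp) _
    · simp [f5]
    · simp [fF.1 6, g6]
    · simp [fF.2 1, gout]
  · rintro s' ⟨hC', g5, -⟩
    simp [g5, hC'.v2]

/-- The part of the output that consists of the columns from `c` on. -/
def partOut (n : ℕ) (E : ℕ → ℕ → ℕ) (c t : ℕ) : ℕ := if c ≤ t % n then rowArr n E t else 0

/-- The state of the decoding program when the columns from `c` on are known. -/
structure DecInv (q n k : ℕ) (E : ℕ → ℕ → ℕ) (c m : ℕ) (s : State) : Prop where
  ctx : Ctx q n k s
  v5 : s.var 5 = wt E c
  v6 : s.var 6 = c - wt E c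
  v7 : s.var 7 = 4 * n + 8 + wt E c * (c - wt E c)
  v17 : s.var 17 = c
  holds : Holds q n k s m (wt E c) (c - wt E c) (idx q E c)
  output : s.arr 1 = partOut n E c

/-- Write a column with a leading one. -/
def putPivotProg : Prog :=
  .store 1 (.var 17) (.lit 1) ;; .arith 13 .mul (.var 5) (.var 1) ;;
  .arith 13 .add (.var 13) (.var 17) ;; .store 1 (.var 13) (.lit 1) ;;
  .arith 5 .sub (.var 5) (.lit 1)

theorem partOut_pivot (hE : Valid q n E) {c : ℕ} (hc : c < n) (h1 : E 0 c = 1) :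
    Function.update (Function.update (partOut n E (c + 1)) c 1) ((wt E c + 1) * n + c) 1 =
      partOut n E c := by
  funext t
  have ht := Nat.div_add_mod t n
  simp only [Function.update_apply, partOut]
  by_cases hmod : t % n = c
  · rw [if_neg (by omega : ¬ c + 1 ≤ t % n), if_pos (by omega : c ≤ t % n)]
    unfold rowArr
    rw [hmod]
    rw [hmod] at ht
    by_cases hr : t / n = wt E c + 1
    · rw [hr] at ht ⊢
      rw [if_pos (by rw [← ht, mul_comm]), hE.pivot c hc h1, if_pos rfl]
    · have hne : t ≠ (wt E c + 1) * n + c := by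
        rintro rfl
        apply hr
        rw [mul_comm, Nat.mul_add_div (by omega), Nat.div_eq_of_lt hc, add_zero]
      rw [if_neg hne]
      by_cases h0 : t / n = 0
      · rw [h0] at ht ⊢
        rw [if_pos (by rw [← ht]; simp), h1]
      · have hne' : t ≠ c := by
          rintro rfl
          exact h0 (Nat.div_eq_of_lt hc)
        obtain ⟨r, hr'⟩ : ∃ r, t / n = r + 1 := Nat.exists_eq_succ_of_ne_zero h0
        rw [if_neg hne', hr', hE.pivot c hc h1, if_neg (by omega)]
  · have hne : t ≠ (wt E c + 1) * n + c := by
      rintro rfl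
      apply hmod
      rw [mul_comm, Nat.mul_add_mod, Nat.mod_eq_of_lt hc]
    have hne' : t ≠ c := by
      rintro rfl
      exact hmod (Nat.mod_eq_of_lt hc)
    rw [if_neg hne, if_neg hne']
    by_cases h : c + 1 ≤ t % n
    · rw [if_pos h, if_pos (by omega)]
    · rw [if_neg h, if_neg (by omega)]

theorem putPivotProg_spec (hS : Sizes q n k B) (hE : Valid q n E) {c : ℕ}
    (hc : c < n) (h1 : E 0 c = 1) {m : ℕ} {s : State} (hC : Ctx q n k s)
    (h5 : s.var 5 = wt E c + 1) (h6 : s.var 6 = c - wt E c)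
    (h7 : s.var 7 = 4 * n + 8 + wt E c * (c - wt E c)) (h17 : s.var 17 = c)
    (hH : Holds q n k s m (wt E c) (c - wt E c) (idx q E c))
    (hout : s.arr 1 = partOut n E (c + 1)) :
    Tri q B putPivotProg s (digitLen q B + 4) (DecInv q n k E c m) := by
  have b1 := hS.positions
  have b3 := hS.addresses
  have hw := hE.wt_le hc.le
  have haddr : (wt E c + 1) * n + c ≤ B := by
    have : (wt E c + 1) * n ≤ n * n := Nat.mul_le_mul_right n (by omega)
    nlinarith
  have hupd := partOut_pivot hE hc h1
  refine Tri.mono (c₁ := 1 + 1 + 1 + digitLen q B + 1) ?_ (by omega) fun _ h => h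
  refine Tri.step (Tri.store ?_ ?_ ?_)
  · simp [h17]; omega
  · simp; omega
  refine Tri.step (Tri.mul ?_ ?_ ?_)
  · simp [h5]; omega
  · simp [hC.v1]; omega
  refine Tri.step (Tri.add ?_ ?_ ?_)
  · simp [h5, hC.v1]; omega
  · simp [h17]; omega
  refine Tri.step (Tri.store ?_ ?_ ?_)
  · simp [h5, hC.v1, h17]; omega
  · simp; omega
  refine Tri.sub ?_ ?_ ?_
  · simp [h5]; omega
  · simp; omega
  refine ⟨?_, ?_, ?_, ?_, ?_, ?_, ?_⟩
  · exact ((((hC.setArr _ _ _).setVar (by simp) _).setVar (by simp) _).setArr _ _ _).setVar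
      (by simp) _
  · simp [h5]
  · simp [h6]
  · simp [h7]
  · simp [h17]
  · exact hH.of_arr (by simp)
  · rw [← hupd]
    simp [h5, hC.v1, h17, hout]

/-- Write a column without a leading one, and clear the integer part of the number. -/
def saveColProg : Prog :=
  .arith 18 .add (.var 17) (.lit 0) ;; .arith 10 .add (.lit 0) (.lit 0) ;;
  .while (.var 10) (.var 5)
    (.arith 13 .sub (.var 13) (.lit 1) ;; .arith 18 .add (.var 18) (.var 1) ;;
     .load 12 2 (.var 13) ;; .store 1 (.var 18) (.var 12) ;; .store 2 (.var 13) (.lit 0) ;;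
     .arith 10 .add (.var 10) (.lit 1))

theorem saveColProg_spec (hS : Sizes q n k B) (hE : Valid q n E) {a p c Z : ℕ} {s : State}
    (hC : Ctx q n k s) (hc : c < n) (h0 : E 0 c = 0) (hwt : wt E c = a) (ha : a ≤ k)
    (hp : p + a ≤ numLen n k) (h5 : s.var 5 = a) (h13 : s.var 13 = p + a) (h17 : s.var 17 = c)
    (hZ : Z < q ^ p) (h2 : s.arr 2 = digitArray q (Z + colNum q E a c * q ^ p))
    (hout : s.arr 1 = partOut n E (c + 1)) :
    Tri q B saveColProg s (7 * n + 3) fun s' =>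
      s'.arr 2 = digitArray q Z ∧ s'.arr 1 = partOut n E c ∧
        Frame [10, 12, 13, 18] [1, 2] s s' := by
  have hq := hS.hq
  have hk := hS.hk
  have b1 := hS.positions
  have b2 := hS.digits
  have b3 := hS.addresses
  rw [← digitArray_add_colNum hE hZ] at h2
  refine Tri.mono (c₁ := a * (6 + 1) + 1 + 1 + 1) ?_ (by omega) fun _ h => h
  refine Tri.step (Tri.add ?_ ?_ ?_)
  · simp [h17]; omega
  · simp
  refine Tri.step (Tri.add ?_ ?_ ?_)
  · simp
  · simp
  refine (Tri.loop (c := 6) (fun i s' => s'.var 10 = i ∧ s'.var 13 = p + a - i ∧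
    s'.var 18 = i * n + c ∧
    (s'.arr 2 = fun t => if p ≤ t ∧ t < p + a - i then E (p + a - t) c else digitArray q Z t) ∧
    (s'.arr 1 = fun t => if t % n = c ∧ t / n ≤ i then rowArr n E t else partOut n E (c + 1) t) ∧
    Frame [10, 12, 13, 18] [1, 2] s s') a ?_ ?_ ?_ ?_).mono le_rfl ?_
  · refine ⟨by simp, by simp [h13], by simp [h17], by simp [h2], ?_, ?_⟩
    · simp only [State.setVar_arr, hout]
      funext t
      split_ifs with ht
      · have : t / n = 0 := Nat.le_zero.mp ht.2
        unfold partOut rowArr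
        rw [if_neg (by omega), this, ht.1, h0]
      · rfl
    · exact Frame.setVar (Frame.setVar (Frame.refl _ _ _) (by simp) _) (by simp) _
  · rintro i hi s' ⟨g10, -, -, -, -, hF⟩
    simp only [Operand.val_var, g10, hF.1 5 (by simp), h5]
    omega
  · rintro i hi s' ⟨g10, g13, g18, g2, g1', hF⟩
    have g5 : s'.var 5 = a := by rw [hF.1 5 (by simp), h5]
    have g1 : s'.var 1 = n := by rw [hF.1 1 (by simp), hC.v1]
    have hx : s'.arr 2 (p + a - i - 1) = E (i + 1) c := by
      rw [g2]
      simp only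
      rw [if_pos (by omega), show p + a - (p + a - i - 1) = i + 1 by omega]
    have hxq := hE.lt (i + 1) c
    have haddr : i * n + c + n ≤ B := by
      have : (i + 1) * n ≤ n * n := Nat.mul_le_mul_right n (by omega)
      nlinarith
    refine ⟨by simp [g10, g5]; omega, ?_⟩
    refine Tri.step (Tri.sub ?_ ?_ ?_)
    · simp [g13]; omega
    · simp; omega
    refine Tri.step (Tri.add ?_ ?_ ?_)
    · simp [g18]; omega
    · simp [g1]; omega
    refine Tri.step (Tri.load ?_ ?_ ?_)
    · simp [g13]; omega
    · simp [g13, hx]; omega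
    refine Tri.step (Tri.store ?_ ?_ ?_)
    · simp [g18, g1]; omega
    · simp [g13, hx]; omega
    refine Tri.step (Tri.store ?_ ?_ ?_)
    · simp [g13]; omega
    · simp
    refine Tri.add ?_ ?_ ?_
    · simp [g10]; omega
    · simp; omega
    refine ⟨by simp [g10], by simp [g13]; omega, by simp [g18, g1]; ring, ?_, ?_, ?_⟩
    · simp [g13]
      funext t
      rw [Function.update_apply, g2]
      by_cases ht : t = p + a - i - 1
      · rw [if_pos ht, if_neg (by omega), digitArray_eq_zero (by omega) hZ (by omega)]
      · rw [if_neg ht]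
        simp only
        by_cases ht2 : p ≤ t ∧ t < p + a - i
        · rw [if_pos ht2, if_pos (by omega)]
        · rw [if_neg ht2, if_neg (by omega)]
    · simp [g13, g18, g1, hx]
      funext t
      rw [Function.update_apply, g1']
      have haddr' : i * n + c + n = (i + 1) * n + c := by ring
      by_cases ht : t = i * n + c + n
      · rw [haddr'] at ht
        have hd : t / n = i + 1 := by
          rw [ht, mul_comm, Nat.mul_add_div (by omega), Nat.div_eq_of_lt hc, add_zero]
        have hm : t % n = c := by rw [ht, mul_comm, Nat.mul_add_mod, Nat.mod_eq_of_lt hc]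
        rw [if_pos (by rw [haddr', ht]), if_pos (by omega), ht, rowArr_apply hc]
      · rw [if_neg ht]
        simp only
        have hne : t % n = c → t / n ≠ i + 1 := by
          intro hm hd
          apply ht
          have := Nat.div_add_mod t n
          rw [hm, hd] at this
          rw [haddr', ← this, mul_comm]
        by_cases ht2 : t % n = c ∧ t / n ≤ i
        · rw [if_pos ht2, if_pos (by omega)]
        · rw [if_neg ht2, if_neg (fun h => by have := hne h.1; omega)]
    · refine Frame.setVar ?_ (by simp) _
      refine Frame.setArr (Frame.setArr ?_ (by simp) _ _) (by simp) _ _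
      repeat refine Frame.setVar ?_ (by simp) _
      exact hF
  · rintro s' ⟨g10, -, -, -, -, hF⟩
    simp [g10, hF.1 5, h5]
  · rintro s' ⟨-, -, -, g2, g1, hF⟩
    refine ⟨?_, ?_, hF⟩
    · rw [g2]
      funext t
      rw [if_neg (by omega)]
    · rw [g1]
      funext t
      unfold partOut
      by_cases hm : t % n = c
      · rw [if_neg (by omega : ¬ c + 1 ≤ t % n), if_pos (by omega : c ≤ t % n)]
        by_cases hr : t / n ≤ a
        · rw [if_pos ⟨hm, hr⟩]
        -- Below row `a` a free column is zero, as the output array still is; nothing has to be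
        -- written there.
        · rw [if_neg (by omega)]
          unfold rowArr
          rw [hm, show t / n = t / n - 1 + 1 by omega]
          exact (hE.free c hc h0 _ (by omega)).symm
      · rw [if_neg (by omega)]
        by_cases h : c + 1 ≤ t % n
        · rw [if_pos h, if_pos (by omega)]
        · rw [if_neg h, if_neg (by omega)]

/-! ### Decoding one column and the whole matrix -/

/-- Continue after a leading one has been found. -/
def decPivotProg : Prog :=
  .store 2 (.var 13) (.lit 0) ;; .arith 6 .add (.var 6) (.lit 1) ;;
  .arith 8 .add (.var 6) (.lit 0) ;; .arith 9 .add (.var 5) (.lit 0) ;; rescaleProg ;;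
  .arith 7 .add (.var 7) (.var 5) ;; .arith 7 .sub (.var 7) (.var 6) ;; putPivotProg

/-- Recover a column. -/
def decColProg : Prog :=
  .arith 17 .sub (.var 17) (.lit 1) ;;
  .ite (.lit 0) (.var 6)
    (.arith 8 .add (.var 5) (.var 6) ;; .arith 9 .add (.var 6) (.lit 0) ;; rescaleProg ;;
     .arith 7 .sub (.var 7) (.var 5) ;; .arith 6 .sub (.var 6) (.lit 1) ;;
     .arith 13 .add (.var 7) (.var 5) ;; .load 19 2 (.var 13) ;;
     .ite (.lit 0) (.var 19) decPivotProg saveColProg)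
    putPivotProg

theorem decPivotProg_spec (hS : Sizes q n k B) (hE : Valid q n E) (hk : wt E n = k) {c b Z m : ℕ}
    (hc : c < n) (h1 : E 0 c = 1) (hcb : c = wt E c + b + 1) {s : State} (hC : Ctx q n k s)
    (h5 : s.var 5 = wt E c + 1) (h6 : s.var 6 = b)
    (h7 : s.var 7 = 4 * n + 8 + (wt E c + 1) * b)
    (h13 : s.var 13 = 4 * n + 8 + (wt E c + 1) * b + (wt E c + 1)) (h17 : s.var 17 = c)
    (hm : m + 1 ≤ 3 * n) (h2 : s.arr 2 = digitArray q Z)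
    (hZ : Approx q n (4 * n + 8) (numLen n k) m (wt E c + 1) b (idx q E (c + 1)) Z)
    (hout : s.arr 1 = partOut n E (c + 1)) :
    Tri q B decPivotProg s (numLen n k * 18 + digitLen q B + 14) (DecInv q n k E c (m + 1)) := by
  have hq := hS.hq
  have b1 := hS.positions
  have hlen := Sizes.le_numLen n k
  obtain ⟨hak, hbk⟩ := hE.counts hk hc.le
  obtain ⟨hak', hbk'⟩ := hE.counts hk (Nat.succ_le_of_lt hc)
  rw [Nat.succ_eq_add_one, wt_succ, h1] at hak' hbk'
  have hidx := hE.idx_lt_pow hS hk hc.le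
  obtain ⟨a, ha⟩ : ∃ a, a = wt E c := ⟨_, rfl⟩
  rw [← ha] at hak' hbk' h5 h7 h13 hZ hcb
  have hmul : (a + 1) * b ≤ k * (n - k) := Nat.mul_le_mul hak' (by omega)
  have hterm := colTerm_pivot (q := q) h1 ha.symm hcb
  have hidx1 : idx q E (c + 1) = idx q E c + q ^ (a + 1) * gauss q (a + 1) b := by
    rw [idx_succ, hterm]
  -- The index is at least one and less than two times the pivot contribution, so the part above
  -- this position is exactly `1`, and clearing that cell subtracts the contribution.
  have hlo : q ^ (a + 1) * q ^ (4 * n + 8 + (a + 1) * b) ≤ Z :=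
    hZ.le_unit hS (by omega) (by omega)
  have hhi : Z < 2 * q ^ (a + 1) * q ^ (4 * n + 8 + (a + 1) * b) := by
    refine hZ.lt_unit hS (by omega) ?_
    have g1 := hE.idx_lt hc.le ha.symm (by omega : c = a + (b + 1))
    have g2 := gauss_le_pow_mul_gauss hq a b
    rw [mul_assoc]
    omega
  obtain ⟨Z', hZ'⟩ := Nat.exists_eq_add_of_le' hlo
  have hZ'lt : Z' < q ^ (4 * n + 8 + (a + 1) * b + (a + 1)) := by
    rw [pow_add, mul_comm]
    rw [mul_assoc] at hhi
    omega
  rw [hidx1, hZ'] at hZ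
  have hA := (Approx.add_mul (by omega) _).mp hZ
  have hupd : Function.update (digitArray q Z) (4 * n + 8 + (a + 1) * b + (a + 1)) 0 =
      digitArray q Z' := by
    have e1 := update_digitArray (d := 1) (by omega) (by omega) hZ'lt
    have e2 := update_digitArray (d := 0) (by omega) (by omega) hZ'lt
    rw [zero_mul, add_zero] at e2
    rw [hZ', mul_comm (q ^ (a + 1)), ← pow_add, ← one_mul (q ^ (_ + _)), ← e1,
      Function.update_idem, e2]
  have hexp : a * (b + 1) = a * b + a := by ring
  have hexp' : (a + 1) * b = a * b + b := by ring
  have hp : 4 * n + 8 + (a + 1) * b + (a + 1) - (b + 1) = 4 * n + 8 + a * (b + 1) := by omega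
  refine Tri.mono (c₁ := digitLen q B + 4 + 1 + 1 + (numLen n k * 18 + 4) + 1 + 1 + 1 + 1) ?_
    (by omega) fun _ h => h
  refine Tri.step (Tri.store ?_ ?_ ?_)
  · simp [h13]; omega
  · simp
  refine Tri.step (Tri.add ?_ ?_ ?_)
  · simp [h6]; omega
  · simp; omega
  refine Tri.step (Tri.add ?_ ?_ ?_)
  · simp [h6]; omega
  · simp
  refine Tri.step (Tri.add ?_ ?_ ?_)
  · simp [h5]; omega
  · simp
  refine Tri.seq (rescale_move (a := a + 1) (b := b) (a' := a) (b' := b + 1) (u := b + 1)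
    (v := a + 1) (m := m) (I := idx q E c) hS (?_ : Ctx q n k _) ?_ ?_ (by omega) (by omega)
    (by omega) (gam_exchange (by omega) a b).symm (by omega) (by omega) hidx ⟨Z', ?_, hA⟩) ?_
  · repeat refine Ctx.setVar ?_ (by simp) _
    exact hC.setArr _ _ _
  · simp [h6]
  · simp [h5]
  · rw [← hupd]
    simp [h13, h2]
  rintro s₁ ⟨gH, gF⟩
  have g5 : s₁.var 5 = a + 1 := by rw [gF.1 5 (by simp)]; simp [h5]
  have g6 : s₁.var 6 = b + 1 := by rw [gF.1 6 (by simp)]; simp [h6]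
  have g7 : s₁.var 7 = 4 * n + 8 + (a + 1) * b := by rw [gF.1 7 (by simp)]; simp [h7]
  have g17 : s₁.var 17 = c := by rw [gF.1 17 (by simp)]; simp [h17]
  have gout : s₁.arr 1 = partOut n E (c + 1) := by rw [gF.2 1 (by simp)]; simp [hout]
  have hC₁ : Ctx q n k s₁ := by
    refine Ctx.frame ?_ gF (by simp)
    repeat refine Ctx.setVar ?_ (by simp) _
    exact hC.setArr _ _ _
  have hb : c - wt E c = b + 1 := by omega
  refine Tri.step (Tri.add ?_ ?_ ?_)
  · simp [g7]; omega
  · simp [g5]; omega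
  refine Tri.step (Tri.sub ?_ ?_ ?_)
  · simp [g7, g5]; omega
  · simp [g6]; omega
  refine putPivotProg_spec hS hE hc h1 ((hC₁.setVar (by simp) _).setVar (by simp) _)
    ?_ ?_ ?_ ?_ ?_ ?_
  · simp [g5, ha]
  · simp [g6, hb]
  · rw [hb, ← ha]; simp [g5, g6, g7]; omega
  · simp [g17]
  · rw [hb, ← ha]; exact gH.of_arr rfl
  · simp [gout]

theorem decColProg_spec (hS : Sizes q n k B) (hE : Valid q n E) (hk : wt E n = k) {c m : ℕ}
    (hc : c < n) (hm : m + 2 ≤ 3 * n) {s : State} (hI : DecInv q n k E (c + 1) m s) :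
    Tri q B decColProg s (numLen n k * 36 + digitLen q B + 7 * n + 30)
      (DecInv q n k E c (m + 2)) := by
  have hq := hS.hq
  have b1 := hS.positions
  have b2 := hS.digits
  have hlen := Sizes.le_numLen n k
  have hw := hE.wt_le hc.le
  have hw' := hE.wt_le (Nat.succ_le_of_lt hc)
  obtain ⟨hak, hbk⟩ := hE.counts hk hc.le
  obtain ⟨hak', hbk'⟩ := hE.counts hk (Nat.succ_le_of_lt hc)
  have hidx := hE.idx_lt_pow hS hk (Nat.succ_le_of_lt hc)
  obtain ⟨hC, h5, h6, h7, h17, hH, hout⟩ := hI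
  have hws := wt_succ E c
  rw [Nat.succ_eq_add_one] at hw' hak' hbk' hidx
  refine Tri.mono (c₁ := numLen n k * 36 + digitLen q B + 7 * n + 28 + 1 + 1) ?_ (by omega)
    fun _ h => h
  refine Tri.step (Tri.sub ?_ ?_ ?_)
  · simp [h17]; omega
  · simp; omega
  refine Tri.ite ?_ ?_ ?_ ?_
  · simp
  · simp [h6]; omega
  · intro hpos
    simp [h6] at hpos
    obtain ⟨A, hA⟩ : ∃ A, A = wt E (c + 1) := ⟨_, rfl⟩
    obtain ⟨b, hb⟩ : ∃ b, c + 1 - wt E (c + 1) = b + 1 := ⟨c - wt E (c + 1), by omega⟩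
    rw [hb] at h6 h7 hH hbk'
    rw [← hA] at h5 h7 hH hak' hws hb hw'
    have hexp : A * (b + 1) = A * b + A := by ring
    have hmul : A * b ≤ k * (n - k) := Nat.mul_le_mul hak' (by omega)
    have hmul' : A * (b + 1) ≤ k * (n - k) := Nat.mul_le_mul hak' (by omega)
    have hp : 4 * n + 8 + A * (b + 1) - A = 4 * n + 8 + A * b := by omega
    refine Tri.mono (c₁ := numLen n k * 18 + digitLen q B + 7 * n + 14 + 1 + 1 + 1 + 1 + 1 +
      (numLen n k * 18 + 4) + 1 + 1) ?_ (by omega) fun _ h => h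
    refine Tri.step (Tri.add ?_ ?_ ?_)
    · simp [h5]; omega
    · simp [h6]; omega
    refine Tri.step (Tri.add ?_ ?_ ?_)
    · simp [h6]; omega
    · simp
    -- With `A` pivots up to and including this column, either kind of column contributes a multiple
    -- of `gauss q A b`. The rescaling can thus precede the decision which kind it is.
    refine Tri.seq (rescale_move (a := A) (b := b + 1) (a' := A) (b' := b) (u := A + b + 1)
      (v := b + 1) (m := m) (I := idx q E (c + 1)) hS (?_ : Ctx q n k _) ?_ ?_ (by omega)
      (by omega) (by omega) (gam_succ_right (by omega) A b).symm (by omega) (by omega) hidx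
      (hH.of_arr rfl)) ?_
    · repeat refine Ctx.setVar ?_ (by simp) _
      exact hC
    · simp [h5, h6]; omega
    · simp [h6]
    rintro s₁ ⟨⟨Z, hZarr, hZ⟩, gF⟩
    have g5 : s₁.var 5 = A := by rw [gF.1 5 (by simp)]; simp [h5]
    have g6 : s₁.var 6 = b + 1 := by rw [gF.1 6 (by simp)]; simp [h6]
    have g7 : s₁.var 7 = 4 * n + 8 + A * (b + 1) := by rw [gF.1 7 (by simp)]; simp [h7]
    have g17 : s₁.var 17 = c := by rw [gF.1 17 (by simp)]; simp [h17]
    have gout : s₁.arr 1 = partOut n E (c + 1) := by rw [gF.2 1 (by simp)]; simp [hout]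
    have hC₁ : Ctx q n k s₁ := by
      refine Ctx.frame ?_ gF (by simp)
      repeat refine Ctx.setVar ?_ (by simp) _
      exact hC
    -- The cell above the `A` cells of a free column decides: a free column leaves the number below
    -- `q ^ A` units, whereas a pivot column puts it between `q ^ A` and `2 * q ^ A` units.
    have hdig : digitArray q Z (4 * n + 8 + A * b + A) = E 0 c := by
      rcases hE.zero_or_one hc with e0 | e1
      · have hwA : wt E c = A := by omega
        have hcol := hE.colNum_lt A c
        have hterm := colTerm_free (q := q) e0 hwA (by omega : c = A + b)
        have hlt := hE.idx_lt hc.le hwA (by omega : c = A + b)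
        have hhi := hZ.lt_unit (x := q ^ A) hS (by omega) (by
          rw [idx_succ, hterm]
          calc _ < (colNum q E A c + 1) * gauss q A b := by rw [add_mul, one_mul]; omega
            _ ≤ _ := Nat.mul_le_mul_right _ hcol)
        rw [← pow_add, add_comm] at hhi
        rw [digitArray_eq_zero (by omega) hhi le_rfl, e0]
      · obtain ⟨a, rfl⟩ : ∃ a, A = a + 1 := ⟨A - 1, by omega⟩
        have hwa : wt E c = a := by omega
        have hterm := colTerm_pivot (q := q) e1 hwa (by omega : c = a + b + 1)
        have g1 := hE.idx_lt hc.le hwa (by omega : c = a + (b + 1))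
        have g2 := gauss_le_pow_mul_gauss hq a b
        have hlo := hZ.le_unit (x := q ^ (a + 1)) hS (by omega) (by rw [idx_succ, hterm]; omega)
        have hhi := hZ.lt_unit (x := 2 * q ^ (a + 1)) hS (by omega) (by
          rw [idx_succ, hterm, mul_assoc]; omega)
        rw [mul_assoc] at hhi
        rw [← pow_add, add_comm (a + 1)] at hlo hhi
        have hdiv : Z / q ^ (4 * n + 8 + (a + 1) * b + (a + 1)) = 1 :=
          Nat.div_eq_of_lt_le (by omega) (by omega)
        rw [e1]
        unfold digitArray
        rw [hdiv, Nat.mod_eq_of_lt (by omega)]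
    refine Tri.step (Tri.sub ?_ ?_ ?_)
    · simp [g7]; omega
    · simp [g5]; omega
    refine Tri.step (Tri.sub ?_ ?_ ?_)
    · simp [g6]; omega
    · simp; omega
    refine Tri.step (Tri.add ?_ ?_ ?_)
    · simp [g7, g5]; omega
    · simp [g5]; omega
    have hle1 := hE.le_one c hc
    refine Tri.step (Tri.load ?_ ?_ ?_)
    · simp [g7, g5]; omega
    · simp [g7, g5, hp, hZarr, hdig]; omega
    refine Tri.ite ?_ ?_ ?_ ?_
    · simp
    · simp [g7, g5, hp, hZarr, hdig]; omega
    · intro h1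
      simp [g7, g5, hp, hZarr, hdig] at h1
      have e1 : E 0 c = 1 := by omega
      have hwa : wt E c + 1 = A := by omega
      refine (decPivotProg_spec (b := b) (Z := Z) (m := m + 1) hS hE hk hc e1 (by omega) ?_
        ?_ ?_ ?_ ?_ ?_ (by omega) ?_ ?_ ?_).mono (by omega) fun _ h => h
      · repeat refine Ctx.setVar ?_ (by simp) _
        exact hC₁
      · simp [g5, hwa]
      · simp [g6]
      · rw [hwa]; simp [g7, g5, hp]
      · rw [hwa]; simp [g7, g5, hp]
      · simp [g17]
      · simp [hZarr]
      · rw [hwa]; exact hZ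
      · simp [gout]
    · intro h1
      simp [g7, g5, hp, hZarr, hdig] at h1
      have e0 : E 0 c = 0 := by omega
      have hwA : wt E c = A := by omega
      have hterm := colTerm_free (q := q) e0 hwA (by omega : c = A + b)
      have hlt := hE.idx_lt hc.le hwA (by omega : c = A + b)
      have hlo := hZ.le_unit (x := colNum q E A c) hS (by omega) (by rw [idx_succ, hterm]; omega)
      have hhi := hZ.lt_unit (x := colNum q E A c + 1) hS (by omega) (by
        rw [idx_succ, hterm, add_mul, one_mul]; omega)
      obtain ⟨Z', hZ'⟩ := Nat.exists_eq_add_of_le' hlo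
      rw [add_mul, one_mul] at hhi
      have hZ'lt : Z' < q ^ (4 * n + 8 + A * b) := by omega
      rw [hZ', idx_succ, hterm] at hZ
      have hAp := (Approx.add_mul (by omega) _).mp hZ
      rw [hZ'] at hZarr
      refine (saveColProg_spec (a := A) (p := 4 * n + 8 + A * b) (c := c) (Z := Z') hS hE ?_ hc e0
        hwA hak' (by have := hS.hk; omega) ?_ ?_ ?_ hZ'lt ?_ ?_).mono (by omega) ?_
      · repeat refine Ctx.setVar ?_ (by simp) _
        exact hC₁
      · simp [g5]
      · simp [g7, g5, hp]
      · simp [g17]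
      · simp [hZarr]
      · simp [gout]
      · rintro s₂ ⟨f2, f1, fF⟩
        have hcb : c - A = b := by omega
        refine ⟨?_, ?_, ?_, ?_, ?_, ?_, f1⟩
        · refine Ctx.frame ?_ fF (by simp)
          repeat refine Ctx.setVar ?_ (by simp) _
          exact hC₁
        · rw [fF.1 5 (by simp), hwA]; simp [g5]
        · rw [fF.1 6 (by simp), hwA, hcb]; simp [g6]
        · rw [fF.1 7 (by simp), hwA, hcb]; simp [g7, g5, hp]
        · rw [fF.1 17 (by simp)]; simp [g17]
        · rw [hwA, hcb]; exact ⟨Z', f2, hAp.mono (by omega)⟩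
  · intro hpos
    simp [h6] at hpos
    -- No free column remains up to column `c`, so this column must be a pivot.
    have e1 : E 0 c = 1 := by
      rcases hE.zero_or_one hc with e0 | e1
      · omega
      · exact e1
    have hwc : wt E c = c := by omega
    refine (putPivotProg_spec (m := m) hS hE hc e1 (hC.setVar (by simp) _) ?_ ?_ ?_ ?_ ?_
      ?_).mono (by omega) ?_
    · simp [h5]; omega
    · simp [h6]; omega
    · simp [h7]; rw [hws, e1, hwc]; simp
    · simp [h17]
    · obtain ⟨Z, hZ1, hZ2⟩ := hH
      refine ⟨Z, hZ1, ?_⟩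
      rw [idx_succ, colTerm_pivot_self e1 hwc, add_zero, hws, e1, hwc, Nat.sub_self] at hZ2
      rw [hwc, Nat.sub_self]
      unfold Approx at *
      rwa [gam_zero_right] at *
    · simp [hout]
    · rintro s' ⟨f1, f2, f3, f4, f5, f6, f7⟩
      exact ⟨f1, f2, f3, f4, f5, f6.mono (by omega), f7⟩

/-- The decoding program. -/
def decodeProg : Prog :=
  setupProg ;; inputProg ;; growProg ;; .arith 7 .sub (.var 4) (.var 1) ;;
  .arith 17 .add (.var 1) (.lit 0) ;; .while (.lit 0) (.var 17) decColProg

theorem decodeProg_spec (hS : Sizes q n k B) (hE : Valid q n E) (hk : wt E n = k) :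
    Tri q B decodeProg (initState q n k (digitArray q (idx q E n)))
      ((n + 1) * digitLen q B + 100 * ((n + 1) * numLen n k)) fun s => s.arr 1 = rowArr n E := by
  have hq := hS.hq
  have hkn := hS.hk
  have b1 := hS.positions
  have hlen := Sizes.le_numLen n k
  have hidx := hE.idx_lt_pow hS hk le_rfl
  have hcost : n * (numLen n k * 36 + digitLen q B + 7 * n + 30 + 1) + 1 + 1 + 1 +
      (k * (numLen n k * 18 + 8) + 1) + (5 * numLen n k + 3) + (digitLen q B + 11) ≤
      (n + 1) * digitLen q B + 100 * ((n + 1) * numLen n k) := by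
    have h1 : k * (numLen n k * 18 + 8) ≤ n * (numLen n k * 18 + 8) := Nat.mul_le_mul_right _ hkn
    have h2 : n * (numLen n k * 36 + digitLen q B + 7 * n + 30 + 1) ≤
        n * (numLen n k * 42 + digitLen q B) := Nat.mul_le_mul_left _ (by omega)
    have h3 : n * (numLen n k * 18 + 8) ≤ n * (numLen n k * 19) := Nat.mul_le_mul_left _ (by omega)
    nlinarith
  refine Tri.mono ?_ hcost fun _ h => h
  refine Tri.seq (setupProg_spec hS) ?_
  rintro s ⟨hC, h5, h6, h17, hin, hout, h2⟩
  refine Tri.seq (inputProg_spec hS hC hidx hin h2) ?_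
  rintro s₁ ⟨g2, gF⟩
  have hC₁ : Ctx q n k s₁ := hC.frame gF (by simp)
  refine Tri.seq (growProg_spec hS hC₁ (by rw [gF.1 5 (by simp), h5])
    (by rw [gF.1 6 (by simp), h6]) hidx ⟨_, g2, Approx.start (by omega) (by omega) (by simp)⟩) ?_
  rintro s₂ ⟨hC₂, f5, f6, fH, fout⟩
  refine Tri.step (Tri.sub ?_ ?_ ?_)
  · simp [hC₂.v4]; omega
  · simp [hC₂.v1]; omega
  refine Tri.step (Tri.add ?_ ?_ ?_)
  · simp [hC₂.v1]; omega
  · simp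
  -- The error count starts at `k`, from `growProg`, and grows by at most two per column, which
  -- stays within `3 * n`.
  refine (Tri.loop (c := numLen n k * 36 + digitLen q B + 7 * n + 30) (fun i s' =>
    DecInv q n k E (n - i) (k + 2 * i) s') n ?_ ?_ ?_ ?_).mono le_rfl ?_
  · rw [Nat.sub_zero]
    refine ⟨(hC₂.setVar (by simp) _).setVar (by simp) _, ?_, ?_, ?_, ?_, ?_, ?_⟩
    · simp [f5, hk]
    · simp [f6, hk]
    -- The units position for `(k, n - k)` is `numLen n k - n`.
    · simp [hC₂.v4, hC₂.v1, hk]; omega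
    · simp [hC₂.v1]
    · rw [hk]; exact fH.of_arr rfl
    · simp only [State.setVar_arr, fout, gF.2 1 (by simp), hout]
      funext t
      unfold partOut
      split_ifs with h
      · exact (hE.out _ _ h).symm
      · rfl
  · rintro i hi s' hI
    simp only [Operand.val_lit, Operand.val_var, hI.v17]
    omega
  · rintro i hi s' hI
    refine ⟨by simp [hI.v17]; omega, ?_⟩
    obtain ⟨c, hc⟩ : ∃ c, n - i = c + 1 := ⟨n - i - 1, by omega⟩
    rw [hc] at hI
    rw [show n - (i + 1) = c by omega]
    exact decColProg_spec (m := k + 2 * i) hS hE hk (by omega) (by omega) hI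
  · rintro s' hI
    simp [hI.v17]
  · rintro s' hI
    rw [hI.output, Nat.sub_self]
    funext t
    simp [partOut]

end GrassEnc

namespace GrassEnc

/-! ### The running time -/

/-- A bound for all numbers that the programs handle. -/
def maxNum (q n k : ℕ) : ℕ := 4 * (q * q) * (numLen n k + (n + 2) * (n + 2))

theorem sizes_maxNum {q n k : ℕ} (hq : 2 ≤ q) (hk : k ≤ n) : Sizes q n k (maxNum q n k) := by
  have hlen := Sizes.le_numLen n k
  have hqq : 4 ≤ q * q := Nat.mul_le_mul hq hq
  have hq1 : 2 * q ≤ q * q := Nat.mul_le_mul_right q hq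
  have hn : n ≤ (n + 2) * (n + 2) := by nlinarith
  have h4 : numLen n k + (n + 2) * (n + 2) ≤ q * q * (numLen n k + (n + 2) * (n + 2)) :=
    Nat.le_mul_of_pos_left _ (by omega)
  refine ⟨hq, hk, ?_, ?_, ?_⟩
  · have h1 : 2 * (numLen n k * q) ≤ numLen n k * (q * q) := by nlinarith
    have h2 : 8 * (q * q) ≤ numLen n k * (q * q) := Nat.mul_le_mul_right _ (by omega)
    have h3 : numLen n k * (q * q) ≤ q * q * (numLen n k + (n + 2) * (n + 2)) := by
      rw [mul_comm]; exact Nat.mul_le_mul_left _ (Nat.le_add_right _ _)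
    unfold maxNum
    rw [mul_assoc (numLen n k), mul_assoc 4]
    omega
  · unfold maxNum
    rw [mul_assoc 4]
    omega
  · unfold maxNum
    rw [mul_assoc 4]
    omega

theorem one_lt_log {n : ℕ} (hn : 3 ≤ n) : 1 < Real.log n := by
  rw [Real.lt_log_iff_exp_lt (by positivity)]
  have : (3 : ℝ) ≤ n := by exact_mod_cast hn
  linarith [Real.exp_one_lt_d9]

/-- From `maxNum q n k ≤ q ^ 4 * n ^ 4` and `log q ≥ log 2` the integer logarithm is at most `4 + 6
* log n`. The remaining constant `5` is absorbed by `log n > 1`, which needs `n ≥ 3`. -/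
theorem digitLen_maxNum_le {q n k : ℕ} (hq : 2 ≤ q) (hn : 3 ≤ n) (hk : k ≤ n) :
    (digitLen q (maxNum q n k) : ℝ) ≤ 11 * Real.log n := by
  have hlog := one_lt_log hn
  have hmax : maxNum q n k ≤ q ^ 4 * n ^ 4 := by
    have h1 : k * (n - k) ≤ n * n := Nat.mul_le_mul hk (Nat.sub_le _ _)
    have h2 : numLen n k + (n + 2) * (n + 2) ≤ n ^ 4 := by
      unfold numLen
      have : 9 * (n * n) ≤ n ^ 4 := by
        calc 9 * (n * n) ≤ (n * n) * (n * n) := Nat.mul_le_mul_right _ (by nlinarith)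
          _ = n ^ 4 := by ring
      nlinarith
    have h3 : 4 * (q * q) ≤ q ^ 4 := by
      calc 4 * (q * q) ≤ (q * q) * (q * q) := Nat.mul_le_mul_right _ (Nat.mul_le_mul hq hq)
        _ = q ^ 4 := by ring
    exact Nat.mul_le_mul h3 h2
  have hpos : maxNum q n k ≠ 0 := by
    have := (sizes_maxNum hq hk).addresses
    have : 0 < (n + 2) * (n + 2) := by positivity
    omega
  have hpow : q ^ Nat.log q (maxNum q n k) ≤ q ^ 4 * n ^ 4 :=
    (Nat.pow_log_le_self q hpos).trans hmax
  set l := Nat.log q (maxNum q n k) with hl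
  have hpowR : ((q : ℝ)) ^ l ≤ (q : ℝ) ^ 4 * (n : ℝ) ^ 4 := by exact_mod_cast hpow
  have hq0 : (0 : ℝ) < q := by positivity
  have hn0 : (0 : ℝ) < n := by positivity
  have h1 := Real.log_le_log (by positivity) hpowR
  rw [Real.log_mul (by positivity) (by positivity), Real.log_pow, Real.log_pow, Real.log_pow] at h1
  have hq2 : Real.log 2 ≤ Real.log q := Real.log_le_log (by norm_num) (by exact_mod_cast hq)
  have hl2 := Real.log_two_gt_d9
  have h2 : (l : ℝ) ≤ 4 + 6 * Real.log n := by
    by_contra hlt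
    push Not at hlt
    push_cast at h1
    nlinarith
  have : (digitLen q (maxNum q n k) : ℝ) = l + 1 := by simp [digitLen, hl]
  rw [this]
  linarith

theorem time_le {q n k t : ℕ} (hq : 2 ≤ q) (hn : 3 ≤ n) (hk0 : 0 < k) (hkn : k < n)
    (ht : t ≤ ((n + 1) * digitLen q (maxNum q n k) + 100 * ((n + 1) * numLen n k)) *
      (2 * digitLen q (maxNum q n k))) :
    (t : ℝ) ≤ 40000 / Real.log (Real.log 3) *
      (n * k * (n - k) * Real.log n * Real.log (Real.log n)) := by
  have hD := digitLen_maxNum_le hq hn hkn.le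
  set D := digitLen q (maxNum q n k)
  have hlog := one_lt_log hn
  have hlog3 : 1 < Real.log 3 := by simpa using one_lt_log (le_refl 3)
  have hll3 : 0 < Real.log (Real.log 3) := Real.log_pos hlog3
  have hll : Real.log (Real.log 3) ≤ Real.log (Real.log n) :=
    Real.log_le_log (by linarith) (Real.log_le_log (by norm_num) (by exact_mod_cast hn))
  have hnR : (3 : ℝ) ≤ n := by exact_mod_cast hn
  have hlogn : Real.log n ≤ n := (Real.log_le_sub_one_of_pos (by linarith)).trans (by linarith)
  set N : ℝ := (k : ℝ) * (n - k) with hN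
  have hlen : (numLen n k : ℝ) = N + 5 * n + 8 := by
    rw [← Sizes.le_numLen]
    push_cast [hkn.le]
    rw [hN]; ring
  have hk1 : (1 : ℝ) ≤ k := by exact_mod_cast hk0
  have hk2 : (1 : ℝ) ≤ (n : ℝ) - k := by
    have : (k : ℝ) + 1 ≤ n := by exact_mod_cast hkn
    linarith
  -- This is `(k - 1) * (n - k - 1) ≥ 0`. It makes the `5 * n + 8` extra digits, and also the cost
  -- `D` of a general product, `O(N)`.
  have hNn : (n : ℝ) - 1 ≤ N := by rw [hN]; nlinarith
  have hlenN : (numLen n k : ℝ) ≤ 13 * N := by rw [hlen]; linarith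
  have hDN : (D : ℝ) ≤ 17 * N := by linarith
  have hD0 : (0 : ℝ) ≤ D := by positivity
  have hN0 : 0 < N := by linarith
  -- Here `n + 1 ≤ 4 / 3 * n` and `17 + 100 * 13 = 1317`, and `4 / 3 * 1317 = 1756`.
  have hc : (n + 1 : ℝ) * D + 100 * ((n + 1) * numLen n k) ≤ 1756 * (n * N) := by
    have h1 : (n + 1 : ℝ) * (D + 100 * numLen n k) ≤ (4 / 3 * n) * (1317 * N) :=
      mul_le_mul (by linarith) (by linarith) (by positivity) (by positivity)
    linarith
  have htR : (t : ℝ) ≤ ((n + 1 : ℝ) * D + 100 * ((n + 1) * numLen n k)) * (2 * D) := by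
    exact_mod_cast ht
  have h2 : ((n + 1 : ℝ) * D + 100 * ((n + 1) * numLen n k)) * (2 * D) ≤
      1756 * (n * N) * (2 * (11 * Real.log n)) :=
    mul_le_mul hc (by linarith) (by positivity) (by positivity)
  have hX : 0 ≤ n * N * Real.log n := by positivity
  -- The constant comes from `1756 * 2 * 11 ≤ 40000`. The factor `log log n` enters only through its
  -- minimum `log log 3`.
  calc (t : ℝ) ≤ 40000 * (n * N * Real.log n) := by linarith
    _ = 40000 / Real.log (Real.log 3) * (n * N * Real.log n * Real.log (Real.log 3)) := by
        field_simp
    _ ≤ 40000 / Real.log (Real.log 3) * (n * N * Real.log n * Real.log (Real.log n)) := by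
        gcongr
    _ = _ := by rw [hN]; ring

theorem matArray_EXT {F : Type*} [Field F] [Fintype F] {n k : ℕ} (σ : F ≃ Fin (Fintype.card F))
    (X : Submodule F (Fin n → F)) : matArray (EXT σ k X) = rowArr n (extArr σ k X) :=
  funext fun t => matArray_eq _ t

end GrassEnc

/-! ### The main theorem -/

theorem mainTheorem4 :
    ∃ (enc dec : GrassEnc.Prog) (C : ℝ),
      ∀ (F : Type*) [Field F] [Fintype F] (σ : F ≃ Fin (Fintype.card F)),
        (σ 0 : ℕ) = 0 → (σ 1 : ℕ) = 1 →
        ∀ n k : ℕ, k ≤ n →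
          (∀ X ∈ GrassEnc.Gr F n k, ∃ (s : GrassEnc.State) (t : ℕ),
            GrassEnc.Exec (Fintype.card F) enc
              (GrassEnc.initState (Fintype.card F) n k
                (GrassEnc.matArray (GrassEnc.EXT σ k X))) s t ∧
            s.arr 1 = GrassEnc.digitArray (Fintype.card F) (GrassEnc.Ind₂ σ k X) ∧
            (3 ≤ n → 0 < k → k < n →
              (t : ℝ) ≤ C * (n * k * (n - k) * Real.log n * Real.log (Real.log n)))) ∧
          (∀ i < (GrassEnc.Gr F n k).ncard, ∃ X ∈ GrassEnc.Gr F n k,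
            GrassEnc.Ind₂ σ k X = i ∧
            ∃ (s : GrassEnc.State) (t : ℕ),
              GrassEnc.Exec (Fintype.card F) dec
                (GrassEnc.initState (Fintype.card F) n k
                  (GrassEnc.digitArray (Fintype.card F) i)) s t ∧
              s.arr 1 = GrassEnc.matArray (GrassEnc.EXT σ k X) ∧
              (3 ≤ n → 0 < k → k < n →
                (t : ℝ) ≤ C * (n * k * (n - k) * Real.log n * Real.log (Real.log n)))) := by
  refine ⟨GrassEnc.encodeProg, GrassEnc.decodeProg, 40000 / Real.log (Real.log 3), ?_⟩
  intro F _ _ σ h0 h1 n k hkn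
  have hq : 2 ≤ Fintype.card F := Fintype.one_lt_card
  have hS := GrassEnc.sizes_maxNum hq hkn
  constructor
  · intro X hX
    obtain ⟨s, t, hexec, ht, hs⟩ := GrassEnc.encodeProg_spec hS (GrassEnc.valid_extArr h0 h1 hX)
      (GrassEnc.wt_extArr hX)
    refine ⟨s, t, ?_, ?_, fun hn hk0 hk1 => GrassEnc.time_le hq hn hk0 hk1 (ht.trans ?_)⟩
    · rw [GrassEnc.matArray_EXT]; exact hexec
    · rw [GrassEnc.Ind₂_eq h0 h1 hkn hX]; exact hs
    -- The encoder makes a single general product, the decoder up to one per column besides; the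
    -- decoder's bound serves for both.
    · gcongr
      exact Nat.le_mul_of_pos_left _ (by omega)
  · intro i hi
    rw [GrassEnc.ncard_Gr h0 h1 hkn] at hi
    obtain ⟨X, hX, rfl⟩ := (GrassEnc.bijOn_idx h0 h1 hkn).surjOn hi
    obtain ⟨s, t, hexec, ht, hs⟩ := GrassEnc.decodeProg_spec hS (GrassEnc.valid_extArr h0 h1 hX)
      (GrassEnc.wt_extArr hX)
    refine ⟨X, hX, GrassEnc.Ind₂_eq h0 h1 hkn hX, s, t, hexec, ?_,
      fun hn hk0 hk1 => GrassEnc.time_le hq hn hk0 hk1 ht⟩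
    rw [GrassEnc.matArray_EXT]; exact hs
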